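/- **Setting.** Let $\mathcal O\subset\mathbb R^3$ be a bounded open set with Lipschitz boundary, $\partial\mathcal O=\overline S\cup\overline\Omega$, $S\cap\Omega=\emptyset$, where $\Omega\subset\{x_3=0\}$ is open in the plane $\{x_3=0\}$, $S\subset\{x_3\le 0\}$, and $\partial\mathcal O\setminus(S\cup\Omega)$ has surface measure zero. Let $\mathbf n$ be the unit outward normal, so $\mathbf n|_\Omega=(0,0,1)$. Let $\nu,\eta>0$, $\lambda\ge 0$, $\epsilon_{ij}(u)=\frac12(\partial_iu_j+\partial_ju_i)$, $\sigma(u)=2\nu\epsilon(u)+\lambda(\operatorname{div}u)I$, and $\mathbf V_0=\{v\in \mathbf H^1(\mathcal O): v\cdot\mathbf n=0\text{ on }\partial\mathcal O\}$. Let $\mathbf U\in\mathbf V_0$ be a real field with $\mathbf U\in L^\infty(\mathcal O)$, $\operatorname{div}\mathbf U\in L^\infty(\mathcal O)$ and $\mathbf U|_\Omega\in C^2(\overline\Omega)$. All other function spaces are over $\mathbb R$ or over $\mathbb C$. Put $$\mathcal H=L^2(\mathcal O)\times \mathbf L^2(\mathcal O)\times H^2_0(\Omega)\times L^2(\Omega),$$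 $$([p,u,w_1,w_2],[\tilde p,\tilde u,\tilde w_1,\tilde w_2])_{\mathcal H}=(p,\tilde p)_{\mathcal O}+(u,\tilde u)_{\mathcal O}+(\Delta w_1,\Delta\tilde w_1)_\Omega+(w_2,\tilde w_2)_\Omega .$$ Let $\mathring A=\Delta^2$ with domain $\{w\in H^2_0(\Omega):\Delta^2w\in L^2(\Omega)\}$, $H_N=\operatorname{span}\{[1,0,\mathring A^{-1}(1),0]\}$ and $$H_N^\perp=\Big\{[p,u,w_1,w_2]\in\mathcal H:\ \int_{\mathcal O}p+\int_\Omega w_1=0\Big\}.$$ For $\varphi=[p,u,w_1,w_2]$ let $$\mathcal A\varphi=\big[-\mathbf U\cdot\nabla p-\operatorname{div}u,\ \ \operatorname{div}\sigma(u)-\nabla p-\eta u-\mathbf U\cdot\nabla u,\ \ w_2,\ \ p|_\Omega-[2\nu\partial_{x_3}u_3+\lambda\operatorname{div}u]_\Omega-\Delta^2w_1\big],$$ $$B\varphi=\big[-\operatorname{div}(\mathbf U)p,\ 0,\ \mathbf U\cdot\nabla w_1,\ 0\big],$$ with derivatives in the sense of distributions. The domain $D(\mathcal A+B)$ is the set of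 all $[p,u,w_1,w_2]\in L^2(\mathcal O)\times\mathbf H^1(\mathcal O)\times H_0^2(\Omega)\times L^2(\Omega)$ such that - $\mathbf U\cdot\nabla p\in L^2(\mathcal O)$ and $\operatorname{div}\sigma(u)-\nabla p\in\mathbf L^2(\mathcal O)$; - $-\Delta^2w_1-[2\nu\partial_{x_3}u_3+\lambda\operatorname{div}u]_\Omega+p|_\Omega\in L^2(\Omega)$, where $[2\nu\partial_{x_3}u_3+\lambda\operatorname{div}u]_\Omega-p|_\Omega$ is the third component on $\Omega$ of $\sigma(u)\mathbf n-p\mathbf n\in\mathbf H^{-1/2}(\partial\mathcal O)$; - $\langle\sigma(u)\mathbf n-p\mathbf n,\tau\rangle_{\partial\mathcal O}=0$ for all $\tau\in \mathbf H^{1/2}(\partial\mathcal O)$ with $\tau\cdot\mathbf n=0$; - $w_2+\mathbf U\cdot\nabla w_1\in H^2_0(\Omega)$; - $u=f+\tilde f$ with $f\in\mathbf V_0$ and $\tilde f\in\mathbf H^1(\mathcal O)$ such that $\tilde f=0$ on $S$ and $\tilde f=(w_2+\mathbf U\cdot\nabla w_1)\mathbf n$ on $\Omega$. **Lemma.** 1.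 $[1,0,\mathring A^{-1}(1),0]\in\mathcal H$, and $H_N^\perp$ is the orthogonal complement of $H_N$ in $\mathcal H$. 2. $\mathcal A+B$ maps $D(\mathcal A+B)\cap H_N^\perp$ into $H_N^\perp$; equivalently, $\big((\mathcal A+B)\varphi,[1,0,\mathring A^{-1}(1),0]\big)_{\mathcal H}=0$ for every $\varphi\in D(\mathcal A+B)\cap H_N^\perp$. 3. The feedback terms in $B$ compensate exactly for the change of the mean under $\mathcal A$: for every $\varphi=[p,u,w_1,w_2]\in D(\mathcal A+B)\cap H_N^\perp$, $$\int_{\mathcal O}(-\mathbf U\cdot\nabla p-\operatorname{div}u)+\int_\Omega w_2=-\Big(-\int_{\mathcal O}\operatorname{div}(\mathbf U)\,p+\int_\Omega\mathbf U\cdot\nabla w_1\Big).$$ -/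

import Mathlib

open MeasureTheory Set Filter Topology
open scoped ENNReal ContDiff

noncomputable section

namespace FSI

/-- Euclidean space `ℝᵈ`. -/
abbrev E (d : ℕ) : Type := EuclideanSpace ℝ (Fin d)

section Sobolev

variable {d : ℕ} {F : Type*} [NormedAddCommGroup F] [NormedSpace ℝ F]

/-- Classical partial derivative `∂ᵢ φ`. -/
def pd (i : Fin d) (φ : E d → F) (x : E d) : F :=
  fderiv ℝ φ x (EuclideanSpace.single i (1 : ℝ))

/-- Classical Laplacian. -/
def lap (φ : E d → F) (x : E d) : F := ∑ i, pd i (pd i φ) x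

/-- `φ ∈ C_c^∞(D)`. -/
def IsTest (D : Set (E d)) (φ : E d → F) : Prop :=
  ContDiff ℝ ∞ φ ∧ HasCompactSupport φ ∧ tsupport φ ⊆ D

/-- `f ∈ L²(D)`. Elements of `L²` are represented by functions; only values almost everywhere
in `D` matter. -/
def MemL2 (D : Set (E d)) (f : E d → F) : Prop := MemLp f 2 (volume.restrict D)

/-- `g ∈ L²(D)` is the weak partial derivative `∂ᵢ f` on `D`. -/
def HasWeakPartial (D : Set (E d)) (i : Fin d) (f g : E d → F) : Prop :=
  MemL2 D g ∧ ∀ φ : E d → ℝ, IsTest D φ →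
    ∫ x in D, pd i φ x • f x = - ∫ x in D, φ x • g x

open Classical in
/-- The weak partial derivative `∂ᵢ f` in `L²(D)` (zero if there is none). -/
def weakPartial (D : Set (E d)) (i : Fin d) (f : E d → F) : E d → F :=
  if h : ∃ g, HasWeakPartial D i f g then h.choose else 0

/-- `f ∈ H¹(D)`. -/
def MemH1 (D : Set (E d)) (f : E d → F) : Prop :=
  MemL2 D f ∧ ∀ i, ∃ g, HasWeakPartial D i f g

/-- `f ∈ H²(D)`. -/
def MemH2 (D : Set (E d)) (f : E d → F) : Prop :=
  MemH1 D f ∧ ∀ i, MemH1 D (weakPartial D i f)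

/-- The weak Laplacian on `D`. -/
def weakLap (D : Set (E d)) (f : E d → F) (x : E d) : F :=
  ∑ i, weakPartial D i (weakPartial D i f) x

/-- The weak divergence on `D`. -/
def weakDiv (D : Set (E d)) (v : Fin d → E d → F) (x : E d) : F :=
  ∑ i, weakPartial D i (v i) x

/-- The smooth functions `φ k` converge to `f` in `H¹(D)`. -/
def TendstoH1 (D : Set (E d)) (φ : ℕ → E d → F) (f : E d → F) : Prop :=
  Tendsto (fun k => eLpNorm (φ k - f) 2 (volume.restrict D)) atTop (𝓝 0) ∧
  ∀ i, Tendsto (fun k => eLpNorm (pd i (φ k) - weakPartial D i f) 2 (volume.restrict D))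
    atTop (𝓝 0)

/-- `f ∈ H₀²(D)`, the closure of `C_c^∞(D)` in `H²(D)`. -/
def MemH02 (D : Set (E d)) (f : E d → F) : Prop :=
  MemH2 D f ∧ ∃ φ : ℕ → E d → F, (∀ k, IsTest D (φ k)) ∧ TendstoH1 D φ f ∧
    ∀ i, TendstoH1 D (fun k => pd i (φ k)) (weakPartial D i f)

/-- `z ∈ H₀²(D)` and `Δ² z = f` in the sense of distributions on `D`; for `f ∈ L²(D)` this says
that `z` is in the domain of the clamped biharmonic operator and is mapped to `f` by it. -/
def IsClampedBiharmonic (D : Set (E d)) (z f : E d → F) : Prop :=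
  MemH02 D z ∧ ∀ θ : E d → ℝ, IsTest D θ →
    ∫ x in D, lap θ x • weakLap D z x = ∫ x in D, θ x • f x

open Classical in
/-- The inverse of the clamped biharmonic operator. -/
def clampedInv (D : Set (E d)) (f : E d → F) : E d → F :=
  if h : ∃ z, IsClampedBiharmonic D z f then h.choose else 0

end Sobolev

section Boundary

variable {F : Type*} [NormedAddCommGroup F] [NormedSpace ℝ F]

/-- The plane `ℝ²` as the plane `x₃ = 0` in `ℝ³`. -/
def embed (x : E 2) : E 3 := !₂[x 0, x 1, 0]

/-- `O ⊂ ℝ³` has a Lipschitz boundary: near every boundary point, in suitable Cartesian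
coordinates, it is the set below the graph of a Lipschitz function. -/
def HasLipschitzBoundary (O : Set (E 3)) : Prop :=
  ∀ x ∈ frontier O, ∃ R : E 3 ≃ₗᵢ[ℝ] E 3, ∃ ζ : E 2 → ℝ, (∃ K, LipschitzWith K ζ) ∧
    ∃ r > 0, ∀ y ∈ Metric.ball x r, (y ∈ O ↔ R y 2 < ζ !₂[R y 0, R y 1])

/-- Surface measure on `∂O` (two-dimensional Hausdorff measure, up to a constant factor that
depends on the normalization and plays no role here). -/
def surf (O : Set (E 3)) : Measure (E 3) := (Measure.hausdorffMeasure 2).restrict (frontier O)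

/-- `n` is the unit outward normal to `O` at `x`: close to `x`, every cone strictly inside the
half space opposite to `n` is in `O`, and every cone strictly inside the half space on the side of
`n` is outside `O`. There is at most one such `n`; if the boundary is a Lipschitz graph near `x`,
there is one if the graph function is differentiable at the point in question, hence at almost
every boundary point. -/
def IsOuterNormal (O : Set (E 3)) (x n : E 3) : Prop :=
  ‖n‖ = 1 ∧ ∀ ε > 0, ∃ r > 0, ∀ y ∈ Metric.ball x r,
    (inner ℝ n (y - x) < -(ε * ‖y - x‖) → y ∈ O) ∧
    (ε * ‖y - x‖ < inner ℝ n (y - x) → y ∉ O)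

/-- `g ∈ L²(∂O)` is the boundary trace of `f ∈ H¹(O)`: the limit in `L²(∂O)` of the boundary
values of smooth functions that converge to `f` in `H¹(O)`. -/
def HasTrace (O : Set (E 3)) (f g : E 3 → F) : Prop :=
  MemH1 O f ∧ MemLp g 2 (surf O) ∧
  ∃ φ : ℕ → E 3 → F, (∀ k, ContDiff ℝ ∞ (φ k)) ∧ TendstoH1 O φ f ∧
    Tendsto (fun k => eLpNorm (φ k - g) 2 (surf O)) atTop (𝓝 0)

open Classical in
/-- The boundary trace of `f`. -/
def trace (O : Set (E 3)) (f : E 3 → F) : E 3 → F :=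
  if h : ∃ g, HasTrace O f g then h.choose else 0

/-- `V₀`: the fields `v ∈ H¹(O)` with `v · n = 0` on `∂O` in the sense of traces. -/
def MemV0 (O : Set (E 3)) (v : Fin 3 → E 3 → F) : Prop :=
  ∃ g : Fin 3 → E 3 → F, (∀ i, HasTrace O (v i) (g i)) ∧
    ∀ᵐ x ∂(surf O), ∀ n : E 3, IsOuterNormal O x n → ∑ i, n i • g i x = 0

/-- `v ∈ H¹(O)` has the boundary trace `0` on `S` and `h n = (0, 0, h)` on the flat part. -/
def HasPlateTrace (O S : Set (E 3)) (Ω : Set (E 2)) (v : Fin 3 → E 3 → F) (h : E 2 → F) : Prop :=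
  ∃ g : Fin 3 → E 3 → F, (∀ i, HasTrace O (v i) (g i)) ∧
    (∀ᵐ x ∂(surf O), x ∈ S → ∀ i, g i x = 0) ∧
    ∀ᵐ x ∂(volume.restrict Ω), ∀ i, g i (embed x) = if i = 2 then h x else 0

end Boundary

/-- The geometry: `O ⊂ ℝ³` is bounded and open with Lipschitz boundary, `∂O` is the union of the
closures of the disjoint sets `S ⊂ {x₃ ≤ 0}` and `Ω ⊂ {x₃ = 0}`, where `Ω` is open in the plane,
and their interface has surface measure zero. As `O` then lies below the plane `x₃ = 0`, the unit
outward normal on `Ω` is `(0, 0, 1)`. -/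
structure IsFlowGeometry (O S : Set (E 3)) (Ω : Set (E 2)) : Prop where
  isOpen : IsOpen O
  isBounded : Bornology.IsBounded O
  lipschitz : HasLipschitzBoundary O
  isOpen_plate : IsOpen Ω
  disjoint : Disjoint S (embed '' Ω)
  frontier_eq : frontier O = closure S ∪ closure (embed '' Ω)
  below : ∀ x ∈ S, x 2 ≤ 0
  interface_null : surf O (frontier O \ (S ∪ embed '' Ω)) = 0

/-- The ambient field: `U ∈ H¹(O)` real, `U · n = 0` on `∂O`, `U ∈ L^∞(O)`, `div U ∈ L^∞(O)`,
and the trace of `U` on `Ω` is of class `C²` up to the boundary of `Ω`. -/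
structure IsAmbientField (O : Set (E 3)) (Ω : Set (E 2)) (U : Fin 3 → E 3 → ℝ) : Prop where
  memV0 : MemV0 O U
  bounded : ∀ i, MemLp (U i) ⊤ (volume.restrict O)
  div_bounded : MemLp (weakDiv O U) ⊤ (volume.restrict O)
  trace_C2 : ∀ i, ∃ b : E 2 → ℝ, ContDiffOn ℝ 2 b (closure Ω) ∧
    ∀ᵐ x ∂(volume.restrict Ω), trace O (U i) (embed x) = b x

section Generator

variable {𝕜 : Type*} [RCLike 𝕜]

/-- Quadruples `[p, u, w₁, w₂]` of functions on `ℝ³`, `ℝ³`, `ℝ²`, `ℝ²`. -/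
abbrev State (𝕜 : Type*) : Type _ :=
  (E 3 → 𝕜) × (Fin 3 → E 3 → 𝕜) × (E 2 → 𝕜) × (E 2 → 𝕜)

/-- Pressure. -/
abbrev State.p (φ : State 𝕜) : E 3 → 𝕜 := φ.1
/-- Flow velocity. -/
abbrev State.u (φ : State 𝕜) : Fin 3 → E 3 → 𝕜 := φ.2.1
/-- Plate displacement. -/
abbrev State.w₁ (φ : State 𝕜) : E 2 → 𝕜 := φ.2.2.1
/-- Plate velocity. -/
abbrev State.w₂ (φ : State 𝕜) : E 2 → 𝕜 := φ.2.2.2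

/-- The finite energy space `H = L²(O) × L²(O)³ × H₀²(Ω) × L²(Ω)`. -/
def energySpace (𝕜 : Type*) [RCLike 𝕜] (O : Set (E 3)) (Ω : Set (E 2)) : Set (State 𝕜) :=
  {φ | MemL2 O φ.p ∧ (∀ i, MemL2 O (φ.u i)) ∧ MemH02 Ω φ.w₁ ∧ MemL2 Ω φ.w₂}

/-- The standard inner product of `H`. -/
def energyInner (O : Set (E 3)) (Ω : Set (E 2)) (φ ψ : State 𝕜) : 𝕜 :=
  (∫ x in O, φ.p x * starRingEnd 𝕜 (ψ.p x))
    + (∑ i, ∫ x in O, φ.u i x * starRingEnd 𝕜 (ψ.u i x))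
    + (∫ x in Ω, weakLap Ω φ.w₁ x * starRingEnd 𝕜 (weakLap Ω ψ.w₁ x))
    + ∫ x in Ω, φ.w₂ x * starRingEnd 𝕜 (ψ.w₂ x)

/-- The vector `[1, 0, Å⁻¹(1), 0]`. -/
def nullVec (𝕜 : Type*) [RCLike 𝕜] (Ω : Set (E 2)) : State 𝕜 :=
  (fun _ => 1, 0, clampedInv Ω (fun _ => 1), 0)

/-- `H_N`, the span of `[1, 0, Å⁻¹(1), 0]`. -/
def HN (𝕜 : Type*) [RCLike 𝕜] (Ω : Set (E 2)) : Submodule 𝕜 (State 𝕜) :=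
  Submodule.span 𝕜 {nullVec 𝕜 Ω}

/-- The functional `∫_O p + ∫_Ω w₁`. -/
def mean (O : Set (E 3)) (Ω : Set (E 2)) (φ : State 𝕜) : 𝕜 :=
  (∫ x in O, φ.p x) + ∫ x in Ω, φ.w₁ x

/-- `H_N^⊥ = {φ ∈ H : ∫_O p + ∫_Ω w₁ = 0}`. -/
def HNperp (𝕜 : Type*) [RCLike 𝕜] (O : Set (E 3)) (Ω : Set (E 2)) : Set (State 𝕜) :=
  {φ | φ ∈ energySpace 𝕜 O Ω ∧ mean O Ω φ = 0}

/-- The strain tensor `ε(v)`. -/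
def strain (O : Set (E 3)) (v : Fin 3 → E 3 → 𝕜) (i j : Fin 3) (x : E 3) : 𝕜 :=
  (1 / 2 : ℝ) • (weakPartial O i (v j) x + weakPartial O j (v i) x)

/-- The stress tensor `σ(v) = 2 ν ε(v) + lam (tr ε(v)) I`. -/
def stress (O : Set (E 3)) (ν lam : ℝ) (v : Fin 3 → E 3 → 𝕜) (i j : Fin 3) (x : E 3) : 𝕜 :=
  (2 * ν) • strain O v i j x + if i = j then lam • ∑ k, strain O v k k x else 0

/-- `g ∈ L²(O)` is `U · ∇p` in the sense of distributions on `O`, that is,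
`⟨U · ∇p, φ⟩ = - ∫ p div (φ U)`. -/
def HasTransport (O : Set (E 3)) (U : Fin 3 → E 3 → ℝ) (p g : E 3 → 𝕜) : Prop :=
  MemL2 O g ∧ ∀ φ : E 3 → ℝ, IsTest O φ →
    ∫ x in O, φ x • g x = - ∫ x in O, ((∑ i, U i x * pd i φ x) + weakDiv O U x * φ x) • p x

open Classical in
/-- `U · ∇p`, for `p ∈ L²(O)` such that this distribution is in `L²(O)`. -/
def transport (O : Set (E 3)) (U : Fin 3 → E 3 → ℝ) (p : E 3 → 𝕜) : E 3 → 𝕜 :=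
  if h : ∃ g, HasTransport O U p g then h.choose else 0

/-- `g ∈ L²(O)` is the `i`-th component of `div σ(u) - ∇p` in the sense of distributions. -/
def HasStressDiv (O : Set (E 3)) (ν lam : ℝ) (p : E 3 → 𝕜) (u : Fin 3 → E 3 → 𝕜) (i : Fin 3)
    (g : E 3 → 𝕜) : Prop :=
  MemL2 O g ∧ ∀ φ : E 3 → ℝ, IsTest O φ →
    ∫ x in O, φ x • g x
      = - ∫ x in O, ((∑ j, pd j φ x • stress O ν lam u i j x) - pd i φ x • p x)

open Classical in
/-- The `i`-th component of `div σ(u) - ∇p`, if it is in `L²(O)`. -/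
def stressDiv (O : Set (E 3)) (ν lam : ℝ) (p : E 3 → 𝕜) (u : Fin 3 → E 3 → 𝕜) (i : Fin 3) :
    E 3 → 𝕜 :=
  if h : ∃ g, HasStressDiv O ν lam p u i g then h.choose else 0

/-- The duality pairing `⟨σ(u) n - p n, v⟩` on `∂O`, given by Green's formula, for `v ∈ H¹(O)`
and `div σ(u) - ∇p ∈ L²(O)`; it depends on `v` only through the trace of `v`. -/
def tractionPairing (O : Set (E 3)) (ν lam : ℝ) (p : E 3 → 𝕜) (u v : Fin 3 → E 3 → 𝕜) : 𝕜 :=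
  ∫ x in O, ((∑ i, ∑ j, stress O ν lam u i j x * strain O v i j x)
    - p x * weakDiv O v x + ∑ i, stressDiv O ν lam p u i x * v i x)

/-- `f ∈ L²(Ω)` is `-Δ² w - [2 ν ∂₃ u₃ + lam div u]_Ω + p|_Ω` in the sense of distributions on
`Ω`. On `Ω`, where `n = (0, 0, 1)`, the quantity `2 ν ∂₃ u₃ + lam div u - p` is the third component
of `σ(u) n - p n`; it is paired with a test function `θ` on `Ω` through any `v ∈ H¹(O)` with trace
`(0, 0, θ)` on `Ω` and `0` on `S`. -/
def HasPlateForce (O S : Set (E 3)) (Ω : Set (E 2)) (ν lam : ℝ) (p : E 3 → 𝕜)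
    (u : Fin 3 → E 3 → 𝕜) (w f : E 2 → 𝕜) : Prop :=
  MemL2 Ω f ∧ ∀ θ : E 2 → ℝ, IsTest Ω θ → ∀ v : Fin 3 → E 3 → 𝕜,
    HasPlateTrace O S Ω v (fun x => (θ x : 𝕜)) →
      ∫ x in Ω, θ x • f x
        = - (∫ x in Ω, lap θ x • weakLap Ω w x) - tractionPairing O ν lam p u v

open Classical in
/-- `-Δ² w - [2 ν ∂₃ u₃ + lam div u]_Ω + p|_Ω`, if it is in `L²(Ω)`. -/
def plateForce (O S : Set (E 3)) (Ω : Set (E 2)) (ν lam : ℝ) (p : E 3 → 𝕜)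
    (u : Fin 3 → E 3 → 𝕜) (w : E 2 → 𝕜) : E 2 → 𝕜 :=
  if h : ∃ f, HasPlateForce O S Ω ν lam p u w f then h.choose else 0

/-- `U · ∇w` on `Ω`, where `U` is evaluated through its trace and `w` depends on `x₁, x₂` only. -/
def plateTransport (O : Set (E 3)) (Ω : Set (E 2)) (U : Fin 3 → E 3 → ℝ) (w : E 2 → 𝕜)
    (x : E 2) : 𝕜 :=
  trace O (U 0) (embed x) • weakPartial Ω 0 w x + trace O (U 1) (embed x) • weakPartial Ω 1 w x

/-- The operator `A`, with rows
`-U · ∇p - div u`, `-∇p + div σ(u) - η u - U · ∇u`, `w₂`,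
`p|_Ω - [2 ν ∂₃ u₃ + lam div u]_Ω - Δ² w₁`. -/
def opA (O S : Set (E 3)) (Ω : Set (E 2)) (U : Fin 3 → E 3 → ℝ) (ν lam η : ℝ) (φ : State 𝕜) :
    State 𝕜 :=
  (fun x => - transport O U φ.p x - weakDiv O φ.u x,
   fun i x => stressDiv O ν lam φ.p φ.u i x - η • φ.u i x
     - ∑ j, U j x • weakPartial O j (φ.u i) x,
   φ.w₂,
   plateForce O S Ω ν lam φ.p φ.u φ.w₁)

/-- The feedback operator `B`, with rows `-div(U) p`, `0`, `U · ∇w₁`, `0`. -/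
def opB (O : Set (E 3)) (Ω : Set (E 2)) (U : Fin 3 → E 3 → ℝ) (φ : State 𝕜) : State 𝕜 :=
  (fun x => - (weakDiv O U x • φ.p x), 0, plateTransport O Ω U φ.w₁, 0)

/-- The operator `A + B`. -/
def opAB (O S : Set (E 3)) (Ω : Set (E 2)) (U : Fin 3 → E 3 → ℝ) (ν lam η : ℝ) (φ : State 𝕜) :
    State 𝕜 :=
  opA O S Ω U ν lam η φ + opB O Ω U φ

/-- The domain `D(A + B)`. -/
structure MemDomain (O S : Set (E 3)) (Ω : Set (E 2)) (U : Fin 3 → E 3 → ℝ) (ν lam : ℝ)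
    (φ : State 𝕜) : Prop where
  p_mem : MemL2 O φ.p
  u_mem : ∀ i, MemH1 O (φ.u i)
  w₁_mem : MemH02 Ω φ.w₁
  w₂_mem : MemL2 Ω φ.w₂
  /-- `U · ∇p ∈ L²(O)` -/
  transport_mem : ∃ g, HasTransport O U φ.p g
  /-- `div σ(u) - ∇p ∈ L²(O)` -/
  stressDiv_mem : ∀ i, ∃ g, HasStressDiv O ν lam φ.p φ.u i g
  /-- `-Δ² w₁ - [2 ν ∂₃ u₃ + lam div u]_Ω + p|_Ω ∈ L²(Ω)` -/
  plateForce_mem : ∃ f, HasPlateForce O S Ω ν lam φ.p φ.u φ.w₁ f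
  /-- `σ(u) n - p n` annihilates all tangential fields of class `H^{1/2}` on `∂O`, which are the
  traces of the elements of `V₀`. -/
  traction_tangential : ∀ v : Fin 3 → E 3 → 𝕜, MemV0 O v →
    tractionPairing O ν lam φ.p φ.u v = 0
  /-- `w₂ + U · ∇w₁ ∈ H₀²(Ω)` -/
  velocity_mem : MemH02 Ω (φ.w₂ + plateTransport O Ω U φ.w₁)
  /-- `u = f₀ + f₁` with `f₀ ∈ V₀` and `f₁` equal to `0` on `S` and to `(w₂ + U · ∇w₁) n`
  on `Ω`. -/
  velocity_match : ∃ f₀ f₁ : Fin 3 → E 3 → 𝕜, MemV0 O f₀ ∧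
    HasPlateTrace O S Ω f₁ (φ.w₂ + plateTransport O Ω U φ.w₁) ∧
    ∀ i, φ.u i =ᵐ[volume.restrict O] f₀ i + f₁ i

end Generator

end FSI

end

open FSI

/-!
The proof rests on the mean value functional `φ ↦ ∫_O p + ∫_Ω w₁`.

It is the inner product with `[1, 0, Å⁻¹ 1, 0]`: for `w ∈ H₀²(Ω)`, Green's formula
`IsClampedBiharmonic.integral_weakLap_mul_conj` gives `(Δ w, Δ Å⁻¹ 1) = ∫_Ω w`. The solution
`Å⁻¹ 1` exists because `|∫ θ| ≤ C ‖Δ θ‖` for test functions `θ` on the bounded set `Ω`, so that the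
functional is represented by an element of the `L²` closure of `{Δ θ}`, and because `‖Δ θ‖` controls
all second derivatives of a test function (`exists_isClampedBiharmonic_real`).

The mean value of `(A + B) φ` is `-∫ U · ∇p - ∫ div u - ∫ (div U) p + ∫ (w₂ + U · ∇w₁)`, and it
vanishes by two applications of the divergence theorem.

* If `V ∈ V₀`, there are test functions `φₙ` on `O` that are bounded uniformly, converge to `1`, and
  satisfy `V · ∇φₙ → 0` in `L²(O)` (`MemV0.exists_tendsto_one`). They are functions of
  `h / δ` with a regularized `h`, where locally `O = {h > 0}` and `h` is the height of the graph
  over a point. The gradient of such a cutoff has the size `1 / δ` and is normal to the boundary, and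
  on the layer `{0 < h < δ}` the field `V` differs from its trace by `o(δ)` in `L²`; since the trace
  is tangential, `V · ∇φₙ` tends to zero. Testing with `φₙ` gives `∫ U · ∇p = -∫ (div U) p` and
  `∫ div f₀ = 0` for the part `f₀ ∈ V₀` of `u`, without any integration on the boundary.
* The same layers give `|∫_O ∂ᵢ f| ≤ C ‖f|_∂O‖` with the norm of `L²(∂O)`
  (`exists_enorm_integral_weakPartial_le`). Near the plate, `O` is the lower half space, so a test
  function `θ` on `Ω` extends to a smooth function `W` on `ℝ³` that vanishes on the rest of the
  boundary, with `∫_O ∂₃ W = ∫_Ω θ`. Applied to the difference of `f₁` and `(0, 0, W)`, where `θ` is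
  close to `w₂ + U · ∇w₁`, the bound yields `∫ div f₁ = ∫_Ω (w₂ + U · ∇w₁)` for the other part `f₁`
  of `u` (`HasPlateTrace.integral_weakDiv`).
-/

namespace FSI

/-! ### Integrals and convergence in `L²` -/

section LTwo

theorem tendsto_eLpNorm_sub_congr {α ι F : Type*} [MeasurableSpace α] {μ : Measure α}
    [NormedAddCommGroup F] {l : Filter ι} {f : ι → α → F} {g g' : α → F}
    (hg : g =ᵐ[μ] g') (h : Tendsto (fun k => eLpNorm (f k - g) 2 μ) l (𝓝 0)) :
    Tendsto (fun k => eLpNorm (f k - g') 2 μ) l (𝓝 0) := by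
  refine h.congr fun k => eLpNorm_congr_ae ?_
  filter_upwards [hg] with x hx
  simp [hx]

variable {α : Type*} [MeasurableSpace α] {μ : Measure α}
  {𝕂 F : Type*} [RCLike 𝕂] [NormedAddCommGroup F] [NormedSpace 𝕂 F]

theorem integrable_smul_of_memLp_two {φ : α → 𝕂} {f : α → F} (hφ : MemLp φ 2 μ)
    (hf : MemLp f 2 μ) : Integrable (fun x => φ x • f x) μ :=
  memLp_one_iff_integrable.1 (hf.smul hφ (p := 2) (q := 2) (r := 1))

theorem enorm_integral_smul_le [NormedSpace ℝ F] {φ : α → 𝕂} {f : α → F} (hφ : AEStronglyMeasurable φ μ)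
    (hf : AEStronglyMeasurable f μ) :
    ‖∫ x, φ x • f x ∂μ‖ₑ ≤ eLpNorm φ 2 μ * eLpNorm f 2 μ := by
  refine (enorm_integral_le_lintegral_enorm _).trans ?_
  rw [← eLpNorm_one_eq_lintegral_enorm]
  exact eLpNorm_smul_le_mul_eLpNorm hf hφ

theorem tendsto_integral_smul_right [NormedSpace ℝ F] {ι : Type*} {l : Filter ι} {φ : α → 𝕂} {f : ι → α → F}
    {f₀ : α → F} (hφ : MemLp φ 2 μ) (hf : ∀ k, MemLp (f k) 2 μ) (hf₀ : MemLp f₀ 2 μ)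
    (h : Tendsto (fun k => eLpNorm (f k - f₀) 2 μ) l (𝓝 0)) :
    Tendsto (fun k => ∫ x, φ x • f k x ∂μ) l (𝓝 (∫ x, φ x • f₀ x ∂μ)) := by
  rw [tendsto_iff_edist_tendsto_0]
  have h0 : Tendsto (fun k => eLpNorm φ 2 μ * eLpNorm (f k - f₀) 2 μ) l (𝓝 0) := by
    simpa using ENNReal.Tendsto.const_mul h (Or.inr hφ.2.ne)
  refine tendsto_of_tendsto_of_tendsto_of_le_of_le tendsto_const_nhds h0 (fun _ => zero_le) ?_
  intro k
  simp only
  rw [edist_eq_enorm_sub, ← integral_sub (integrable_smul_of_memLp_two hφ (hf k))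
    (integrable_smul_of_memLp_two hφ hf₀)]
  simp_rw [← smul_sub]
  exact enorm_integral_smul_le hφ.1 ((hf k).sub hf₀).1

theorem tendsto_integral_smul_left [NormedSpace ℝ F] {ι : Type*} {l : Filter ι} {φ : ι → α → 𝕂} {φ₀ : α → 𝕂}
    {f : α → F} (hφ : ∀ k, MemLp (φ k) 2 μ) (hφ₀ : MemLp φ₀ 2 μ) (hf : MemLp f 2 μ)
    (h : Tendsto (fun k => eLpNorm (φ k - φ₀) 2 μ) l (𝓝 0)) :
    Tendsto (fun k => ∫ x, φ k x • f x ∂μ) l (𝓝 (∫ x, φ₀ x • f x ∂μ)) := by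
  rw [tendsto_iff_edist_tendsto_0]
  have h0 : Tendsto (fun k => eLpNorm (φ k - φ₀) 2 μ * eLpNorm f 2 μ) l (𝓝 0) := by
    simpa using ENNReal.Tendsto.mul_const h (Or.inr hf.2.ne)
  refine tendsto_of_tendsto_of_tendsto_of_le_of_le tendsto_const_nhds h0 (fun _ => zero_le) ?_
  intro k
  simp only
  rw [edist_eq_enorm_sub, ← integral_sub (integrable_smul_of_memLp_two (hφ k) hf)
    (integrable_smul_of_memLp_two hφ₀ hf)]
  simp_rw [← sub_smul]
  exact enorm_integral_smul_le ((hφ k).sub hφ₀).1 hf.1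

end LTwo

/-! ### Weak derivatives -/

section Weak

variable {d : ℕ} {D : Set (E d)} {i : Fin d} {F F' : Type*} [NormedAddCommGroup F]
  [NormedSpace ℝ F] [NormedAddCommGroup F'] [NormedSpace ℝ F']

theorem contDiff_pd {φ : E d → F} (h : ContDiff ℝ ∞ φ) (i : Fin d) : ContDiff ℝ ∞ (pd i φ) :=
  (h.fderiv_right (m := ∞) (by simp)).clm_apply contDiff_const

theorem tsupport_pd_subset (i : Fin d) (φ : E d → F) : tsupport (pd i φ) ⊆ tsupport φ := by
  refine (closure_mono ?_).trans (tsupport_fderiv_subset ℝ (f := φ))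
  intro x hx h
  exact hx (by simp [pd, h])

theorem IsTest.pd {φ : E d → F} (h : IsTest D φ) (i : Fin d) : IsTest D (pd i φ) :=
  ⟨contDiff_pd h.1 i, h.2.1.mono' ((subset_tsupport _).trans (tsupport_pd_subset i φ)),
    (tsupport_pd_subset i φ).trans h.2.2⟩

theorem IsTest.memLp {φ : E d → F} (h : IsTest D φ) (p : ℝ≥0∞) (μ : Measure (E d))
    [IsFiniteMeasureOnCompacts μ] : MemLp φ p μ :=
  h.1.continuous.memLp_of_hasCompactSupport h.2.1

theorem IsTest.memL2 {φ : E d → F} (h : IsTest D φ) : MemL2 D φ := h.memLp _ _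

theorem IsTest.mono {φ : E d → F} {D' : Set (E d)} (h : IsTest D φ) (hD : D ⊆ D') :
    IsTest D' φ := ⟨h.1, h.2.1, h.2.2.trans hD⟩

theorem IsTest.add {φ ψ : E d → F} (h : IsTest D φ) (h' : IsTest D ψ) :
    IsTest D (fun x => φ x + ψ x) :=
  ⟨h.1.add h'.1, h.2.1.add h'.2.1, (tsupport_add φ ψ).trans (union_subset h.2.2 h'.2.2)⟩

theorem IsTest.comp_clm {φ : E d → F} (h : IsTest D φ) (L : F →L[ℝ] F') :
    IsTest D (fun x => L (φ x)) := by
  refine ⟨L.contDiff.comp h.1, h.2.1.comp_left (g := L) (by simp), ?_⟩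
  refine (closure_mono ?_).trans h.2.2
  intro x hx h0
  exact hx (by simp [h0])

theorem pd_clm_comp {φ : E d → F} {x : E d} (h : DifferentiableAt ℝ φ x) (L : F →L[ℝ] F')
    (i : Fin d) : pd i (fun y => L (φ y)) x = L (pd i φ x) := by
  unfold pd
  have : HasFDerivAt (fun y => L (φ y)) (L ∘L fderiv ℝ φ x) x :=
    L.hasFDerivAt.comp x h.hasFDerivAt
  rw [this.fderiv]; rfl

theorem pd_add {φ ψ : E d → F} {x : E d} (h : DifferentiableAt ℝ φ x)
    (h' : DifferentiableAt ℝ ψ x) (i : Fin d) :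
    pd i (fun y => φ y + ψ y) x = pd i φ x + pd i ψ x := by
  unfold pd
  rw [fderiv_fun_add h h']; rfl

theorem pd_sub {φ ψ : E d → F} {x : E d} (h : DifferentiableAt ℝ φ x)
    (h' : DifferentiableAt ℝ ψ x) (i : Fin d) :
    pd i (φ - ψ) x = pd i φ x - pd i ψ x := by
  unfold pd
  rw [fderiv_sub h h']; rfl

theorem pd_smul {φ : E d → ℝ} {ψ : E d → F} {x : E d} (h : DifferentiableAt ℝ φ x)
    (h' : DifferentiableAt ℝ ψ x) (i : Fin d) :
    pd i (fun y => φ y • ψ y) x = φ x • pd i ψ x + pd i φ x • ψ x := by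
  unfold pd
  rw [fderiv_fun_smul h h']; rfl

theorem pd_eq_zero_of_notMem {φ : E d → F} {x : E d} (h : x ∉ tsupport φ) (i : Fin d) :
    pd i φ x = 0 :=
  image_eq_zero_of_notMem_tsupport fun hx => h (tsupport_pd_subset i φ hx)

theorem fderiv_apply_eq_sum_pd (φ : E d → F) (x v : E d) :
    fderiv ℝ φ x v = ∑ i, v i • pd i φ x := by
  have hv : v = ∑ i, v i • EuclideanSpace.single i (1 : ℝ) := by
    simpa using ((EuclideanSpace.basisFun (Fin d) ℝ).sum_repr v).symm
  conv_lhs => rw [hv]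
  simp [pd]

theorem norm_pd_le (φ : E d → F) (x : E d) (i : Fin d) : ‖pd i φ x‖ ≤ ‖fderiv ℝ φ x‖ := by
  simpa [pd] using (fderiv ℝ φ x).le_opNorm (EuclideanSpace.single i (1 : ℝ))

/-- Integration by parts against a test function. -/
theorem integral_pd_smul_eq_neg {φ : E d → ℝ} {f : E d → F} (hφ : IsTest D φ)
    (hf : ContDiff ℝ 1 f) (i : Fin d) :
    ∫ x in D, pd i φ x • f x = - ∫ x in D, φ x • pd i f x := by
  have hfc : Continuous (pd i f) :=
    (hf.continuous_fderiv (by simp)).clm_apply continuous_const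
  have h1 : ∫ x in D, pd i φ x • f x = ∫ x, pd i φ x • f x := by
    refine setIntegral_eq_integral_of_forall_compl_eq_zero fun x hx => ?_
    rw [pd_eq_zero_of_notMem (fun h => hx (hφ.2.2 h)), zero_smul]
  have h2 : ∫ x in D, φ x • pd i f x = ∫ x, φ x • pd i f x := by
    refine setIntegral_eq_integral_of_forall_compl_eq_zero fun x hx => ?_
    rw [image_eq_zero_of_notMem_tsupport (fun h => hx (hφ.2.2 h)), zero_smul]
  rw [h1, h2]
  have hcs : ∀ {ψ : E d → ℝ} {g : E d → F}, IsTest D ψ → Continuous g →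
      Integrable (fun x => ψ x • g x) := fun hψ hg =>
    (hψ.1.continuous.smul hg).integrable_of_hasCompactSupport hψ.2.1.smul_right
  have := integral_bilinear_hasFDerivAt_right_eq_neg_left_of_integrable (μ := volume)
    (f := φ) (g := f) (f' := fderiv ℝ φ) (g' := fderiv ℝ f) (B := ContinuousLinearMap.lsmul ℝ ℝ)
    (v := EuclideanSpace.single i (1 : ℝ)) (hcs (hφ.pd i) hf.continuous) (hcs hφ hfc)
    (hcs hφ hf.continuous)
    (fun x _ => (hφ.1.differentiable (by simp) x).hasFDerivAt)
    (fun x _ => (hf.differentiable (by simp) x).hasFDerivAt)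
  simp only [ContinuousLinearMap.lsmul_apply] at this
  simp only [FSI.pd]
  rw [this, neg_neg]

theorem hasWeakPartial_pd {f : E d → F} (hf : ContDiff ℝ 1 f) (h : MemL2 D (pd i f)) :
    HasWeakPartial D i f (pd i f) :=
  ⟨h, fun _ hφ => integral_pd_smul_eq_neg hφ hf i⟩

theorem IsTest.integrable_smul {φ : E d → ℝ} {f : E d → F} (hφ : IsTest D φ) (hf : MemL2 D f) :
    Integrable (fun x => φ x • f x) (volume.restrict D) :=
  integrable_smul_of_memLp_two hφ.memL2 hf

theorem HasWeakPartial.congr {f f' g g' : E d → F} (h : HasWeakPartial D i f g)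
    (hf : f =ᵐ[volume.restrict D] f') (hg : g =ᵐ[volume.restrict D] g') :
    HasWeakPartial D i f' g' := by
  refine ⟨h.1.ae_eq hg, fun φ hφ => ?_⟩
  have h1 : ∫ x in D, pd i φ x • f' x = ∫ x in D, pd i φ x • f x :=
    integral_congr_ae (by filter_upwards [hf] with x hx; rw [hx])
  have h2 : ∫ x in D, φ x • g' x = ∫ x in D, φ x • g x :=
    integral_congr_ae (by filter_upwards [hg] with x hx; rw [hx])
  rw [h1, h2, h.2 φ hφ]

theorem HasWeakPartial.add {f f' g g' : E d → F} (h : HasWeakPartial D i f g)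
    (h' : HasWeakPartial D i f' g') (hf : MemL2 D f) (hf' : MemL2 D f') :
    HasWeakPartial D i (f + f') (g + g') := by
  refine ⟨h.1.add h'.1, fun φ hφ => ?_⟩
  simp only [Pi.add_apply, smul_add]
  rw [integral_add ((hφ.pd i).integrable_smul hf) ((hφ.pd i).integrable_smul hf'),
    integral_add (hφ.integrable_smul h.1) (hφ.integrable_smul h'.1), h.2 φ hφ, h'.2 φ hφ, neg_add]

theorem HasWeakPartial.sub {f f' g g' : E d → F} (h : HasWeakPartial D i f g)
    (h' : HasWeakPartial D i f' g') (hf : MemL2 D f) (hf' : MemL2 D f') :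
    HasWeakPartial D i (f - f') (g - g') := by
  refine ⟨h.1.sub h'.1, fun φ hφ => ?_⟩
  simp only [Pi.sub_apply, smul_sub]
  rw [integral_sub ((hφ.pd i).integrable_smul hf) ((hφ.pd i).integrable_smul hf'),
    integral_sub (hφ.integrable_smul h.1) (hφ.integrable_smul h'.1), h.2 φ hφ, h'.2 φ hφ]
  abel

/-- Weak derivatives are closed under `L²` convergence. -/
theorem HasWeakPartial.of_tendsto {f g : ℕ → E d → F} {f₀ g₀ : E d → F}
    (h : ∀ k, HasWeakPartial D i (f k) (g k)) (hf : ∀ k, MemL2 D (f k)) (hf₀ : MemL2 D f₀)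
    (hg₀ : MemL2 D g₀)
    (h1 : Tendsto (fun k => eLpNorm (f k - f₀) 2 (volume.restrict D)) atTop (𝓝 0))
    (h2 : Tendsto (fun k => eLpNorm (g k - g₀) 2 (volume.restrict D)) atTop (𝓝 0)) :
    HasWeakPartial D i f₀ g₀ := by
  refine ⟨hg₀, fun φ hφ => ?_⟩
  refine tendsto_nhds_unique (tendsto_integral_smul_right (hφ.pd i).memL2 hf hf₀ h1) ?_
  refine (tendsto_integral_smul_right hφ.memL2 (fun k => (h k).1) hg₀ h2).neg.congr fun k => ?_
  rw [(h k).2 φ hφ]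

/-- Functions in `L²(D)` that agree as distributions on `D` agree almost everywhere in `D`. -/
theorem ae_eq_of_forall_test [CompleteSpace F] (hD : IsOpen D) {f g : E d → F} (hf : MemL2 D f)
    (hg : MemL2 D g) (h : ∀ φ : E d → ℝ, IsTest D φ → ∫ x in D, φ x • f x = ∫ x in D, φ x • g x) :
    f =ᵐ[volume.restrict D] g := by
  have hl : LocallyIntegrableOn (f - g) D (volume.restrict D) :=
    ((hf.sub hg).locallyIntegrable (by norm_num)).locallyIntegrableOn D
  have := hD.ae_eq_zero_of_integral_contDiff_smul_eq_zero hl (fun φ h1 h2 h3 => by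
    have hφ : IsTest D φ := ⟨h1, h2, h3⟩
    simp only [Pi.sub_apply, smul_sub]
    rw [integral_sub (hφ.integrable_smul hf) (hφ.integrable_smul hg), h φ hφ, sub_self])
  filter_upwards [this, ae_restrict_mem hD.measurableSet] with x hx hxD
  exact sub_eq_zero.1 (hx hxD)

theorem HasWeakPartial.ae_eq [CompleteSpace F] (hD : IsOpen D) {f g g' : E d → F}
    (h : HasWeakPartial D i f g) (h' : HasWeakPartial D i f g') : g =ᵐ[volume.restrict D] g' :=
  ae_eq_of_forall_test hD h.1 h'.1 fun φ hφ => by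
    rw [← neg_inj, ← h.2 φ hφ, ← h'.2 φ hφ]

theorem hasWeakPartial_weakPartial {f : E d → F} (h : ∃ g, HasWeakPartial D i f g) :
    HasWeakPartial D i f (weakPartial D i f) := by
  rw [weakPartial, dif_pos h]
  exact h.choose_spec

theorem MemH1.hasWeakPartial {f : E d → F} (h : MemH1 D f) (i : Fin d) :
    HasWeakPartial D i f (weakPartial D i f) := hasWeakPartial_weakPartial (h.2 i)

theorem HasWeakPartial.weakPartial_ae [CompleteSpace F] (hD : IsOpen D) {f g : E d → F}
    (h : HasWeakPartial D i f g) : weakPartial D i f =ᵐ[volume.restrict D] g :=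
  (hasWeakPartial_weakPartial ⟨g, h⟩).ae_eq hD h

theorem MemH1.sub {f f' : E d → F} (h : MemH1 D f) (h' : MemH1 D f') : MemH1 D (f - f') :=
  ⟨h.1.sub h'.1, fun i => ⟨_, (h.hasWeakPartial i).sub (h'.hasWeakPartial i) h.1 h'.1⟩⟩

theorem MemH1.weakPartial_sub [CompleteSpace F] (hD : IsOpen D) {f f' : E d → F} (h : MemH1 D f)
    (h' : MemH1 D f') (i : Fin d) :
    weakPartial D i (f - f') =ᵐ[volume.restrict D] weakPartial D i f - weakPartial D i f' :=
  ((h.hasWeakPartial i).sub (h'.hasWeakPartial i) h.1 h'.1).weakPartial_ae hD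

theorem IsTest.hasWeakPartial {D' : Set (E d)} {f : E d → F} (hf : IsTest D' f) (i : Fin d) :
    HasWeakPartial D i f (FSI.pd i f) :=
  hasWeakPartial_pd (hf.1.of_le (by simp)) ((hf.pd i).memLp _ _)

theorem IsTest.memH1 {D' : Set (E d)} {f : E d → F} (hf : IsTest D' f) : MemH1 D f :=
  ⟨hf.memLp _ _, fun i => ⟨_, hf.hasWeakPartial i⟩⟩

end Weak

/-! ### The clamped biharmonic problem -/

section Biharmonic

variable {d : ℕ} (D : Set (E d))

/-- The space of real test functions on `D`. -/
def testSpace : Submodule ℝ (E d → ℝ) where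
  carrier := {θ | IsTest D θ}
  add_mem' h h' := h.add h'
  zero_mem' := ⟨contDiff_const, HasCompactSupport.zero, by simp [tsupport]⟩
  smul_mem' c _ h := h.comp_clm (c • ContinuousLinearMap.id ℝ ℝ)

variable {D}

theorem testSpace.differentiable (θ : testSpace D) : Differentiable ℝ (θ : E d → ℝ) :=
  θ.2.1.differentiable (by simp)

theorem testSpace.memL2 (θ : testSpace D) : MemL2 D (θ : E d → ℝ) := IsTest.memL2 θ.2

/-- The class in `L²(D)` of a test function. -/
noncomputable def testToL2 : testSpace D →ₗ[ℝ] Lp ℝ 2 (volume.restrict D) where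
  toFun θ := (testSpace.memL2 θ).toLp _
  map_add' _ _ := rfl
  map_smul' _ _ := rfl

/-- Partial differentiation of test functions. -/
noncomputable def testPd (i : Fin d) : testSpace D →ₗ[ℝ] testSpace D where
  toFun θ := ⟨pd i θ, IsTest.pd θ.2 i⟩
  map_add' θ θ' := by
    ext x
    exact pd_add (testSpace.differentiable θ x) (testSpace.differentiable θ' x) i
  map_smul' c θ := by
    ext x
    exact pd_clm_comp (testSpace.differentiable θ x) (c • ContinuousLinearMap.id ℝ ℝ) i

/-- The Laplacian of test functions. -/
noncomputable def testLap : testSpace D →ₗ[ℝ] testSpace D := ∑ i, testPd i ∘ₗ testPd i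

theorem testPd_comm (i j : Fin d) (θ : testSpace D) :
    testPd i (testPd j θ) = testPd j (testPd i θ) := by
  ext x
  have h2 : Differentiable ℝ (fderiv ℝ (θ : E d → ℝ)) :=
    (θ.2.1.fderiv_right (m := ∞) (by simp)).differentiable (by simp)
  have key : ∀ i j, pd i (pd j (θ : E d → ℝ)) x
      = fderiv ℝ (fderiv ℝ (θ : E d → ℝ)) x (EuclideanSpace.single i 1)
        (EuclideanSpace.single j 1) := by
    intro i j
    have : HasFDerivAt (pd j (θ : E d → ℝ)) _ x :=
      (h2 x).hasFDerivAt.clm_apply (hasFDerivAt_const (EuclideanSpace.single j (1 : ℝ)) x)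
    rw [pd, this.fderiv]
    simp
  change pd i (pd j (θ : E d → ℝ)) x = pd j (pd i (θ : E d → ℝ)) x
  rw [key, key]
  exact (θ.2.1.contDiffAt.isSymmSndFDerivAt
    (by simpa using WithTop.coe_le_coe.2 (le_top : (2 : ℕ∞) ≤ ⊤))) _ _

theorem testLap_coe (θ : testSpace D) : (testLap θ : E d → ℝ) = lap (θ : E d → ℝ) := by
  ext x
  simp [testLap, lap, testPd]

theorem inner_testToL2 (a b : testSpace D) :
    inner ℝ (testToL2 a) (testToL2 b) = ∫ x in D, (a : E d → ℝ) x * (b : E d → ℝ) x := by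
  rw [L2.inner_def]
  refine integral_congr_ae ?_
  filter_upwards [(testSpace.memL2 a).coeFn_toLp, (testSpace.memL2 b).coeFn_toLp] with x ha hb
  have h1 : (testToL2 a : E d → ℝ) x = (a : E d → ℝ) x := ha
  have h2 : (testToL2 b : E d → ℝ) x = (b : E d → ℝ) x := hb
  rw [h1, h2, real_inner_eq_re_inner]
  simp [mul_comm]

theorem inner_testPd_left (i : Fin d) (a b : testSpace D) :
    inner ℝ (testToL2 (testPd i a)) (testToL2 b)
      = - inner ℝ (testToL2 a) (testToL2 (testPd i b)) := by
  rw [inner_testToL2, inner_testToL2]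
  exact integral_pd_smul_eq_neg a.2 (b.2.1.of_le (by simp)) i

theorem norm_sq_testPd_testPd (i j : Fin d) (θ : testSpace D) :
    ‖testToL2 (testPd i (testPd j θ))‖ ^ 2
      = inner ℝ (testToL2 (testPd j (testPd j θ))) (testToL2 (testPd i (testPd i θ))) := by
  rw [← real_inner_self_eq_norm_sq, inner_testPd_left, testPd_comm i j θ,
    testPd_comm i j (testPd i θ), inner_testPd_left j (testPd j θ)]

/-- The Hessian of a test function is controlled by its Laplacian. -/
theorem norm_testPd_testPd_le (i j : Fin d) (θ : testSpace D) :
    ‖testToL2 (testPd i (testPd j θ))‖ ≤ ‖testToL2 (testLap θ)‖ := by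
  have h : ‖testToL2 (testLap θ)‖ ^ 2
      = ∑ i, ∑ j, ‖testToL2 (testPd i (testPd j θ))‖ ^ 2 := by
    simp_rw [norm_sq_testPd_testPd]
    rw [← real_inner_self_eq_norm_sq]
    simp only [testLap, LinearMap.sum_apply, LinearMap.comp_apply, map_sum, sum_inner, inner_sum]
  refine le_of_sq_le_sq ?_ (norm_nonneg _)
  rw [h]
  refine (Finset.single_le_sum (f := fun j => ‖testToL2 (testPd i (testPd j θ))‖ ^ 2)
    (fun j _ => sq_nonneg _) (Finset.mem_univ j)).trans ?_
  exact Finset.single_le_sum (f := fun i => ∑ j, ‖testToL2 (testPd i (testPd j θ))‖ ^ 2)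
    (fun i _ => Finset.sum_nonneg fun j _ => sq_nonneg _) (Finset.mem_univ i)

/-- Poincaré's inequality, from `∫ θ² = - ∫ 2 xᵢ θ ∂ᵢθ` and Young's inequality. -/
theorem norm_testToL2_le {R : ℝ} (hR : 0 ≤ R) (i : Fin d) (hD : MeasurableSet D)
    (h : ∀ x ∈ D, |x i| ≤ R) (θ : testSpace D) :
    ‖testToL2 θ‖ ≤ 2 * R * ‖testToL2 (testPd i θ)‖ := by
  set f : E d → ℝ := (θ : E d → ℝ) with hf
  set g : E d → ℝ := (testPd i θ : E d → ℝ) with hg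
  have hfi : Integrable (fun x => f x * f x) (volume.restrict D) :=
    integrable_smul_of_memLp_two (testSpace.memL2 θ) (testSpace.memL2 θ)
  have hgi : Integrable (fun x => g x * g x) (volume.restrict D) :=
    integrable_smul_of_memLp_two (testSpace.memL2 (testPd i θ)) (testSpace.memL2 (testPd i θ))
  have hsq : IsTest D (fun x => f x * f x) := by
    refine ⟨θ.2.1.mul θ.2.1, θ.2.2.1.mul_right, ?_⟩
    have hsub : Function.support (fun x => f x * f x) ⊆ Function.support f := by
      intro x hx h0
      exact hx (by simp [h0])
    exact (closure_mono hsub).trans θ.2.2.2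
  have hpdsq : ∀ x, pd i (fun x => f x * f x) x = 2 * (f x * g x) := by
    intro x
    have := pd_smul (testSpace.differentiable θ x) (testSpace.differentiable θ x) i
    simp only [smul_eq_mul] at this
    change pd i (fun x => f x * f x) x = f x * g x + g x * f x at this
    rw [this]; ring
  have hx1 : ∀ x : E d, pd i (fun y : E d => y i) x = 1 := by
    intro x
    have : HasFDerivAt (fun y : E d => y i) (EuclideanSpace.proj i : E d →L[ℝ] ℝ) x :=
      (EuclideanSpace.proj i : E d →L[ℝ] ℝ).hasFDerivAt
    rw [pd, this.fderiv]; simp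
  have hxc : ContDiff ℝ 1 (fun y : E d => y i) := (EuclideanSpace.proj i : E d →L[ℝ] ℝ).contDiff
  have ibp := integral_pd_smul_eq_neg hsq hxc i
  simp only [hpdsq, hx1, smul_eq_mul, mul_one] at ibp
  have hmono : ∫ x in D, f x * f x ≤ ∫ x in D, (1 / 2 * (f x * f x) + 2 * R ^ 2 * (g x * g x)) := by
    rw [← neg_eq_iff_eq_neg.2 ibp, ← integral_neg]
    refine integral_mono_ae ?_ ((hfi.const_mul _).add (hgi.const_mul _)) ?_
    · have hi : Integrable (fun x : E d => pd i (fun x => f x * f x) x * x i) volume :=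
        ((hsq.pd i).1.continuous.mul hxc.continuous).integrable_of_hasCompactSupport
          (hsq.pd i).2.1.mul_right
      simp only [hpdsq] at hi
      exact hi.neg.restrict
    · filter_upwards [ae_restrict_mem hD] with x hx
      have h1 := abs_le.1 (h x hx)
      have h2 : (x i) ^ 2 ≤ R ^ 2 := sq_le_sq' h1.1 h1.2
      nlinarith [sq_nonneg (f x + 2 * (x i) * g x), mul_le_mul_of_nonneg_right h2 (sq_nonneg (g x))]
  rw [integral_add (hfi.const_mul _) (hgi.const_mul _), integral_const_mul, integral_const_mul]
    at hmono
  have e1 : ‖testToL2 θ‖ ^ 2 = ∫ x in D, f x * f x := by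
    rw [← real_inner_self_eq_norm_sq, inner_testToL2]
  have e2 : ‖testToL2 (testPd i θ)‖ ^ 2 = ∫ x in D, g x * g x := by
    rw [← real_inner_self_eq_norm_sq, inner_testToL2]
  rw [← e1, ← e2] at hmono
  refine le_of_sq_le_sq ?_ (by positivity)
  nlinarith

/-- A linear functional on a space `T` that is dominated by a linear map into a Hilbert space is
represented by an element of the closure of the range of that map. -/
theorem exists_mem_closure_range_inner_eq {T X : Type*} [AddCommGroup T] [Module ℝ T]
    [NormedAddCommGroup X] [InnerProductSpace ℝ X] [CompleteSpace X] (Λ : T →ₗ[ℝ] X)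
    (J : T →ₗ[ℝ] ℝ) (C : ℝ) (h : ∀ t, |J t| ≤ C * ‖Λ t‖) :
    ∃ q ∈ closure (range Λ), ∀ t, inner ℝ q (Λ t) = J t := by
  have hker : LinearMap.ker Λ ≤ LinearMap.ker J := by
    intro t ht
    have := h t
    rw [LinearMap.mem_ker.1 ht, norm_zero, mul_zero] at this
    exact LinearMap.mem_ker.2 (abs_nonpos_iff.1 this)
  let f : LinearMap.range Λ →ₗ[ℝ] ℝ :=
    (LinearMap.ker Λ).liftQ J hker ∘ₗ Λ.quotKerEquivRange.symm.toLinearMap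
  have hf : ∀ t, f ⟨Λ t, t, rfl⟩ = J t := by
    intro t
    have : Λ.quotKerEquivRange.symm ⟨Λ t, t, rfl⟩ = (LinearMap.ker Λ).mkQ t := by
      rw [LinearEquiv.symm_apply_eq]; rfl
    simp [f, this]
  let fc : StrongDual ℝ (LinearMap.range Λ) := f.mkContinuous C (by
    rintro ⟨_, t, rfl⟩
    rw [hf]
    exact h t)
  obtain ⟨g, hg, -⟩ := exists_extension_norm_eq (LinearMap.range Λ) fc
  set K := (LinearMap.range Λ).topologicalClosure with hK
  have : CompleteSpace K := (LinearMap.range Λ).isClosed_topologicalClosure.completeSpace_coe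
  refine ⟨K.starProjection ((InnerProductSpace.toDual ℝ X).symm g), ?_, fun t => ?_⟩
  · exact K.starProjection_apply_mem _
  · have ht : Λ t ∈ K := (LinearMap.range Λ).le_topologicalClosure ⟨t, rfl⟩
    rw [K.inner_starProjection_left_eq_right, K.starProjection_eq_self_iff.2 ht,
      InnerProductSpace.toDual_symm_apply]
    exact (hg ⟨Λ t, t, rfl⟩).trans (hf t)

theorem memH02_of_tendsto (hD : IsOpen D) {F : Type*} [NormedAddCommGroup F] [NormedSpace ℝ F]
    [CompleteSpace F] {θ : ℕ → E d → F} {z : E d → F} {g : Fin d → E d → F}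
    {H : Fin d → Fin d → E d → F} (hθ : ∀ k, IsTest D (θ k)) (hz : MemL2 D z)
    (hg : ∀ i, MemL2 D (g i)) (hH : ∀ i j, MemL2 D (H i j))
    (h0 : Tendsto (fun k => eLpNorm (θ k - z) 2 (volume.restrict D)) atTop (𝓝 0))
    (h1 : ∀ i, Tendsto (fun k => eLpNorm (pd i (θ k) - g i) 2 (volume.restrict D)) atTop (𝓝 0))
    (h2 : ∀ i j, Tendsto (fun k => eLpNorm (pd i (pd j (θ k)) - H i j) 2 (volume.restrict D))
      atTop (𝓝 0)) :
    MemH02 D z ∧ weakLap D z =ᵐ[volume.restrict D] fun x => ∑ i, H i i x := by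
  have wz : ∀ i, HasWeakPartial D i z (g i) := fun i =>
    HasWeakPartial.of_tendsto (fun k => (hθ k).hasWeakPartial i) (fun k => (hθ k).memL2) hz (hg i)
      h0 (h1 i)
  have wg : ∀ i j, HasWeakPartial D i (g j) (H i j) := fun i j =>
    HasWeakPartial.of_tendsto (fun k => ((hθ k).pd j).hasWeakPartial i)
      (fun k => ((hθ k).pd j).memL2) (hg j) (hH i j) (h1 j) (h2 i j)
  have az : ∀ i, weakPartial D i z =ᵐ[volume.restrict D] g i := fun i => (wz i).weakPartial_ae hD
  have wp : ∀ i j, HasWeakPartial D i (weakPartial D j z) (H i j) := fun i j =>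
    (wg i j).congr (az j).symm (ae_eq_refl _)
  have ag : ∀ i j, weakPartial D i (weakPartial D j z) =ᵐ[volume.restrict D] H i j := fun i j =>
    (wp i j).weakPartial_ae hD
  refine ⟨⟨⟨⟨hz, fun i => ⟨_, wz i⟩⟩, fun j => ⟨(hg j).ae_eq (az j).symm, fun i => ⟨_, wp i j⟩⟩⟩,
    θ, hθ, ⟨h0, fun i => tendsto_eLpNorm_sub_congr (az i).symm (h1 i)⟩,
    fun j => ⟨tendsto_eLpNorm_sub_congr (az j).symm (h1 j),
      fun i => tendsto_eLpNorm_sub_congr (ag i j).symm (h2 i j)⟩⟩, ?_⟩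
  have : ∀ᵐ x ∂(volume.restrict D), ∀ i, weakPartial D i (weakPartial D i z) x = H i i x :=
    ae_all_iff.2 fun i => ag i i
  filter_upwards [this] with x hx
  exact Finset.sum_congr rfl fun i _ => hx i

/-- The clamped problem `Δ² z = f` has a solution on every bounded open set: `Δ z` is the Riesz
representative of `θ ↦ ∫ θ f` in the closure of the Laplacians of test functions. -/
theorem exists_isClampedBiharmonic_real (hd : 0 < d) (hD : IsOpen D) (hb : Bornology.IsBounded D)
    {f : E d → ℝ} (hf : MemL2 D f) : ∃ z, IsClampedBiharmonic D z f := by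
  obtain ⟨R, hR0, hR⟩ : ∃ R, 0 ≤ R ∧ ∀ x ∈ D, ∀ i, |x i| ≤ R := by
    obtain ⟨R, hR0, hR⟩ := hb.exists_pos_norm_le
    exact ⟨R, hR0.le, fun x hx i => (PiLp.norm_apply_le x i).trans (hR x hx)⟩
  let i0 : Fin d := ⟨0, hd⟩
  let Λ : testSpace D →ₗ[ℝ] Lp ℝ 2 (volume.restrict D) := testToL2 ∘ₗ testLap
  have b1 : ∀ i θ, ‖testToL2 (testPd i θ)‖ ≤ (2 * R) * ‖Λ θ‖ := fun i θ =>
    (norm_testToL2_le hR0 i0 hD.measurableSet (fun x hx => hR x hx i0) _).trans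
      (mul_le_mul_of_nonneg_left (norm_testPd_testPd_le i0 i θ) (by positivity))
  have b0 : ∀ θ, ‖testToL2 θ‖ ≤ (2 * R * (2 * R)) * ‖Λ θ‖ := fun θ =>
    (norm_testToL2_le hR0 i0 hD.measurableSet (fun x hx => hR x hx i0) _).trans (by
      rw [mul_assoc (2 * R)]
      exact mul_le_mul_of_nonneg_left (b1 i0 θ) (by positivity))
  have b2 : ∀ i j θ, ‖testToL2 (testPd i (testPd j θ))‖ ≤ 1 * ‖Λ θ‖ := fun i j θ => by
    rw [one_mul]; exact norm_testPd_testPd_le i j θ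
  let fL : Lp ℝ 2 (volume.restrict D) := hf.toLp f
  let J : testSpace D →ₗ[ℝ] ℝ := (innerSL ℝ fL).toLinearMap ∘ₗ testToL2
  obtain ⟨q, hq, hqJ⟩ := exists_mem_closure_range_inner_eq Λ J (‖fL‖ * (2 * R * (2 * R)))
    (fun θ => by
      refine (abs_real_inner_le_norm fL (testToL2 θ)).trans ?_
      rw [mul_assoc]
      exact mul_le_mul_of_nonneg_left (b0 θ) (norm_nonneg _))
  obtain ⟨y, hy, hyq⟩ := mem_closure_iff_seq_limit.1 hq
  choose θ hθ using hy
  have hconv : ∀ (A : testSpace D →ₗ[ℝ] testSpace D) (C : ℝ),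
      (∀ t, ‖testToL2 (A t)‖ ≤ C * ‖Λ t‖) →
      ∃ a : E d → ℝ, MemL2 D a ∧
        Tendsto (fun k => eLpNorm ((A (θ k) : E d → ℝ) - a) 2 (volume.restrict D)) atTop (𝓝 0) := by
    intro A C hA
    have hc : CauchySeq fun k => testToL2 (A (θ k)) := by
      have hcy : CauchySeq y := hyq.cauchySeq
      rw [Metric.cauchySeq_iff'] at hcy ⊢
      intro ε hε
      obtain ⟨N, hN⟩ := hcy (ε / (|C| + 1)) (by positivity)
      refine ⟨N, fun n hn => ?_⟩
      have h1 : dist (testToL2 (A (θ n))) (testToL2 (A (θ N))) ≤ C * dist (y n) (y N) := by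
        rw [dist_eq_norm, dist_eq_norm, ← hθ n, ← hθ N, ← map_sub, ← map_sub, ← map_sub]
        exact hA _
      calc _ ≤ C * dist (y n) (y N) := h1
        _ ≤ (|C| + 1) * dist (y n) (y N) := by
          gcongr; linarith [le_abs_self C]
        _ < (|C| + 1) * (ε / (|C| + 1)) := by gcongr; exact hN n hn
        _ = ε := by field_simp
    obtain ⟨a, ha⟩ := cauchySeq_tendsto_of_complete hc
    refine ⟨a, Lp.memLp a, ?_⟩
    rw [← Lp.toLp_coeFn a (Lp.memLp a)] at ha
    exact (Lp.tendsto_Lp_iff_tendsto_eLpNorm'' _ (fun k => testSpace.memL2 (A (θ k))) _ _).1 ha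
  obtain ⟨z, hz, hz'⟩ := hconv LinearMap.id _ b0
  choose g hg hg' using fun i => hconv (testPd i) _ (b1 i)
  choose H hH hH' using fun i j => hconv (testPd i ∘ₗ testPd j) _ (b2 i j)
  obtain ⟨hz0, hlap⟩ := memH02_of_tendsto hD (fun k => (θ k).2) hz hg hH hz' hg' hH'
  refine ⟨z, hz0, fun t ht => ?_⟩
  -- `Δ z` is the limit of the Laplacians of the test functions, hence equal to `q`
  have hHL : Tendsto (fun k => ∫ x in D, lap t x • lap (θ k : E d → ℝ) x) atTop
      (𝓝 (∫ x in D, lap t x • weakLap D z x)) := by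
    have hlt : MemL2 D (lap t) := by
      have := testSpace.memL2 (testLap ⟨t, ht⟩)
      rwa [testLap_coe] at this
    have hs : (∫ x in D, lap t x • weakLap D z x) = ∑ i, ∫ x in D, lap t x • H i i x := by
      rw [← integral_finsetSum _ fun i _ => integrable_smul_of_memLp_two hlt (hH i i)]
      refine integral_congr_ae ?_
      filter_upwards [hlap] with x hx
      rw [hx, Finset.smul_sum]
    rw [hs]
    refine (tendsto_finsetSum _ fun i _ => tendsto_integral_smul_right hlt
      (fun k => testSpace.memL2 (testPd i (testPd i (θ k)))) (hH i i) (hH' i i)).congr fun k => ?_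
    rw [← integral_finsetSum _ fun i _ => integrable_smul_of_memLp_two hlt
      (testSpace.memL2 (testPd i (testPd i (θ k))))]
    refine integral_congr_ae (Eventually.of_forall fun x => ?_)
    simp only [lap, Finset.smul_sum]
    rfl
  have hq2 : Tendsto (fun k => ∫ x in D, lap t x • lap (θ k : E d → ℝ) x) atTop
      (𝓝 (inner ℝ (Λ ⟨t, ht⟩) q)) := by
    refine (tendsto_const_nhds.inner hyq).congr fun k => ?_
    rw [← hθ k]
    refine (inner_testToL2 _ _).trans ?_
    rw [testLap_coe, testLap_coe]
    rfl
  rw [tendsto_nhds_unique hHL hq2, real_inner_comm, hqJ ⟨t, ht⟩]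
  change inner ℝ fL (testToL2 ⟨t, ht⟩) = _
  rw [L2.inner_def]
  refine integral_congr_ae ?_
  filter_upwards [hf.coeFn_toLp, IsTest.memL2 ht |>.coeFn_toLp] with x h1 h2
  have h3 : (testToL2 (⟨t, ht⟩ : testSpace D) : E d → ℝ) x = t x := h2
  have h4 : (fL : E d → ℝ) x = f x := h1
  rw [h3, h4]
  simp

end Biharmonic

section ClampedInverse

variable {d : ℕ} {D : Set (E d)} {F F' : Type*} [NormedAddCommGroup F]
  [NormedSpace ℝ F] [NormedAddCommGroup F'] [NormedSpace ℝ F']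

theorem MemH02.memL2 {z : E d → F} (h : MemH02 D z) : MemL2 D z := h.1.1.1

theorem MemH02.memL2_weakPartial {z : E d → F} (h : MemH02 D z) (i : Fin d) :
    MemL2 D (weakPartial D i z) := (h.1.2 i).1

theorem MemH02.memL2_weakPartial_weakPartial {z : E d → F} (h : MemH02 D z) (i j : Fin d) :
    MemL2 D (weakPartial D i (weakPartial D j z)) := ((h.1.2 j).hasWeakPartial i).1

theorem tendsto_eLpNorm_clm_comp {α ι : Type*} [MeasurableSpace α] {μ : Measure α} {l : Filter ι}
    {f : ι → α → F} {g : α → F} (L : F →L[ℝ] F')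
    (h : Tendsto (fun k => eLpNorm (f k - g) 2 μ) l (𝓝 0)) :
    Tendsto (fun k => eLpNorm ((fun x => L (f k x)) - fun x => L (g x)) 2 μ) l (𝓝 0) := by
  have h0 : Tendsto (fun k => ENNReal.ofReal ‖L‖ * eLpNorm (f k - g) 2 μ) l (𝓝 0) := by
    simpa using ENNReal.Tendsto.const_mul (a := ENNReal.ofReal ‖L‖) h
      (Or.inr ENNReal.ofReal_ne_top)
  refine tendsto_of_tendsto_of_tendsto_of_le_of_le tendsto_const_nhds h0 (fun _ => zero_le) ?_
  intro k
  refine eLpNorm_le_mul_eLpNorm_of_ae_le_mul (Eventually.of_forall fun x => ?_) 2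
  simp only [Pi.sub_apply, ← map_sub]
  exact L.le_opNorm _

theorem MemH02.comp_clm [CompleteSpace F] [CompleteSpace F'] (hD : IsOpen D) {z : E d → F}
    (h : MemH02 D z) (L : F →L[ℝ] F') :
    MemH02 D (fun x => L (z x)) ∧
      weakLap D (fun x => L (z x)) =ᵐ[volume.restrict D] fun x => L (weakLap D z x) := by
  obtain ⟨θ, hθ, h0, h1⟩ := h.2
  have e1 : ∀ {φ : E d → F}, IsTest D φ → ∀ i, pd i (fun x => L (φ x)) = fun x => L (pd i φ x) :=
    fun hφ i => funext fun x => pd_clm_comp (hφ.1.differentiable (by simp) x) L i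
  have := memH02_of_tendsto hD (θ := fun k x => L (θ k x)) (z := fun x => L (z x))
    (g := fun i x => L (weakPartial D i z x))
    (H := fun i j x => L (weakPartial D i (weakPartial D j z) x))
    (fun k => (hθ k).comp_clm L) (L.comp_memLp' h.memL2)
    (fun i => L.comp_memLp' (h.memL2_weakPartial i))
    (fun i j => L.comp_memLp' (h.memL2_weakPartial_weakPartial i j))
    (tendsto_eLpNorm_clm_comp L h0.1)
    (fun i => by
      simp_rw [e1 (hθ _) i]
      exact tendsto_eLpNorm_clm_comp L (h0.2 i))
    (fun i j => by
      simp_rw [e1 (hθ _) j, e1 ((hθ _).pd j) i]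
      exact tendsto_eLpNorm_clm_comp L ((h1 j).2 i))
  refine ⟨this.1, this.2.trans (Eventually.of_forall fun x => ?_)⟩
  simp [weakLap]

variable {𝕜 : Type*} [RCLike 𝕜]

theorem IsClampedBiharmonic.ofReal (hD : IsOpen D) {z f : E d → ℝ}
    (h : IsClampedBiharmonic D z f) :
    IsClampedBiharmonic D (fun x => (z x : 𝕜)) (fun x => (f x : 𝕜)) := by
  obtain ⟨h1, h2⟩ := h.1.comp_clm hD (RCLike.ofRealCLM : ℝ →L[ℝ] 𝕜)
  refine ⟨h1, fun θ hθ => ?_⟩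
  have e : ∀ a b : ℝ, a • (b : 𝕜) = ((a * b : ℝ) : 𝕜) := fun a b => by
    rw [RCLike.real_smul_eq_coe_mul, RCLike.ofReal_mul]
  have : ∫ x in D, lap θ x • weakLap D (fun x => (z x : 𝕜)) x
      = ∫ x in D, ((lap θ x * weakLap D z x : ℝ) : 𝕜) := by
    refine integral_congr_ae ?_
    filter_upwards [h2] with x hx
    have hx' : weakLap D (fun x => (z x : 𝕜)) x = ((weakLap D z x : ℝ) : 𝕜) := hx
    rw [hx', e]
  rw [this]
  simp_rw [e]
  rw [integral_ofReal, integral_ofReal]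
  exact congrArg _ (h.2 θ hθ)

theorem exists_isClampedBiharmonic_one (𝕜 : Type*) [RCLike 𝕜] (hd : 0 < d) (hD : IsOpen D)
    (hb : Bornology.IsBounded D) :
    ∃ z : E d → 𝕜, IsClampedBiharmonic D z (fun _ => 1) := by
  have : IsFiniteMeasure (volume.restrict D) := ⟨by simpa using hb.measure_lt_top⟩
  obtain ⟨z, hz⟩ := exists_isClampedBiharmonic_real hd hD hb (f := fun _ => 1) (memLp_const _)
  have := hz.ofReal (𝕜 := 𝕜) hD
  simp only [RCLike.ofReal_one] at this
  exact ⟨_, this⟩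

theorem MemH02.memL2_weakLap {z : E d → F} (h : MemH02 D z) : MemL2 D (weakLap D z) :=
  memLp_finsetSum _ fun i _ => h.memL2_weakPartial_weakPartial i i

theorem IsTest.lap {θ : E d → F} (h : IsTest D θ) : ContDiff ℝ ∞ (lap θ) ∧ MemL2 D (lap θ) :=
  ⟨ContDiff.sum fun i _ => ((h.pd i).pd i).1, memLp_finsetSum _ fun i _ => ((h.pd i).pd i).memL2⟩

/-- Green's formula for the clamped problem, `(Δw, Δz) = (w, Δ²z)`. -/
theorem IsClampedBiharmonic.integral_weakLap_mul_conj {z f w : E d → 𝕜}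
    (h : IsClampedBiharmonic D z f) (hf : MemL2 D f) (hw : MemH02 D w) :
    ∫ x in D, weakLap D w x * starRingEnd 𝕜 (weakLap D z x)
      = ∫ x in D, w x * starRingEnd 𝕜 (f x) := by
  have hconj : ∀ {g : E d → 𝕜}, MemL2 D g → MemL2 D (fun x => starRingEnd 𝕜 (g x)) := fun hg =>
    (RCLike.conjCLE (K := 𝕜)).toContinuousLinearMap.comp_memLp' hg
  have hz := hconj h.1.memL2_weakLap
  have hfc := hconj hf
  -- the identity for a real test function
  have hreal : ∀ {θ : E d → ℝ}, IsTest D θ →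
      ∫ x in D, FSI.lap θ x • starRingEnd 𝕜 (weakLap D z x)
        = ∫ x in D, θ x • starRingEnd 𝕜 (f x) := by
    intro θ hθ
    have := congrArg (starRingEnd 𝕜) (h.2 θ hθ)
    rw [← integral_conj, ← integral_conj] at this
    simpa [RCLike.real_smul_eq_coe_mul] using this
  -- the identity for a test function with values in `𝕜`, by splitting it into its two parts
  have htest : ∀ {θ : E d → 𝕜}, IsTest D θ →
      ∫ x in D, FSI.lap θ x * starRingEnd 𝕜 (weakLap D z x)
        = ∫ x in D, θ x * starRingEnd 𝕜 (f x) := by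
    intro θ hθ
    have hr := hθ.comp_clm (RCLike.reCLM (K := 𝕜))
    have hi := hθ.comp_clm (RCLike.imCLM (K := 𝕜))
    have hl : ∀ (L : 𝕜 →L[ℝ] ℝ) x, FSI.lap (fun y => L (θ y)) x = L (FSI.lap θ x) := by
      intro L x
      simp only [FSI.lap, map_sum]
      refine Finset.sum_congr rfl fun i _ => ?_
      have : FSI.pd i (fun y => L (θ y)) = fun y => L (FSI.pd i θ y) :=
        funext fun y => pd_clm_comp (hθ.1.differentiable (by simp) y) L i
      rw [this]
      exact pd_clm_comp ((hθ.pd i).1.differentiable (by simp) x) L i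
    have split : ∀ {g : E d → 𝕜} {k : E d → 𝕜}, MemL2 D g → MemL2 D k →
        ∫ x in D, g x * k x = (∫ x in D, RCLike.reCLM (g x) • k x)
          + RCLike.I * ∫ x in D, RCLike.imCLM (g x) • k x := by
      intro g k hg hk
      have h1 : Integrable (fun x => RCLike.reCLM (g x) • k x) (volume.restrict D) :=
        integrable_smul_of_memLp_two ((RCLike.reCLM (K := 𝕜)).comp_memLp' hg) hk
      have h2 : Integrable (fun x => RCLike.imCLM (g x) • k x) (volume.restrict D) :=
        integrable_smul_of_memLp_two ((RCLike.imCLM (K := 𝕜)).comp_memLp' hg) hk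
      rw [← integral_const_mul, ← integral_add h1 (h2.const_mul _)]
      refine integral_congr_ae (Eventually.of_forall fun x => ?_)
      simp only [RCLike.reCLM_apply, RCLike.imCLM_apply, RCLike.real_smul_eq_coe_mul]
      conv_lhs => rw [← RCLike.re_add_im (g x)]
      ring
    rw [split hθ.lap.2 hz, split hθ.memL2 hfc]
    simp_rw [← hl]
    rw [hreal hr, hreal hi]
  obtain ⟨θ, hθ, h0, h1⟩ := hw.2
  have t1 : Tendsto (fun k => ∫ x in D, FSI.lap (θ k) x * starRingEnd 𝕜 (weakLap D z x)) atTop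
      (𝓝 (∫ x in D, weakLap D w x * starRingEnd 𝕜 (weakLap D z x))) := by
    refine tendsto_integral_smul_left (fun k => (hθ k).lap.2) hw.memL2_weakLap hz ?_
    have hs : Tendsto (fun k => ∑ i, eLpNorm (FSI.pd i (FSI.pd i (θ k))
        - weakPartial D i (weakPartial D i w)) 2 (volume.restrict D)) atTop (𝓝 0) := by
      simpa using tendsto_finsetSum Finset.univ fun i _ => (h1 i).2 i
    refine tendsto_of_tendsto_of_tendsto_of_le_of_le tendsto_const_nhds hs
      (fun _ => zero_le) fun k => ?_
    have : FSI.lap (θ k) - weakLap D w = ∑ i, (FSI.pd i (FSI.pd i (θ k))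
        - weakPartial D i (weakPartial D i w)) := by
      ext x
      simp [FSI.lap, weakLap]
    rw [this]
    exact eLpNorm_sum_le (fun i _ => ((((hθ k).pd i).pd i).memL2.sub
      (hw.memL2_weakPartial_weakPartial i i)).1) (by norm_num)
  have t2 : Tendsto (fun k => ∫ x in D, θ k x * starRingEnd 𝕜 (f x)) atTop
      (𝓝 (∫ x in D, w x * starRingEnd 𝕜 (f x))) :=
    tendsto_integral_smul_left (fun k => (hθ k).memL2) hw.memL2 hfc h0.1
  exact tendsto_nhds_unique t1 (t2.congr fun k => (htest (hθ k)).symm)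

end ClampedInverse

/-! ### The null vector and its orthogonal complement -/

section NullVector

variable {𝕜 : Type*} [RCLike 𝕜] {O : Set (E 3)} {Ω : Set (E 2)}

theorem isClampedBiharmonic_clampedInv_one (hΩ : IsOpen Ω) (hb : Bornology.IsBounded Ω) :
    IsClampedBiharmonic Ω (clampedInv Ω (fun _ => (1 : 𝕜))) (fun _ => 1) := by
  have h := exists_isClampedBiharmonic_one 𝕜 two_pos hΩ hb
  rw [clampedInv, dif_pos h]
  exact h.choose_spec

theorem nullVec_mem_energySpace (hO : Bornology.IsBounded O) (hΩ : IsOpen Ω)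
    (hb : Bornology.IsBounded Ω) : nullVec 𝕜 Ω ∈ energySpace 𝕜 O Ω := by
  have : IsFiniteMeasure (volume.restrict O) := ⟨by simpa using hO.measure_lt_top⟩
  exact ⟨memLp_const _, fun i => MemLp.zero, (isClampedBiharmonic_clampedInv_one hΩ hb).1,
    MemLp.zero⟩

/-- The inner product with the null vector is the mean value functional. -/
theorem energyInner_nullVec (hΩ : IsOpen Ω) (hb : Bornology.IsBounded Ω) {φ : State 𝕜}
    (hφ : φ ∈ energySpace 𝕜 O Ω) : energyInner O Ω φ (nullVec 𝕜 Ω) = mean O Ω φ := by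
  have : IsFiniteMeasure (volume.restrict Ω) := ⟨by simpa using hb.measure_lt_top⟩
  have h := (isClampedBiharmonic_clampedInv_one (𝕜 := 𝕜) hΩ hb).integral_weakLap_mul_conj
    (memLp_const _) hφ.2.2.1
  simp only [map_one, mul_one] at h
  simp [energyInner, nullVec, mean, State.p, State.u, State.w₁, State.w₂] at h ⊢
  exact h

theorem energyInner_smul_nullVec (hΩ : IsOpen Ω) (hb : Bornology.IsBounded Ω) (φ : State 𝕜)
    (c : 𝕜) :
    energyInner O Ω φ (c • nullVec 𝕜 Ω) = starRingEnd 𝕜 c * energyInner O Ω φ (nullVec 𝕜 Ω) := by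
  have hz := (isClampedBiharmonic_clampedInv_one (𝕜 := 𝕜) hΩ hb).1
  have hl := (hz.comp_clm hΩ (c • ContinuousLinearMap.id ℝ 𝕜)).2
  have e : ∫ x in Ω, weakLap Ω φ.w₁ x * starRingEnd 𝕜 (weakLap Ω (c • nullVec 𝕜 Ω).w₁ x)
      = starRingEnd 𝕜 c *
        ∫ x in Ω, weakLap Ω φ.w₁ x * starRingEnd 𝕜 (weakLap Ω (nullVec 𝕜 Ω).w₁ x) := by
    rw [← integral_const_mul]
    refine integral_congr_ae ?_
    filter_upwards [hl] with x hx
    have hx' : weakLap Ω (c • nullVec 𝕜 Ω).w₁ x = c * weakLap Ω (nullVec 𝕜 Ω).w₁ x := hx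
    rw [hx', map_mul]
    ring
  unfold energyInner
  rw [e]
  simp only [nullVec, State.p, State.u, State.w₁, State.w₂, Prod.smul_mk, Pi.smul_apply,
    smul_eq_mul, map_one, mul_one, smul_zero, Pi.zero_apply, map_zero, mul_zero,
    integral_zero, Finset.sum_const_zero, add_zero]
  rw [integral_mul_const]
  ring

theorem mem_HNperp_iff (hΩ : IsOpen Ω) (hb : Bornology.IsBounded Ω) {φ : State 𝕜}
    (hφ : φ ∈ energySpace 𝕜 O Ω) :
    φ ∈ HNperp 𝕜 O Ω ↔ ∀ χ ∈ HN 𝕜 Ω, energyInner O Ω φ χ = 0 := by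
  constructor
  · rintro ⟨-, hm⟩ χ hχ
    obtain ⟨c, rfl⟩ := Submodule.mem_span_singleton.1 hχ
    rw [energyInner_smul_nullVec hΩ hb, energyInner_nullVec hΩ hb hφ, hm, mul_zero]
  · intro h
    refine ⟨hφ, ?_⟩
    rw [← energyInner_nullVec hΩ hb hφ]
    exact h _ (Submodule.mem_span_singleton_self _)

end NullVector

/-! ### Boundary charts -/

theorem exists_volume_eq_smul_hausdorffMeasure :
    ∃ c : ℝ≥0∞, c ≠ 0 ∧ c ≠ ⊤ ∧
      (volume : Measure (E 2)) = c • (Measure.hausdorffMeasure 2 : Measure (E 2)) := by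
  have h := Measure.isAddLeftInvariant_eq_smul (volume : Measure (E 2))
    (Measure.hausdorffMeasure ((2 : ℕ) : ℝ))
  have h0 := Measure.addHaarScalarFactor_volume_hausdorffMeasure_ne_zero 2
  generalize Measure.addHaarScalarFactor (volume : Measure (E 2))
    (Measure.hausdorffMeasure ((2 : ℕ) : ℝ)) = k at h h0
  rw [Nat.cast_ofNat] at h
  exact ⟨k, by exact_mod_cast h0, ENNReal.coe_ne_top, h⟩

/-- A description of `O` near the boundary point `x₀` as the set above the zero level of a Lipschitz
function `h`, which decreases with unit speed in the direction `e`. The plane orthogonal to `e` is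
parametrized by `ℝ²`: `P` is the projection to it and `G` its right inverse with values in
`{h = 0}`. -/
structure BoundaryChart (O : Set (E 3)) (x₀ : E 3) where
  /-- the direction transversal to the boundary -/
  e : E 3
  /-- the height of the boundary above a point, measured in the direction `e` -/
  h : E 3 → ℝ
  /-- the Lipschitz constant of `h` -/
  K : NNReal
  /-- the projection along `e` -/
  P : E 3 → E 2
  /-- the graph parametrization of the boundary -/
  G : E 2 → E 3
  /-- the size of the chart -/
  r : ℝ
  norm_e : ‖e‖ = 1
  lip : LipschitzWith K h
  shift : ∀ y s, h (y + s • e) = h y - s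
  P_lip : LipschitzWith 1 P
  P_G : ∀ x, P (G x) = x
  G_P : ∀ y, G (P y) = y + h y • e
  r_pos : 0 < r
  mem_iff : ∀ y ∈ Metric.ball x₀ r, y ∈ O ↔ 0 < h y
  measurePreserving : MeasurePreserving (fun q : E 2 × ℝ => G q.1 - q.2 • e)
    (volume.prod volume) volume

/-- The isometry `(x, s) ↦ (x₁, x₂, s)` preserves the volume. -/
theorem measurePreserving_append :
    MeasurePreserving (fun q : E 2 × ℝ => (!₂[q.1 0, q.1 1, q.2] : E 3))
      (volume.prod volume) volume := by
  have h1 : MeasurePreserving (fun q : E 2 × ℝ => (q.2, (WithLp.ofLp q.1 : Fin 2 → ℝ)))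
      (volume.prod volume) (volume.prod volume) :=
    ((MeasurePreserving.id volume).prod (PiLp.volume_preserving_ofLp (Fin 2))).comp
      Measure.measurePreserving_swap
  have h2 := (volume_preserving_piFinSuccAbove (fun _ : Fin 3 => ℝ) (Fin.last 2)).symm
  have h3 := PiLp.volume_preserving_toLp (Fin 3)
  have := h3.comp (h2.comp h1)
  have hfun : (fun q : E 2 × ℝ => (!₂[q.1 0, q.1 1, q.2] : E 3)) = WithLp.toLp 2 ∘
      (MeasurableEquiv.piFinSuccAbove (fun _ : Fin 3 => ℝ) (Fin.last 2)).symm ∘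
      fun q : E 2 × ℝ => (q.2, (WithLp.ofLp q.1 : Fin 2 → ℝ)) := by
    funext q
    ext i
    fin_cases i <;> rfl
  rw [hfun]
  exact this

theorem nonempty_boundaryChart {O : Set (E 3)} (hO : HasLipschitzBoundary O) {x₀ : E 3}
    (hx : x₀ ∈ frontier O) : Nonempty (BoundaryChart O x₀) := by
  obtain ⟨R, ζ, ⟨K, hK⟩, r, hr, hmem⟩ := hO x₀ hx
  let P : E 3 → E 2 := fun y => !₂[R y 0, R y 1]
  let e : E 3 := R.symm (EuclideanSpace.single 2 1)
  have hRe : R e = EuclideanSpace.single 2 1 := R.apply_symm_apply _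
  have hPlip : LipschitzWith 1 P := by
    refine LipschitzWith.of_dist_le_mul fun y z => ?_
    rw [NNReal.coe_one, one_mul, ← R.dist_map y z, EuclideanSpace.dist_eq, EuclideanSpace.dist_eq]
    refine Real.sqrt_le_sqrt ?_
    simp only [Fin.sum_univ_two, Fin.sum_univ_three, P]
    simp only [Matrix.cons_val_zero, Matrix.cons_val_one]
    exact le_add_of_nonneg_right (sq_nonneg _)
  have hcoord : LipschitzWith 1 (fun y : E 3 => R y 2) := by
    refine LipschitzWith.of_dist_le_mul fun y z => ?_
    rw [NNReal.coe_one, one_mul, ← R.dist_map y z, dist_eq_norm, dist_eq_norm]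
    exact PiLp.norm_apply_le (R y - R z) 2
  refine ⟨{
    e := e
    h := fun y => ζ (P y) - R y 2
    K := K * 1 + 1
    P := P
    G := fun x => R.symm !₂[x 0, x 1, ζ x]
    r := r
    norm_e := by simp [e]
    lip := (hK.comp hPlip).sub hcoord
    shift := ?_
    P_lip := hPlip
    P_G := ?_
    G_P := ?_
    r_pos := hr
    mem_iff := fun y hy => by rw [hmem y hy, sub_pos]
    measurePreserving := ?_ }⟩
  · intro y s
    have h1 : P (y + s • e) = P y := by
      ext i
      fin_cases i <;> simp [P, hRe]
    have h2 : R (y + s • e) 2 = R y 2 + s := by simp [hRe]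
    rw [h1, h2]
    ring
  · intro x
    ext i
    fin_cases i <;> simp [P]
  · intro y
    apply R.injective
    simp only [LinearIsometryEquiv.apply_symm_apply, map_add, map_smul, hRe]
    ext i
    fin_cases i <;> simp [P]
  · have h1 : MeasurePreserving (fun q : E 2 × ℝ => (q.1, ζ q.1 - q.2))
        (volume.prod volume) (volume.prod volume) := by
      refine (MeasurePreserving.id volume).skew_product (g := fun x t => ζ x - t) ?_ ?_
      · exact (hK.continuous.measurable.comp measurable_fst).sub measurable_snd
      · exact Eventually.of_forall fun x => Measure.map_sub_left_eq_self volume (ζ x)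
    have := R.symm.measurePreserving.comp (measurePreserving_append.comp h1)
    have hfun : (fun q : E 2 × ℝ => R.symm !₂[q.1 0, q.1 1, ζ q.1] - q.2 • e)
        = R.symm ∘ (fun q : E 2 × ℝ => (!₂[q.1 0, q.1 1, q.2] : E 3))
          ∘ fun q : E 2 × ℝ => (q.1, ζ q.1 - q.2) := by
      funext q
      apply R.injective
      simp only [map_sub, map_smul, hRe, Function.comp, LinearIsometryEquiv.apply_symm_apply]
      ext i
      fin_cases i <;> simp
    rw [hfun]
    exact this

namespace BoundaryChart

variable {O : Set (E 3)} {x₀ : E 3} (c : BoundaryChart O x₀)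

/-- The projection to the boundary along `e`. -/
def proj (y : E 3) : E 3 := y + c.h y • c.e

/-- The part of the layer of width `δ` below the boundary within distance `ρ` of `x₀`. -/
def layer (ρ δ : ℝ) : Set (E 3) := {y | y ∈ Metric.ball x₀ ρ ∧ 0 < c.h y ∧ c.h y < δ}

theorem isOpen_layer (ρ δ : ℝ) : IsOpen (c.layer ρ δ) :=
  Metric.isOpen_ball.inter ((isOpen_lt continuous_const c.lip.continuous).inter
    (isOpen_lt c.lip.continuous continuous_const))

theorem layer_mono {ρ ρ' δ δ' : ℝ} (hρ : ρ ≤ ρ') (hδ : δ ≤ δ') :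
    c.layer ρ δ ⊆ c.layer ρ' δ' :=
  fun _ hy => ⟨Metric.ball_subset_ball hρ hy.1, hy.2.1, hy.2.2.trans_le hδ⟩

theorem layer_subset {δ : ℝ} : c.layer c.r δ ⊆ O := fun y hy => (c.mem_iff y hy.1).2 hy.2.1

theorem layer_half_subset {δ : ℝ} : c.layer (c.r / 2) δ ⊆ O :=
  (c.layer_mono (by linarith [c.r_pos]) le_rfl).trans c.layer_subset

theorem h_proj (y : E 3) : c.h (c.proj y) = 0 := by rw [proj, c.shift, sub_self]

theorem h_G (x : E 2) : c.h (c.G x) = 0 := by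
  have h1 := c.G_P (c.G x)
  rw [c.P_G] at h1
  have h2 : c.h (c.G x) • c.e = 0 := by simpa using h1.symm
  rcases smul_eq_zero.1 h2 with h | h
  · exact h
  · have := c.norm_e
    rw [h, norm_zero] at this
    exact absurd this zero_ne_one

theorem h_G_sub (x : E 2) (t : ℝ) : c.h (c.G x - t • c.e) = t := by
  rw [sub_eq_add_neg, ← neg_smul, c.shift, c.h_G]
  ring

theorem proj_G_sub (x : E 2) (t : ℝ) : c.proj (c.G x - t • c.e) = c.G x := by
  rw [proj, c.h_G_sub, sub_add_cancel]

theorem continuous_proj : Continuous c.proj :=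
  continuous_id.add (c.lip.continuous.smul continuous_const)

theorem dist_proj (y : E 3) : dist (c.proj y) y = |c.h y| := by
  simp [proj, dist_eq_norm, norm_smul, c.norm_e]

theorem mem_frontier_of_h_eq_zero {y : E 3} (hy : y ∈ Metric.ball x₀ c.r) (h : c.h y = 0) :
    y ∈ frontier O := by
  refine mem_closure_iff_frequently.2 ?_ |> fun hc => ⟨hc, fun hi => ?_⟩
  · have ht : Tendsto (fun s : ℝ => y + (-s) • c.e) (𝓝[>] 0) (𝓝 y) := by
      have : Continuous fun s : ℝ => y + (-s) • c.e := by fun_prop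
      simpa using (this.tendsto 0).mono_left nhdsWithin_le_nhds
    refine ht.frequently (Eventually.frequently ?_)
    filter_upwards [ht.eventually (Metric.isOpen_ball.mem_nhds hy), self_mem_nhdsWithin] with s hs hs0
    rw [c.mem_iff _ hs, c.shift, h]
    simpa using hs0
  · have := (c.mem_iff y hy).1 (interior_subset hi)
    exact this.ne' h

theorem h_eq_zero_of_mem_frontier (hO : IsOpen O) {y : E 3} (hy : y ∈ Metric.ball x₀ c.r)
    (h : y ∈ frontier O) : c.h y = 0 := by
  rcases lt_trichotomy (c.h y) 0 with h0 | h0 | h0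
  · have h1 : ∀ᶠ z in 𝓝 y, z ∉ O := by
      filter_upwards [Metric.isOpen_ball.mem_nhds hy,
        (isOpen_lt c.lip.continuous continuous_const).mem_nhds h0] with z hz hz0
      rw [c.mem_iff z hz]
      exact not_lt.2 (le_of_lt hz0)
    exact absurd h1 (mem_closure_iff_frequently.1 h.1)
  · exact h0
  · exact absurd ((c.mem_iff y hy).2 h0) (hO.frontier_eq ▸ h).2

theorem proj_mem_frontier {ρ δ : ℝ} (h : ρ + δ ≤ c.r) {y : E 3} (hy : y ∈ c.layer ρ δ) :
    c.proj y ∈ frontier O := by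
  refine c.mem_frontier_of_h_eq_zero ?_ (c.h_proj y)
  have h1 := c.dist_proj y
  rw [abs_of_pos hy.2.1] at h1
  have h2 := hy.1
  rw [Metric.mem_ball] at h2 ⊢
  linarith [dist_triangle (c.proj y) y x₀, hy.2.2]

/-- The volume of a layer of width `δ` over a boundary set is at most of order `δ` times the surface
measure of that set, because the projection along `e` does not increase Hausdorff measure. -/
theorem exists_map_proj_le :
    ∃ C : ℝ≥0∞, C ≠ ⊤ ∧ ∀ ρ δ : ℝ, ρ + δ ≤ c.r →
      (volume.restrict (c.layer ρ δ)).map c.proj ≤ (C * ENNReal.ofReal δ) • surf O := by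
  obtain ⟨C, -, hC, hvol⟩ := exists_volume_eq_smul_hausdorffMeasure
  refine ⟨C, hC, fun ρ δ hδ => Measure.le_iff.2 fun A hA => ?_⟩
  have hcl : MeasurableSet (frontier O) := isClosed_frontier.measurableSet
  have hAf := hA.inter hcl
  rw [Measure.map_apply c.continuous_proj.measurable hA,
    Measure.restrict_apply (c.continuous_proj.measurable hA), Measure.smul_apply, surf,
    Measure.restrict_apply hA]
  have hsub : c.proj ⁻¹' A ∩ c.layer ρ δ ⊆ c.proj ⁻¹' (A ∩ frontier O) ∩ c.h ⁻¹' Ioo 0 δ :=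
    fun y hy => ⟨⟨hy.1, c.proj_mem_frontier hδ hy.2⟩, hy.2.2⟩
  have hmeas : MeasurableSet (c.proj ⁻¹' (A ∩ frontier O) ∩ c.h ⁻¹' Ioo 0 δ) :=
    (c.continuous_proj.measurable hAf).inter (c.lip.continuous.measurable measurableSet_Ioo)
  have hpre : (fun q : E 2 × ℝ => c.G q.1 - q.2 • c.e) ⁻¹'
      (c.proj ⁻¹' (A ∩ frontier O) ∩ c.h ⁻¹' Ioo 0 δ) = (c.G ⁻¹' (A ∩ frontier O)) ×ˢ Ioo 0 δ := by
    ext ⟨x, t⟩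
    simp [c.proj_G_sub, c.h_G_sub]
  have himg : c.G ⁻¹' (A ∩ frontier O) ⊆ c.P '' (A ∩ frontier O) :=
    fun x hx => ⟨c.G x, hx, c.P_G x⟩
  calc volume (c.proj ⁻¹' A ∩ c.layer ρ δ)
      ≤ volume (c.proj ⁻¹' (A ∩ frontier O) ∩ c.h ⁻¹' Ioo 0 δ) := measure_mono hsub
    _ = volume (c.G ⁻¹' (A ∩ frontier O)) * ENNReal.ofReal δ := by
        rw [← c.measurePreserving.measure_preimage hmeas.nullMeasurableSet, hpre,
          Measure.prod_prod, Real.volume_Ioo, sub_zero]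
    _ ≤ (C * Measure.hausdorffMeasure 2 (A ∩ frontier O)) * ENNReal.ofReal δ := by
        gcongr
        rw [hvol, Measure.smul_apply, smul_eq_mul]
        gcongr
        refine (measure_mono himg).trans ?_
        simpa using (c.P_lip.lipschitzOnWith (s := A ∩ frontier O)).hausdorffMeasure_image_le
          (d := 2) zero_le_two
    _ = _ := by rw [smul_eq_mul]; ring

end BoundaryChart

/-! ### Traces and values in a boundary layer -/

theorem eLpNorm_two_sq {α F : Type*} [MeasurableSpace α] [NormedAddCommGroup F] (f : α → F)
    (μ : Measure α) : eLpNorm f 2 μ ^ 2 = ∫⁻ x, ‖f x‖ₑ ^ 2 ∂μ := by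
  have := eLpNorm_nnreal_pow_eq_lintegral (f := f) (μ := μ) (p := 2) two_ne_zero
  simpa using this

theorem enorm_sub_sq_le_lintegral {F : Type*} [NormedAddCommGroup F] [NormedSpace ℝ F]
    [CompleteSpace F] {γ γ' : ℝ → F} (hγ : ∀ s, HasDerivAt γ (γ' s) s) (hc : Continuous γ') {t : ℝ}
    (ht : 0 ≤ t) :
    ‖γ t - γ 0‖ₑ ^ 2 ≤ ENNReal.ofReal t * ∫⁻ s in Ioc 0 t, ‖γ' s‖ₑ ^ 2 := by
  have h1 : γ t - γ 0 = ∫ s in Ioc 0 t, γ' s := by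
    rw [← intervalIntegral.integral_of_le ht,
      intervalIntegral.integral_eq_sub_of_hasDerivAt (fun x _ => hγ x) (hc.intervalIntegrable _ _)]
  have h2 : ‖γ t - γ 0‖ₑ ≤ eLpNorm γ' 2 (volume.restrict (Ioc 0 t)) * ENNReal.ofReal t ^ (1 / 2 : ℝ) := by
    rw [h1]
    refine (enorm_integral_le_lintegral_enorm _).trans ?_
    rw [← eLpNorm_one_eq_lintegral_enorm]
    refine (eLpNorm_le_eLpNorm_mul_rpow_measure_univ one_le_two hc.aestronglyMeasurable).trans ?_
    simp only [Measure.restrict_apply_univ, Real.volume_Ioc, sub_zero, ENNReal.toReal_one,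
      ENNReal.toReal_ofNat]
    norm_num
  calc ‖γ t - γ 0‖ₑ ^ 2
      ≤ (eLpNorm γ' 2 (volume.restrict (Ioc 0 t)) * ENNReal.ofReal t ^ (1 / 2 : ℝ)) ^ 2 := by gcongr
    _ = _ := by
      rw [mul_pow, eLpNorm_two_sq, mul_comm, ← ENNReal.rpow_natCast, ← ENNReal.rpow_mul]
      norm_num

namespace BoundaryChart

variable {O : Set (E 3)} {x₀ : E 3} (c : BoundaryChart O x₀)
  {F : Type*} [NormedAddCommGroup F]

/-- For a smooth function, the deviation from the boundary values in a layer of width `δ` is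
controlled by `δ` times the derivative. -/
theorem eLpNorm_sub_comp_proj_le [NormedSpace ℝ F] [CompleteSpace F]
    {ψ : E 3 → F} (hψ : ContDiff ℝ 1 ψ) {ρ ρ' δ : ℝ}
    (hδ : ρ + δ ≤ ρ') :
    eLpNorm (ψ - ψ ∘ c.proj) 2 (volume.restrict (c.layer ρ δ))
      ≤ ENNReal.ofReal δ *
        eLpNorm (fun y => fderiv ℝ ψ y c.e) 2 (volume.restrict (c.layer ρ' δ)) := by
  set Q := c.layer ρ δ with hQ
  set Q' := c.layer ρ' δ with hQ'
  have hQm : MeasurableSet Q := (c.isOpen_layer ρ δ).measurableSet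
  have hQm' : MeasurableSet Q' := (c.isOpen_layer ρ' δ).measurableSet
  have hdc : Continuous fun y => fderiv ℝ ψ y c.e :=
    (hψ.continuous_fderiv one_ne_zero).clm_apply continuous_const
  let Φ : E 2 × ℝ → E 3 := fun q => c.G q.1 - q.2 • c.e
  let a : E 3 → ℝ≥0∞ := Q.indicator fun y => ‖ψ y - ψ (c.proj y)‖ₑ ^ 2
  let b : E 3 → ℝ≥0∞ := Q'.indicator fun y => ‖fderiv ℝ ψ y c.e‖ₑ ^ 2
  have ham : Measurable a :=
    ((hψ.continuous.sub (hψ.continuous.comp c.continuous_proj)).enorm.measurable.pow_const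
      2).indicator hQm
  have hbm : Measurable b := (hdc.enorm.measurable.pow_const 2).indicator hQm'
  have hΦ : Measurable Φ := c.measurePreserving.measurable
  -- the estimate along one line in the direction `e`
  have hline : ∀ x t, a (Φ (x, t))
      ≤ (Ioo 0 δ).indicator (fun _ => ENNReal.ofReal δ * ∫⁻ s, b (Φ (x, s))) t := by
    intro x t
    by_cases hq : Φ (x, t) ∈ Q
    · have ht : t ∈ Ioo 0 δ := by
        have := hq.2
        rwa [show c.h (Φ (x, t)) = t from c.h_G_sub x t] at this
      rw [indicator_of_mem ht]
      simp only [a, indicator_of_mem hq]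
      rw [show c.proj (Φ (x, t)) = c.G x from c.proj_G_sub x t]
      let γ : ℝ → F := fun s => ψ (Φ (x, s))
      have hγ : ∀ s, HasDerivAt γ (-(fderiv ℝ ψ (Φ (x, s)) c.e)) s := by
        intro s
        have h1 : HasDerivAt (fun s : ℝ => c.G x - s • c.e) (-c.e) s := by
          simpa using (((hasDerivAt_id s).smul_const c.e).const_sub (c.G x))
        have := ((hψ.differentiable one_ne_zero (Φ (x, s))).hasFDerivAt).comp_hasDerivAt s h1
        rw [map_neg] at this
        exact this
      have hγc : Continuous fun s => -(fderiv ℝ ψ (Φ (x, s)) c.e) :=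
        (hdc.comp (by fun_prop : Continuous fun s : ℝ => c.G x - s • c.e)).neg
      have h0 : γ 0 = ψ (c.G x) := by simp [γ, Φ]
      have h := enorm_sub_sq_le_lintegral hγ hγc ht.1.le
      rw [h0] at h
      refine h.trans ?_
      refine mul_le_mul' (ENNReal.ofReal_le_ofReal ht.2.le) ?_
      · rw [← lintegral_indicator measurableSet_Ioc]
        refine lintegral_mono fun s => ?_
        by_cases hs : s ∈ Ioc 0 t
        · rw [indicator_of_mem hs, enorm_neg]
          have hs' : Φ (x, s) ∈ Q' := by
            refine ⟨?_, ?_⟩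
            · have h1 : dist (Φ (x, s)) (Φ (x, t)) = t - s := by
                have : Φ (x, s) - Φ (x, t) = (t - s) • c.e := by
                  simp only [Φ, sub_smul]; abel
                rw [dist_eq_norm, this, norm_smul, c.norm_e, mul_one, Real.norm_eq_abs,
                  abs_of_nonneg (by linarith [hs.2])]
              have h2 := Metric.mem_ball.1 hq.1
              rw [Metric.mem_ball]
              linarith [dist_triangle (Φ (x, s)) (Φ (x, t)) x₀, hs.1, ht.2]
            · rw [show c.h (Φ (x, s)) = s from c.h_G_sub x s]
              exact ⟨hs.1, hs.2.trans_lt ht.2⟩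
          simp only [b, indicator_of_mem hs', le_refl]
        · rw [indicator_of_notMem hs]
          exact zero_le
    · simp only [a, indicator_of_notMem hq]
      exact zero_le
  have hint : ∫⁻ y, a y ≤ ENNReal.ofReal δ ^ 2 * ∫⁻ y, b y := by
    have hF : ∀ {k : E 3 → ℝ≥0∞}, Measurable k → ∫⁻ y, k y = ∫⁻ x, ∫⁻ t, k (Φ (x, t)) :=
      fun {k} hk => by
        rw [← c.measurePreserving.lintegral_comp hk]
        exact lintegral_prod (fun q => k (Φ q)) (hk.comp hΦ).aemeasurable
    rw [hF ham, hF hbm, ← lintegral_const_mul' _ _ (by simp)]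
    refine lintegral_mono fun x => ?_
    refine (lintegral_mono (hline x)).trans ?_
    rw [lintegral_indicator measurableSet_Ioo, lintegral_const, Measure.restrict_apply_univ,
      Real.volume_Ioo, sub_zero]
    apply le_of_eq
    ring
  refine (ENNReal.pow_le_pow_left_iff two_ne_zero).1 ?_
  rw [mul_pow, eLpNorm_two_sq, eLpNorm_two_sq]
  simp only [a, b, lintegral_indicator hQm, lintegral_indicator hQm'] at hint
  exact hint

theorem aestronglyMeasurable_comp_proj {g : E 3 → F} (hg : AEStronglyMeasurable g (surf O))
    {ρ δ : ℝ} (hδ : ρ + δ ≤ c.r) :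
    AEStronglyMeasurable (g ∘ c.proj) (volume.restrict (c.layer ρ δ)) := by
  obtain ⟨C, -, h⟩ := c.exists_map_proj_le
  refine AEStronglyMeasurable.comp_measurable ?_ c.continuous_proj.measurable
  exact hg.mono_ac ((Measure.absolutelyContinuous_of_le (h ρ δ hδ)).trans
    Measure.smul_absolutelyContinuous)

theorem ae_comp_proj {p : E 3 → Prop} (hp : ∀ᵐ x ∂(surf O), p x) {ρ δ : ℝ} (hδ : ρ + δ ≤ c.r) :
    ∀ᵐ y ∂(volume.restrict (c.layer ρ δ)), p (c.proj y) := by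
  obtain ⟨C, -, h⟩ := c.exists_map_proj_le
  exact ae_of_ae_map c.continuous_proj.aemeasurable
    (((Measure.absolutelyContinuous_of_le (h ρ δ hδ)).trans
      Measure.smul_absolutelyContinuous).ae_le hp)

theorem exists_eLpNorm_comp_proj_le :
    ∃ C : ℝ≥0∞, C ≠ ⊤ ∧ ∀ ρ δ : ℝ, ρ + δ ≤ c.r → ∀ g : E 3 → F,
      AEStronglyMeasurable g (surf O) →
      eLpNorm (g ∘ c.proj) 2 (volume.restrict (c.layer ρ δ))
        ≤ C * ENNReal.ofReal δ ^ (1 / 2 : ℝ) * eLpNorm g 2 (surf O) := by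
  obtain ⟨C, hC, h⟩ := c.exists_map_proj_le
  refine ⟨C ^ (1 / 2 : ℝ), by finiteness, fun ρ δ hδ g hg => ?_⟩
  have hg' := hg.mono_ac ((Measure.absolutelyContinuous_of_le (h ρ δ hδ)).trans
    Measure.smul_absolutelyContinuous)
  rw [← eLpNorm_map_measure hg' c.continuous_proj.aemeasurable]
  refine (eLpNorm_mono_measure _ (h ρ δ hδ)).trans ?_
  rw [eLpNorm_smul_measure_of_ne_top (by simp), smul_eq_mul,
    ← ENNReal.mul_rpow_of_nonneg _ _ (by norm_num)]
  simp

/-- An `H¹` function differs from its trace in a layer of width `δ` by at most `δ` times its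
derivative in the direction `e`. -/
theorem eLpNorm_sub_trace_comp_proj_le [NormedSpace ℝ F] [CompleteSpace F]
    {f g : E 3 → F} (h : HasTrace O f g)
    {ρ δ : ℝ} (hδ : ρ + δ ≤ c.r) (hδ0 : 0 ≤ δ) :
    eLpNorm (f - g ∘ c.proj) 2 (volume.restrict (c.layer ρ δ))
      ≤ ENNReal.ofReal δ *
        eLpNorm (fun y => ∑ i, c.e i • weakPartial O i f y) 2
          (volume.restrict (c.layer c.r δ)) := by
  obtain ⟨hf, hg, φ, hφ, hφf, hφg⟩ := h
  obtain ⟨C, hC, hCg⟩ := c.exists_eLpNorm_comp_proj_le (F := F)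
  have hρ : ρ ≤ c.r := by linarith
  have hQ : c.layer ρ δ ⊆ O := (c.layer_mono hρ le_rfl).trans c.layer_subset
  set Q := volume.restrict (c.layer ρ δ)
  set Q' := volume.restrict (c.layer c.r δ)
  have hQO : Q ≤ volume.restrict O := Measure.restrict_mono hQ le_rfl
  have hQO' : Q' ≤ volume.restrict O := Measure.restrict_mono c.layer_subset le_rfl
  set w : E 3 → F := fun y => ∑ i, c.e i • weakPartial O i f y
  let R : ℕ → ℝ≥0∞ := fun k => eLpNorm (φ k - f) 2 (volume.restrict O)
    + (ENNReal.ofReal δ * (eLpNorm w 2 Q' + ∑ i, ‖c.e i‖ₑ *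
        eLpNorm (pd i (φ k) - weakPartial O i f) 2 (volume.restrict O))
      + C * ENNReal.ofReal δ ^ (1 / 2 : ℝ) * eLpNorm (φ k - g) 2 (surf O))
  have hR : Tendsto R atTop (𝓝 (0 + (ENNReal.ofReal δ * (eLpNorm w 2 Q' + ∑ i, ‖c.e i‖ₑ * 0)
      + C * ENNReal.ofReal δ ^ (1 / 2 : ℝ) * 0))) := by
    refine hφf.1.add (Tendsto.add ?_ ?_)
    · refine ENNReal.Tendsto.const_mul (tendsto_const_nhds.add
        (tendsto_finsetSum _ fun i _ => ENNReal.Tendsto.const_mul (hφf.2 i) (Or.inr (by simp))))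
        (Or.inr (by simp))
    · exact ENNReal.Tendsto.const_mul hφg (Or.inr (by finiteness))
  simp only [mul_zero, Finset.sum_const_zero, add_zero, zero_add] at hR
  refine ge_of_tendsto' hR fun k => ?_
  have hφm : AEStronglyMeasurable (φ k) Q := (hφ k).continuous.aestronglyMeasurable
  have hφpm : AEStronglyMeasurable (φ k ∘ c.proj) Q :=
    ((hφ k).continuous.comp c.continuous_proj).aestronglyMeasurable
  have hfm : AEStronglyMeasurable f Q := hf.1.1.mono_measure hQO
  have hgm : AEStronglyMeasurable (g ∘ c.proj) Q := c.aestronglyMeasurable_comp_proj hg.1 hδ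
  have e1 : f - g ∘ c.proj
      = (f - φ k) + ((φ k - φ k ∘ c.proj) + (φ k - g) ∘ c.proj) := by
    ext y; simp
  rw [e1]
  refine (eLpNorm_add_le (hfm.sub hφm) ((hφm.sub hφpm).add (hφpm.sub hgm)) one_le_two).trans ?_
  refine add_le_add ?_ ((eLpNorm_add_le (hφm.sub hφpm) (hφpm.sub hgm) one_le_two).trans
    (add_le_add ?_ ?_))
  · rw [eLpNorm_sub_comm]
    exact eLpNorm_mono_measure _ hQO
  · refine (c.eLpNorm_sub_comp_proj_le ((hφ k).of_le (by simp)) hδ).trans ?_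
    gcongr
    have e2 : (fun y => fderiv ℝ (φ k) y c.e)
        = w + ∑ i, c.e i • (pd i (φ k) - weakPartial O i f) := by
      ext y
      simp only [fderiv_apply_eq_sum_pd, w, Pi.add_apply, Finset.sum_apply, Pi.smul_apply,
        Pi.sub_apply, smul_sub, Finset.sum_sub_distrib]
      abel
    have hwp : ∀ i, AEStronglyMeasurable (weakPartial O i f) Q' := fun i =>
      (hf.hasWeakPartial i).1.1.mono_measure hQO'
    have hpd : ∀ i, AEStronglyMeasurable (pd i (φ k)) Q' := fun i =>
      (contDiff_pd (hφ k) i).continuous.aestronglyMeasurable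
    have hwm : AEStronglyMeasurable w Q' :=
      Finset.aestronglyMeasurable_fun_sum _ fun i _ => (hwp i).const_smul (c.e i)
    have hsm : ∀ i ∈ Finset.univ,
        AEStronglyMeasurable (c.e i • (pd i (φ k) - weakPartial O i f)) Q' :=
      fun i _ => ((hpd i).sub (hwp i)).const_smul (c.e i)
    rw [e2]
    refine (eLpNorm_add_le hwm (Finset.aestronglyMeasurable_sum _ hsm) one_le_two).trans ?_
    gcongr
    refine (eLpNorm_sum_le hsm one_le_two).trans (Finset.sum_le_sum fun i _ => ?_)
    rw [eLpNorm_const_smul]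
    exact mul_le_mul' le_rfl (eLpNorm_mono_measure _ hQO')
  · exact hCg ρ δ hδ (φ k - g)
      ((hφ k).continuous.aestronglyMeasurable.sub hg.1 : AEStronglyMeasurable (φ k - g) (surf O))

end BoundaryChart

/-! ### Mollification and partitions of unity -/

/-- Dominated convergence to zero in `L²`. -/
theorem tendsto_eLpNorm_two_zero_of_dominated {α F F' : Type*} [MeasurableSpace α] {μ : Measure α}
    [NormedAddCommGroup F] [NormedAddCommGroup F'] {u : ℕ → α → F} {f : α → F'}
    (hf : MemLp f 2 μ) (B : ℝ) (hu : ∀ n, AEStronglyMeasurable (u n) μ)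
    (hb : ∀ n, ∀ᵐ x ∂μ, ‖u n x‖ ≤ B * ‖f x‖)
    (hlim : ∀ᵐ x ∂μ, Tendsto (fun n => u n x) atTop (𝓝 0)) :
    Tendsto (fun n => eLpNorm (u n) 2 μ) atTop (𝓝 0) := by
  have h1 : Tendsto (fun n => eLpNorm (u n) 2 μ ^ 2) atTop (𝓝 0) := by
    simp_rw [eLpNorm_two_sq]
    have := tendsto_lintegral_of_dominated_convergence' (μ := μ) (F := fun n x => ‖u n x‖ₑ ^ 2)
      (f := fun _ => 0) (fun x => (ENNReal.ofReal B * ‖f x‖ₑ) ^ 2)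
      (fun n => (hu n).enorm.pow_const 2) (fun n => ?_) ?_ ?_
    · simpa using this
    · filter_upwards [hb n] with x hx
      gcongr
      rw [← ofReal_norm, ← ofReal_norm (f x), ← ENNReal.ofReal_mul' (norm_nonneg _)]
      exact ENNReal.ofReal_le_ofReal hx
    · simp_rw [mul_pow]
      rw [lintegral_const_mul' _ _ (by finiteness), ← eLpNorm_two_sq]
      exact ENNReal.mul_ne_top (by finiteness) (ENNReal.pow_ne_top hf.2.ne)
    · filter_upwards [hlim] with x hx
      have hx' : Tendsto (fun n => ‖u n x‖ₑ) atTop (𝓝 0) := by simpa using hx.enorm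
      simpa [Function.comp_def] using ((ENNReal.continuous_pow 2).tendsto 0).comp hx'
  have h2 := (ENNReal.continuous_rpow_const (y := 1 / 2)).tendsto 0 |>.comp h1
  simp only [Function.comp_def] at h2
  rw [ENNReal.zero_rpow_of_pos (by norm_num)] at h2
  refine h2.congr fun n => ?_
  rw [← ENNReal.rpow_natCast, ← ENNReal.rpow_mul]
  norm_num

section Mollify

variable {d : ℕ}

open Convolution in
/-- The derivative of a mollified Lipschitz function is the mollified derivative. -/
theorem hasFDerivAt_convolution_of_lipschitz {K : NNReal} {h : E d → ℝ} (hh : LipschitzWith K h)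
    (ρ : ContDiffBump (0 : E d)) (x : E d) :
    HasFDerivAt (ρ.normed volume ⋆[ContinuousLinearMap.lsmul ℝ ℝ, volume] h)
      ((ρ.normed volume ⋆[ContinuousLinearMap.lsmul ℝ ℝ, volume] fderiv ℝ h) x) x := by
  have hρi : Integrable (ρ.normed (volume : Measure (E d))) := ρ.integrable_normed
  have hρc : Continuous (ρ.normed (volume : Measure (E d))) := ρ.continuous_normed
  have hcont : ∀ z : E d, Continuous fun t => ρ.normed volume t • h (z - t) := fun z =>
    hρc.smul (hh.continuous.comp (by fun_prop))
  refine (hasFDerivAt_integral_of_dominated_loc_of_lip (μ := (volume : Measure (E d))) (𝕜 := ℝ)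
    (F := fun z t => ρ.normed volume t • h (z - t))
    (F' := fun t => ρ.normed volume t • fderiv ℝ h (x - t)) (s := univ)
    (bound := fun t => ρ.normed volume t * K) univ_mem
    (Eventually.of_forall fun z => (hcont z).aestronglyMeasurable) ?_ ?_ ?_ ?_ ?_).2
  · exact (hcont x).integrable_of_hasCompactSupport ρ.hasCompactSupport_normed.smul_right
  · exact hρc.aestronglyMeasurable.smul ((measurable_fderiv ℝ h).comp
      (measurable_const.sub measurable_id)).aestronglyMeasurable
  · refine Eventually.of_forall fun t => LipschitzWith.lipschitzOnWith ?_
    refine LipschitzWith.of_dist_le_mul fun z z' => ?_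
    rw [Real.coe_nnabs]
    refine le_trans ?_ (mul_le_mul_of_nonneg_right (le_abs_self _) dist_nonneg)
    rw [dist_eq_norm, ← smul_sub, norm_smul, Real.norm_of_nonneg (ρ.nonneg_normed t), mul_assoc]
    refine mul_le_mul_of_nonneg_left ?_ (ρ.nonneg_normed t)
    have := hh.dist_le_mul (z - t) (z' - t)
    rwa [dist_sub_right, dist_eq_norm] at this
  · exact hρi.mul_const _
  · have hd := (quasiMeasurePreserving_sub_left_of_right_invariant (volume : Measure (E d)) x).ae
      (hh.ae_differentiableAt (μ := volume))
    filter_upwards [hd] with t ht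
    have h1 : HasFDerivAt (fun z => h (z - t)) (fderiv ℝ h (x - t)) x := by
      exact HasFDerivAt.comp (g := h) (f := fun z => z - t) x ht.hasFDerivAt
        ((hasFDerivAt_id x).sub_const t)
    exact h1.fun_const_smul _

open Convolution in
/-- A Lipschitz function can be approximated uniformly by smooth functions with the same Lipschitz
constant such that the gradients converge when multiplied with given functions in `L²`. -/
theorem exists_smooth_approx {F : Type*} [NormedAddCommGroup F] [NormedSpace ℝ F] {K : NNReal}
    {h : E d → ℝ} (hh : LipschitzWith K h) {D : Set (E d)} {f : Fin d → E d → F}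
    (hf : ∀ i, MemL2 D (f i)) {ε : ℝ} (hε : 0 < ε) :
    ∃ m : E d → ℝ, ContDiff ℝ ∞ m ∧ (∀ x, |m x - h x| ≤ ε) ∧ (∀ x, ‖fderiv ℝ m x‖ ≤ K) ∧
      eLpNorm (fun x => ∑ i, (pd i m x - pd i h x) • f i x) 2 (volume.restrict D)
        ≤ ENNReal.ofReal ε := by
  let ρ : ℕ → ContDiffBump (0 : E d) := fun n =>
    ⟨1 / (2 * ((n : ℝ) + 1)), 1 / ((n : ℝ) + 1), by positivity, by
      gcongr; linarith [(Nat.cast_nonneg n : (0 : ℝ) ≤ n)]⟩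
  let m : ℕ → E d → ℝ := fun n => ((ρ n).normed volume ⋆[ContinuousLinearMap.lsmul ℝ ℝ, volume] h)
  have hr0 : Tendsto (fun n => (ρ n).rOut) atTop (𝓝 0) := tendsto_one_div_add_atTop_nhds_zero_nat
  have hm : ∀ n, ContDiff ℝ ∞ (m n) := fun n =>
    (ρ n).hasCompactSupport_normed.contDiff_convolution_left _ (ρ n).contDiff_normed
      hh.continuous.locallyIntegrable
  have hfd : ∀ n x, fderiv ℝ (m n) x
      = ((ρ n).normed volume ⋆[ContinuousLinearMap.lsmul ℝ ℝ, volume] fderiv ℝ h) x :=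
    fun n x => (hasFDerivAt_convolution_of_lipschitz hh (ρ n) x).fderiv
  have hDb : ∀ x, ‖fderiv ℝ h x‖ ≤ K := fun x => norm_fderiv_le_of_lipschitz ℝ hh
  have hb : ∀ n x, ‖fderiv ℝ (m n) x‖ ≤ K := by
    intro n x
    rw [hfd]
    refine (norm_integral_le_of_norm_le ((ρ n).integrable_normed.mul_const (K : ℝ))
      (Eventually.of_forall fun t => ?_)).trans (le_of_eq ?_)
    · simp only [ContinuousLinearMap.lsmul_apply]
      rw [norm_smul, Real.norm_of_nonneg ((ρ n).nonneg_normed t)]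
      exact mul_le_mul_of_nonneg_left (hDb _) ((ρ n).nonneg_normed t)
    · rw [integral_mul_const, (ρ n).integral_normed, one_mul]
  have hli : LocallyIntegrable (fderiv ℝ h) (volume : Measure (E d)) := by
    have h1 : MemLp (fderiv ℝ h) ⊤ (volume : Measure (E d)) :=
      memLp_top_of_bound (measurable_fderiv ℝ h).aestronglyMeasurable K (Eventually.of_forall hDb)
    exact h1.locallyIntegrable le_top
  have hlim : ∀ᵐ x ∂(volume : Measure (E d)),
      Tendsto (fun n => fderiv ℝ (m n) x) atTop (𝓝 (fderiv ℝ h x)) := by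
    filter_upwards [ContDiffBump.ae_convolution_tendsto_right_of_locallyIntegrable (φ := ρ) (K := 2)
      hr0 (Eventually.of_forall fun n => by
        change 1 / ((n : ℝ) + 1) ≤ 2 * (1 / (2 * ((n : ℝ) + 1)))
        apply le_of_eq; field_simp) hli] with x hx
    simpa only [hfd] using hx
  have hsum : Tendsto (fun n => ∑ i, eLpNorm (fun x => (pd i (m n) x - pd i h x) • f i x) 2
      (volume.restrict D)) atTop (𝓝 0) := by
    have hi : ∀ i ∈ (Finset.univ : Finset (Fin d)), Tendsto (fun n => eLpNorm
        (fun x => (pd i (m n) x - pd i h x) • f i x) 2 (volume.restrict D)) atTop (𝓝 0) := by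
      intro i _
      refine tendsto_eLpNorm_two_zero_of_dominated (hf i) (2 * K) (fun n => ?_) (fun n => ?_) ?_
      · refine AEStronglyMeasurable.smul ?_ (hf i).1
        exact ((contDiff_pd (hm n) i).continuous.measurable.sub
          (measurable_fderiv_apply_const ℝ h _)).aestronglyMeasurable
      · refine Eventually.of_forall fun x => ?_
        rw [norm_smul]
        gcongr
        refine (norm_sub_le _ _).trans ?_
        rw [two_mul]
        exact add_le_add ((norm_pd_le _ _ _).trans (hb n x)) ((norm_pd_le _ _ _).trans (hDb x))
      · filter_upwards [ae_restrict_of_ae hlim] with x hx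
        have h1 : Tendsto (fun n => pd i (m n) x) atTop (𝓝 (pd i h x)) :=
          ((ContinuousLinearMap.apply ℝ ℝ (EuclideanSpace.single i (1 : ℝ))).continuous.tendsto
            _).comp hx
        have h2 := (h1.sub_const (pd i h x)).smul_const (f i x)
        simpa using h2
    simpa using tendsto_finsetSum _ hi
  obtain ⟨n, hn1, hn2⟩ := ((hsum.eventually (ge_mem_nhds
    (ENNReal.ofReal_pos.2 hε))).and (hr0.eventually (ge_mem_nhds
      (show (0 : ℝ) < ε / (K + 1) by positivity)))).exists
  refine ⟨m n, hm n, fun x => ?_, hb n, ?_⟩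
  · rw [← Real.dist_eq]
    refine ContDiffBump.dist_normed_convolution_le hh.continuous.aestronglyMeasurable fun y hy => ?_
    refine (hh.dist_le_mul y x).trans ?_
    have h1 : dist y x ≤ ε / (K + 1) := (Metric.mem_ball.1 hy).le.trans hn2
    calc (K : ℝ) * dist y x ≤ (K + 1) * (ε / (K + 1)) := by gcongr; linarith
      _ = ε := by field_simp
  · refine le_trans ?_ hn1
    have hs : (fun x => ∑ i, (pd i (m n) x - pd i h x) • f i x)
        = ∑ i, fun x => (pd i (m n) x - pd i h x) • f i x := by
      ext x; simp
    rw [hs]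
    refine eLpNorm_sum_le (fun i _ => AEStronglyMeasurable.smul ?_ (hf i).1) one_le_two
    exact ((contDiff_pd (hm n) i).continuous.measurable.sub
      (measurable_fderiv_apply_const ℝ h _)).aestronglyMeasurable

open Manifold in
/-- A property of test functions that is additive and holds locally, holds for all test
functions. -/
theorem forall_isTest_of_local {P : (E d → ℝ) → Prop} (h0 : P 0)
    (hadd : ∀ ψ ψ', IsTest univ ψ → IsTest univ ψ' → P ψ → P ψ' → P (fun x => ψ x + ψ' x))
    (hloc : ∀ x, ∃ W, IsOpen W ∧ x ∈ W ∧ ∀ ψ, IsTest W ψ → P ψ) {ψ : E d → ℝ}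
    (hψ : IsTest univ ψ) : P ψ := by
  choose W hW hxW hPW using hloc
  have hcomp : IsCompact (tsupport ψ) := hψ.2.1
  obtain ⟨t, ht⟩ := hcomp.elim_finite_subcover W hW fun x _ => mem_iUnion.2 ⟨x, hxW x⟩
  obtain ⟨f, hf⟩ := SmoothPartitionOfUnity.exists_isSubordinate 𝓘(ℝ, E d) (isClosed_tsupport ψ)
    (fun i : t => W i) (fun i => hW i) (by simpa [iUnion_subtype] using ht)
  have hterm : ∀ i : t, IsTest (W i) (fun x => f i x * ψ x) := by
    intro i
    refine ⟨(f i).contMDiff.contDiff.mul hψ.1, hψ.2.1.mul_left, ?_⟩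
    refine (closure_mono ?_).trans (hf i)
    intro x hx hx0
    exact hx (by simp [hx0])
  have hsum : ψ = fun x => ∑ i : t, f i x * ψ x := by
    ext x
    rw [← Finset.sum_mul]
    by_cases hx : x ∈ tsupport ψ
    · rw [← finsum_eq_sum_of_fintype, f.sum_eq_one hx, one_mul]
    · rw [image_eq_zero_of_notMem_tsupport hx, mul_zero]
  have hfin : ∀ s : Finset t, IsTest univ (fun x => ∑ i ∈ s, f i x * ψ x) ∧
      P (fun x => ∑ i ∈ s, f i x * ψ x) := by
    classical
    intro s
    induction s using Finset.induction_on with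
    | empty =>
      simp only [Finset.sum_empty]
      exact ⟨⟨contDiff_const, HasCompactSupport.zero, subset_univ _⟩, h0⟩
    | insert i s his ih =>
      simp only [Finset.sum_insert his]
      have hi := (hterm i).mono (subset_univ _)
      exact ⟨hi.add ih.1, hadd _ _ hi ih.1 (hPW _ _ (hterm i)) ih.2⟩
  rw [hsum]
  exact (hfin Finset.univ).2

end Mollify

/-- A smooth step function from `0` to `1` with the transition inside `[1/3, 2/3]`. -/
theorem exists_smooth_step :
    ∃ χ : ℝ → ℝ, ContDiff ℝ ∞ χ ∧ (∀ t, 0 ≤ χ t ∧ χ t ≤ 1) ∧ (∀ t ≤ 1 / 3, χ t = 0) ∧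
      (∀ t, 2 / 3 ≤ t → χ t = 1) ∧ (∀ t, deriv χ t ≠ 0 → 1 / 3 ≤ t ∧ t ≤ 2 / 3) ∧
      ∃ C > 0, ∀ t, |deriv χ t| ≤ C := by
  let χ : ℝ → ℝ := fun t => Real.smoothTransition (3 * t - 1)
  have hχ : ContDiff ℝ ∞ χ := Real.smoothTransition.contDiff.comp (by fun_prop)
  have h0 : ∀ t ≤ 1 / 3, χ t = 0 := fun t ht =>
    Real.smoothTransition.zero_of_nonpos (by linarith)
  have h1 : ∀ t, 2 / 3 ≤ t → χ t = 1 := fun t ht =>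
    Real.smoothTransition.one_of_one_le (by linarith)
  have hd : ∀ t, deriv χ t ≠ 0 → 1 / 3 ≤ t ∧ t ≤ 2 / 3 := by
    intro t ht
    by_contra hcon
    apply ht
    rcases not_and_or.1 hcon with h | h
    · have : χ =ᶠ[𝓝 t] fun _ => 0 := by
        filter_upwards [Iio_mem_nhds (not_le.1 h)] with s hs using h0 s hs.le
      rw [this.deriv_eq, deriv_const]
    · have : χ =ᶠ[𝓝 t] fun _ => 1 := by
        filter_upwards [Ioi_mem_nhds (not_le.1 h)] with s hs using h1 s hs.le
      rw [this.deriv_eq, deriv_const]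
  obtain ⟨C, hC⟩ := (isCompact_Icc (a := (1 / 3 : ℝ)) (b := 2 / 3)).exists_bound_of_continuousOn
    (hχ.continuous_deriv (by simp)).continuousOn
  refine ⟨χ, hχ, fun t => ⟨Real.smoothTransition.nonneg _, Real.smoothTransition.le_one _⟩, h0, h1,
    hd, |C| + 1, by positivity, fun t => ?_⟩
  by_cases ht : deriv χ t = 0
  · rw [ht, abs_zero]; positivity
  · exact (hC t ⟨(hd t ht).1, (hd t ht).2⟩).trans (by linarith [le_abs_self C])

/-! ### Cutoff functions near the boundary -/

namespace BoundaryChart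

variable {O : Set (E 3)} {x₀ : E 3} (c : BoundaryChart O x₀)
  {F : Type*} [NormedAddCommGroup F] [NormedSpace ℝ F]

/-- Smooth cutoffs of a layer of width `δ`: functions of a mollification of the height `h`. The
mollification is so fine that the gradient of the cutoff, multiplied with the given fields `f`, is
controlled by the gradient of `h` itself. -/
theorem exists_cutoff {f : Fin 3 → E 3 → F} (hf : ∀ i, MemL2 O (f i)) :
    ∃ C > 0, ∀ δ > 0, ∃ κ : E 3 → ℝ, ContDiff ℝ ∞ κ ∧ (∀ x, 0 ≤ κ x ∧ κ x ≤ 1) ∧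
      (∀ x, δ ≤ c.h x → κ x = 1) ∧ (∃ η > 0, ∀ x, c.h x ≤ η → κ x = 0) ∧
      (∀ x i, |pd i κ x| ≤ C / δ) ∧ (∀ x i, pd i κ x ≠ 0 → 0 < c.h x ∧ c.h x < δ) ∧
      eLpNorm (fun x => ∑ i, pd i κ x • f i x) 2 (volume.restrict (c.layer (c.r / 2) δ))
        ≤ ENNReal.ofReal (C / δ) * eLpNorm (fun x => ∑ i, pd i c.h x • f i x) 2
            (volume.restrict (c.layer (c.r / 2) δ)) + ENNReal.ofReal δ := by
  obtain ⟨χ, hχ, hχ01, hχ0, hχ1, hχd, C, hC0, hC⟩ := exists_smooth_step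
  refine ⟨C * (c.K + 1), by positivity, fun δ hδ => ?_⟩
  obtain ⟨m, hm, hmh, hmK, hmf⟩ := exists_smooth_approx c.lip hf
    (show (0 : ℝ) < min (δ / 6) (δ * δ / C) by positivity)
  have hm1 : ∀ x, |m x - c.h x| ≤ δ / 6 := fun x => (hmh x).trans (min_le_left _ _)
  have hpd : ∀ x i, pd i (fun x => χ (m x / δ)) x = deriv χ (m x / δ) / δ * pd i m x := by
    intro x i
    have h1 : HasFDerivAt (fun x => m x / δ) (δ⁻¹ • fderiv ℝ m x) x := by
      simpa [div_eq_inv_mul] using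
        ((hm.differentiable (by simp) x).hasFDerivAt.fun_const_smul δ⁻¹)
    have h2 := ((hχ.differentiable (by simp) (m x / δ)).hasDerivAt).comp_hasFDerivAt x h1
    change fderiv ℝ (χ ∘ fun x => m x / δ) x _ = _
    rw [h2.fderiv]
    simp only [smul_apply, smul_eq_mul, pd]
    ring
  refine ⟨fun x => χ (m x / δ), hχ.comp (hm.div_const δ), fun x => hχ01 _, fun x hx => ?_,
    ⟨δ / 6, by positivity, fun x hx => ?_⟩, fun x i => ?_, fun x i hx => ?_, ?_⟩
  · apply hχ1
    rw [le_div_iff₀ hδ]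
    linarith [(abs_le.1 (hm1 x)).1]
  · apply hχ0
    rw [div_le_iff₀ hδ]
    linarith [(abs_le.1 (hm1 x)).2]
  · rw [hpd, abs_mul, abs_div, abs_of_pos hδ]
    have h1 : |pd i m x| ≤ c.K + 1 := ((norm_pd_le m x i).trans (hmK x)).trans (by linarith)
    calc |deriv χ (m x / δ)| / δ * |pd i m x| ≤ C / δ * (c.K + 1) := by
          gcongr
          exact hC _
      _ = _ := by ring
  · rw [hpd] at hx
    have h0 : deriv χ (m x / δ) ≠ 0 := fun h => hx (by rw [h]; simp)
    obtain ⟨h1, h2⟩ := hχd _ h0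
    rw [le_div_iff₀ hδ] at h1
    rw [div_le_iff₀ hδ] at h2
    have := abs_le.1 (hm1 x)
    constructor <;> linarith [this.1, this.2]
  · set Q := volume.restrict (c.layer (c.r / 2) δ)
    have hQ : Q ≤ volume.restrict O := Measure.restrict_mono c.layer_half_subset le_rfl
    have hfm : ∀ i, AEStronglyMeasurable (f i) Q := fun i => (hf i).1.mono_measure hQ
    have hpm : ∀ i, AEStronglyMeasurable (pd i m) Q := fun i =>
      (contDiff_pd hm i).continuous.aestronglyMeasurable
    have hph : ∀ i, AEStronglyMeasurable (pd i c.h) Q := fun i =>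
      (measurable_fderiv_apply_const ℝ c.h _).aestronglyMeasurable
    set A : E 3 → F := fun x => ∑ i, pd i c.h x • f i x
    set B : E 3 → F := fun x => ∑ i, (pd i m x - pd i c.h x) • f i x
    have hA : AEStronglyMeasurable A Q :=
      Finset.aestronglyMeasurable_fun_sum _ fun i _ => (hph i).smul (hfm i)
    have hB : AEStronglyMeasurable B Q :=
      Finset.aestronglyMeasurable_fun_sum _ fun i _ => ((hpm i).sub (hph i)).smul (hfm i)
    have hle : eLpNorm (fun x => ∑ i, pd i (fun x => χ (m x / δ)) x • f i x) 2 Q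
        ≤ ENNReal.ofReal (C / δ) * eLpNorm (A + B) 2 Q := by
      refine eLpNorm_le_mul_eLpNorm_of_ae_le_mul (Eventually.of_forall fun x => ?_) 2
      have : ∑ i, pd i (fun x => χ (m x / δ)) x • f i x
          = (deriv χ (m x / δ) / δ) • (A + B) x := by
        simp only [hpd, A, B, Pi.add_apply, ← Finset.sum_add_distrib, ← add_smul, Finset.smul_sum,
          smul_smul]
        refine Finset.sum_congr rfl fun i _ => ?_
        congr 2
        ring
      rw [this, norm_smul, Real.norm_eq_abs, abs_div, abs_of_pos hδ]
      gcongr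
      exact hC _
    refine hle.trans ?_
    refine (mul_le_mul' le_rfl (eLpNorm_add_le hA hB one_le_two)).trans ?_
    rw [mul_add]
    refine add_le_add ?_ ?_
    · gcongr
      nlinarith [c.K.2, hC0]
    · calc ENNReal.ofReal (C / δ) * eLpNorm B 2 Q
          ≤ ENNReal.ofReal (C / δ) * ENNReal.ofReal (δ * δ / C) := by
            gcongr
            refine (eLpNorm_mono_measure _ hQ).trans (hmf.trans ?_)
            exact ENNReal.ofReal_le_ofReal (min_le_right _ _)
        _ = ENNReal.ofReal δ := by
            rw [← ENNReal.ofReal_mul (by positivity)]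
            congr 1
            field_simp

theorem isTest_mul_cutoff {ψ κ : E 3 → ℝ} (hψ : IsTest (Metric.ball x₀ (c.r / 2)) ψ)
    (hκ : ContDiff ℝ ∞ κ) {η : ℝ} (hη : 0 < η) (h0 : ∀ x, c.h x ≤ η → κ x = 0) :
    IsTest O (fun x => κ x * ψ x) := by
  refine ⟨hκ.mul hψ.1, hψ.2.1.mul_left, ?_⟩
  have h1 : tsupport (fun x => κ x * ψ x) ⊆ tsupport ψ ∩ {x | η ≤ c.h x} := by
    refine closure_minimal (fun x hx => ⟨subset_tsupport _ fun h => hx (by simp [h]), ?_⟩)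
      ((isClosed_tsupport ψ).inter (isClosed_le continuous_const c.lip.continuous))
    by_contra hlt
    exact hx (by simp [h0 x (not_le.1 hlt).le])
  intro x hx
  obtain ⟨h2, h3⟩ := h1 hx
  refine (c.mem_iff x ?_).2 (hη.trans_le h3)
  exact Metric.ball_subset_ball (by linarith [c.r_pos]) (hψ.2.2 h2)

/-- Where `h` is differentiable, its negative normalized gradient is the outer normal. -/
theorem isOuterNormal_proj {ρ δ : ℝ} (hδ : ρ + δ ≤ c.r) {y : E 3} (hy : y ∈ c.layer ρ δ)
    (hd : DifferentiableAt ℝ c.h y) :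
    ∃ n : E 3, IsOuterNormal O (c.proj y) n ∧ ∃ t : ℝ, ∀ i, pd i c.h y = t * n i := by
  set x := c.proj y with hx
  set a : E 3 := WithLp.toLp 2 fun i => pd i c.h y with ha
  have haL : ∀ v, fderiv ℝ c.h y v = inner ℝ a v := by
    intro v
    rw [fderiv_apply_eq_sum_pd, PiLp.inner_apply]
    refine Finset.sum_congr rfl fun i _ => ?_
    simp [a, mul_comm]
  have hhx : ∀ z, c.h z = c.h (z - c.h y • c.e) - c.h y := by
    intro z
    conv_lhs => rw [← sub_add_cancel z (c.h y • c.e), c.shift]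
  have hD : HasFDerivAt c.h (fderiv ℝ c.h y) x := by
    have h1 : HasFDerivAt c.h (fderiv ℝ c.h y) (x - c.h y • c.e) := by
      have : x - c.h y • c.e = y := by simp [hx, proj]
      rw [this]
      exact hd.hasFDerivAt
    have h2 := (HasFDerivAt.comp (g := c.h) (f := fun z => z - c.h y • c.e) x h1
      ((hasFDerivAt_id x).sub_const _)).sub_const (c.h y)
    refine h2.congr_of_eventuallyEq (Eventually.of_forall fun z => ?_)
    exact hhx z
  have hae : inner ℝ a c.e = -1 := by
    rw [← haL]
    have h1 : HasDerivAt (fun s : ℝ => y + s • c.e) c.e 0 := by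
      simpa using ((hasDerivAt_id (0 : ℝ)).smul_const c.e).const_add y
    have h2 : HasDerivAt (fun s : ℝ => c.h (y + s • c.e)) (fderiv ℝ c.h y c.e) 0 := by
      have hd' : HasFDerivAt c.h (fderiv ℝ c.h y) (y + (0 : ℝ) • c.e) := by
        simpa using hd.hasFDerivAt
      exact hd'.comp_hasDerivAt 0 h1
    simp only [c.shift] at h2
    exact h2.unique (by simpa using (hasDerivAt_id (0 : ℝ)).const_sub (c.h y))
  have ha0 : a ≠ 0 := by
    intro h
    rw [h, inner_zero_left] at hae
    norm_num at hae
  have hna : 0 < ‖a‖ := norm_pos_iff.2 ha0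
  refine ⟨(-‖a‖⁻¹) • a, ⟨?_, fun ε hε => ?_⟩, -‖a‖, fun i => ?_⟩
  · rw [norm_smul, norm_neg, norm_inv, norm_norm, inv_mul_cancel₀ hna.ne']
  · have h1 := hD.isLittleO.def (c := ε * ‖a‖) (by positivity)
    obtain ⟨r₁, hr₁, hr₁b⟩ := Metric.eventually_nhds_iff_ball.1 h1
    have hxr : x ∈ Metric.ball x₀ c.r := by
      have h1 := c.dist_proj y
      rw [abs_of_pos hy.2.1] at h1
      have h2 := hy.1
      rw [Metric.mem_ball] at h2 ⊢
      linarith [dist_triangle (c.proj y) y x₀, hy.2.2]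
    obtain ⟨r₂, hr₂, hr₂b⟩ := Metric.isOpen_ball.mem_nhds hxr |> Metric.mem_nhds_iff.1
    refine ⟨min r₁ r₂, lt_min hr₁ hr₂, fun z hz => ?_⟩
    have hz1 := hr₁b z (Metric.ball_subset_ball (min_le_left _ _) hz)
    have hz2 := hr₂b (Metric.ball_subset_ball (min_le_right _ _) hz)
    rw [show c.h x = 0 from c.h_proj y, sub_zero, haL, Real.norm_eq_abs, abs_le] at hz1
    have hin : inner ℝ ((-‖a‖⁻¹) • a) (z - x) = -(‖a‖⁻¹ * inner ℝ a (z - x)) := by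
      rw [inner_smul_left]; simp
    have hmul : inner ℝ a (z - x) = ‖a‖ * (‖a‖⁻¹ * inner ℝ a (z - x)) := by
      rw [← mul_assoc, mul_inv_cancel₀ hna.ne', one_mul]
    rw [hin, c.mem_iff z hz2]
    set q := ‖a‖⁻¹ * inner ℝ a (z - x) with hq
    rw [hmul] at hz1
    constructor
    · intro h
      have : ‖a‖ * (ε * ‖z - x‖) < ‖a‖ * q := by gcongr; linarith
      nlinarith [hz1.1]
    · intro h
      have : ‖a‖ * (ε * ‖z - x‖) < ‖a‖ * (-q) := by gcongr
      apply not_lt.2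
      nlinarith [hz1.2]
  · simp only [PiLp.smul_apply, smul_eq_mul, neg_mul, mul_neg, neg_neg]
    rw [← mul_assoc, mul_inv_cancel₀ hna.ne', one_mul]

theorem exists_volume_layer_le :
    ∃ C : ℝ≥0∞, C ≠ ⊤ ∧ ∀ δ, volume (c.layer (c.r / 2) δ) ≤ C * ENNReal.ofReal δ := by
  refine ⟨volume (Metric.ball (c.P x₀) (c.r / 2)), measure_ball_lt_top.ne, fun δ => ?_⟩
  rw [← c.measurePreserving.measure_preimage (c.isOpen_layer _ _).measurableSet.nullMeasurableSet]
  refine (measure_mono (t := Metric.ball (c.P x₀) (c.r / 2) ×ˢ Ioo 0 δ) ?_).trans ?_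
  · rintro ⟨x, t⟩ hq
    have h2 : 0 < c.h (c.G x - t • c.e) ∧ c.h (c.G x - t • c.e) < δ := hq.2
    rw [c.h_G_sub] at h2
    refine ⟨?_, h2⟩
    have h3 : c.P (c.G x - t • c.e) = x := by
      have := c.G_P (c.G x - t • c.e)
      rw [c.h_G_sub, sub_add_cancel] at this
      have h4 := congrArg c.P this
      rwa [c.P_G, c.P_G] at h4
    have h5 := c.P_lip.dist_le_mul (c.G x - t • c.e) x₀
    rw [h3, NNReal.coe_one, one_mul] at h5
    exact Metric.mem_ball.2 (h5.trans_lt hq.1)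
  · rw [Measure.prod_prod, Real.volume_Ioo, sub_zero]

end BoundaryChart

/-! ### Approximation of `1` by test functions that are almost tangential to a field in `V₀` -/

/-- `ψ` is the limit on `O` of a bounded sequence of test functions on `O` whose derivatives in the
direction of `V` converge to that of `ψ` in `L²(O)`. If `V` is tangential to the boundary, this does not need any
boundary condition on `ψ`. -/
def HasInnerApprox {F : Type*} [NormedAddCommGroup F] [NormedSpace ℝ F] (O : Set (E 3))
    (V : Fin 3 → E 3 → F) (ψ : E 3 → ℝ) : Prop :=
  ∃ φ : ℕ → E 3 → ℝ, (∀ n, IsTest O (φ n)) ∧ (∃ C, ∀ n x, |φ n x| ≤ C) ∧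
    (∀ x ∈ O, Tendsto (fun n => φ n x) atTop (𝓝 (ψ x))) ∧
    Tendsto (fun n => eLpNorm (fun x => ∑ i, (pd i (φ n) x - pd i ψ x) • V i x) 2
      (volume.restrict O)) atTop (𝓝 0)

section InnerApprox

variable {F : Type*} [NormedAddCommGroup F] [NormedSpace ℝ F] {O : Set (E 3)}
  {V : Fin 3 → E 3 → F} {ψ ψ' : E 3 → ℝ}

theorem isTest_zero {d : ℕ} {D : Set (E d)} : IsTest D (0 : E d → F) :=
  ⟨contDiff_const, HasCompactSupport.zero, by simp [tsupport]⟩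

theorem IsTest.exists_bound {d : ℕ} {D : Set (E d)} {φ : E d → F} (h : IsTest D φ) :
    ∃ C ≥ 0, ∀ x, ‖φ x‖ ≤ C := by
  obtain ⟨C, hC⟩ := h.2.1.exists_bound_of_continuous h.1.continuous
  exact ⟨C, (norm_nonneg _).trans (hC 0), hC⟩

theorem IsTest.bounded_smul {d : ℕ} {D D' : Set (E d)} {φ : E d → ℝ} (h : IsTest D' φ)
    {f : E d → F} (hf : MemL2 D f) : MemL2 D (fun x => φ x • f x) := by
  obtain ⟨C, -, hC⟩ := h.exists_bound
  exact MemLp.of_le_mul hf (h.1.continuous.aestronglyMeasurable.smul hf.1)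
    (Eventually.of_forall fun x => by
      rw [norm_smul]; exact mul_le_mul_of_nonneg_right (hC x) (norm_nonneg _))

theorem HasInnerApprox.of_isTest (h : IsTest O ψ) : HasInnerApprox O V ψ := by
  obtain ⟨C, -, hC⟩ := h.exists_bound
  exact ⟨fun _ => ψ, fun _ => h, ⟨C, fun _ x => hC x⟩, fun x _ => tendsto_const_nhds, by simp⟩

theorem HasInnerApprox.of_eq_zero (hO : IsOpen O) (h : ∀ x ∈ O, ψ x = 0) :
    HasInnerApprox O V ψ := by
  refine ⟨fun _ => 0, fun _ => isTest_zero, ⟨0, fun _ x => by simp⟩, fun x hx => ?_, ?_⟩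
  · simp [h x hx]
  · have : ∀ᵐ x ∂(volume.restrict O),
        (∑ i, (pd i (0 : E 3 → ℝ) x - pd i ψ x) • V i x) = (0 : E 3 → F) x := by
      filter_upwards [ae_restrict_mem hO.measurableSet] with x hx
      have h0 : ψ =ᶠ[𝓝 x] (0 : E 3 → ℝ) := by
        filter_upwards [hO.mem_nhds hx] with z hz using h z hz
      have : ∀ i, pd i (0 : E 3 → ℝ) x - pd i ψ x = 0 := fun i => by
        rw [pd, pd, h0.fderiv_eq, sub_self]
      simp [this]
    simp_rw [eLpNorm_congr_ae this]
    simp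

theorem HasInnerApprox.add (hV : ∀ i, MemL2 O (V i)) (hψ : IsTest univ ψ) (hψ' : IsTest univ ψ')
    (h : HasInnerApprox O V ψ) (h' : HasInnerApprox O V ψ') :
    HasInnerApprox O V (fun x => ψ x + ψ' x) := by
  obtain ⟨φ, h1, ⟨C, hC⟩, h2, h3⟩ := h
  obtain ⟨φ', h1', ⟨C', hC'⟩, h2', h3'⟩ := h'
  refine ⟨fun n x => φ n x + φ' n x, fun n => (h1 n).add (h1' n), ⟨C + C', fun n x =>
    (abs_add_le _ _).trans (add_le_add (hC n x) (hC' n x))⟩,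
    fun x hx => (h2 x hx).add (h2' x hx), ?_⟩
  have hs : Tendsto (fun n => eLpNorm (fun x => ∑ i, (pd i (φ n) x - pd i ψ x) • V i x) 2
      (volume.restrict O) + eLpNorm (fun x => ∑ i, (pd i (φ' n) x - pd i ψ' x) • V i x) 2
      (volume.restrict O)) atTop (𝓝 0) := by simpa using h3.add h3'
  refine tendsto_of_tendsto_of_tendsto_of_le_of_le tendsto_const_nhds hs (fun _ => zero_le) ?_
  intro n
  have hm : ∀ {a b : E 3 → ℝ}, ContDiff ℝ ∞ a → ContDiff ℝ ∞ b → AEStronglyMeasurable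
      (fun x => ∑ i, (pd i a x - pd i b x) • V i x) (volume.restrict O) := fun ha hb =>
    Finset.aestronglyMeasurable_fun_sum _ fun i _ =>
      ((contDiff_pd ha i).continuous.sub (contDiff_pd hb i).continuous).aestronglyMeasurable.smul
        (hV i).1
  have hE : (fun x => ∑ i, (pd i (fun x => φ n x + φ' n x) x - pd i (fun x => ψ x + ψ' x) x) • V i x)
      = (fun x => ∑ i, (pd i (φ n) x - pd i ψ x) • V i x)
        + fun x => ∑ i, (pd i (φ' n) x - pd i ψ' x) • V i x := ?_
  · simp only
    rw [hE]
    exact eLpNorm_add_le (hm (h1 n).1 hψ.1) (hm (h1' n).1 hψ'.1) one_le_two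
  ext x
  simp only [Pi.add_apply, ← Finset.sum_add_distrib, ← add_smul]
  refine Finset.sum_congr rfl fun i _ => ?_
  rw [pd_add ((h1 n).1.differentiable (by simp) x) ((h1' n).1.differentiable (by simp) x),
    pd_add (hψ.1.differentiable (by simp) x) (hψ'.1.differentiable (by simp) x)]
  congr 1
  ring

/-- The widths of the layers used near a boundary point. -/
theorem tendsto_layerWidth (c : ℝ) :
    Tendsto (fun n : ℕ => c / ((n : ℝ) + 1)) atTop (𝓝 0) := by
  simpa [div_eq_mul_inv] using (tendsto_one_div_add_atTop_nhds_zero_nat (𝕜 := ℝ)).const_mul c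

namespace BoundaryChart

variable {x₀ : E 3} (c : BoundaryChart O x₀)

theorem tendsto_eLpNorm_layer {F' : Type*} [NormedAddCommGroup F'] {f : E 3 → F'} (hf : MemL2 O f) {δ : ℕ → ℝ}
    (hδ : Tendsto δ atTop (𝓝 0)) :
    Tendsto (fun n => eLpNorm f 2 (volume.restrict (c.layer c.r (δ n)))) atTop (𝓝 0) := by
  have hm : ∀ n, MeasurableSet (c.layer c.r (δ n)) := fun n => (c.isOpen_layer _ _).measurableSet
  have h := tendsto_eLpNorm_two_zero_of_dominated hf 1
    (u := fun n => (c.layer c.r (δ n)).indicator f) (fun n => hf.1.indicator (hm n))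
    (fun n => Eventually.of_forall fun x => by
      rw [one_mul]; exact norm_indicator_le_norm_self f x)
    (Eventually.of_forall fun x => by
      refine tendsto_const_nhds.congr' ?_
      by_cases hx : 0 < c.h x
      · filter_upwards [hδ.eventually (gt_mem_nhds hx)] with n hn
        rw [indicator_of_notMem]
        exact fun h => lt_asymm hn h.2.2
      · refine Eventually.of_forall fun n => ?_
        simp only
        rw [indicator_of_notMem]
        exact fun h => hx h.2.1)
  refine h.congr fun n => ?_
  rw [eLpNorm_indicator_eq_eLpNorm_restrict (hm n), Measure.restrict_restrict (hm n),
    inter_eq_self_of_subset_left c.layer_subset]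

/-- A field in `V₀` is almost orthogonal to `∇h` near the boundary. -/
theorem eLpNorm_sum_pd_smul_le [CompleteSpace F] {g : Fin 3 → E 3 → F}
    (hV : ∀ i, HasTrace O (V i) (g i))
    (hg : ∀ᵐ x ∂(surf O), ∀ n : E 3, IsOuterNormal O x n → ∑ i, n i • g i x = 0) {δ : ℝ}
    (hδ0 : 0 ≤ δ) (hδ : c.r / 2 + δ ≤ c.r) :
    eLpNorm (fun x => ∑ i, pd i c.h x • V i x) 2 (volume.restrict (c.layer (c.r / 2) δ))
      ≤ c.K * (ENNReal.ofReal δ * ∑ j, eLpNorm (fun y => ∑ i, c.e i • weakPartial O i (V j) y) 2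
          (volume.restrict (c.layer c.r δ))) := by
  set Q := volume.restrict (c.layer (c.r / 2) δ) with hQdef
  have hQ : Q ≤ volume.restrict O := Measure.restrict_mono c.layer_half_subset le_rfl
  have hmem : ∀ᵐ y ∂Q, y ∈ c.layer (c.r / 2) δ := ae_restrict_mem (c.isOpen_layer _ _).measurableSet
  have hae : (fun y => ∑ i, pd i c.h y • V i y)
      =ᵐ[Q] fun y => ∑ i, pd i c.h y • (V i - g i ∘ c.proj) y := by
    filter_upwards [hmem, c.ae_comp_proj hg hδ,
      ae_restrict_of_ae (c.lip.ae_differentiableAt (μ := volume))] with y hy hgy hdy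
    obtain ⟨n, hn, t, ht⟩ := c.isOuterNormal_proj hδ hy hdy
    have h0 : ∑ i, pd i c.h y • g i (c.proj y) = 0 := by
      simp_rw [ht, mul_smul, ← Finset.smul_sum]
      rw [hgy n hn, smul_zero]
    simp only [Pi.sub_apply, smul_sub, Finset.sum_sub_distrib, Function.comp]
    rw [h0, sub_zero]
  have hpd : ∀ x i, ‖pd i c.h x‖ ≤ c.K := fun x i =>
    (norm_pd_le _ _ _).trans (norm_fderiv_le_of_lipschitz ℝ c.lip)
  rw [eLpNorm_congr_ae hae]
  have hs : (fun y => ∑ i, pd i c.h y • (V i - g i ∘ c.proj) y)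
      = ∑ i, fun y => pd i c.h y • (V i - g i ∘ c.proj) y := by
    ext y; simp
  have hm : ∀ i, AEStronglyMeasurable (V i - g i ∘ c.proj) Q := fun i =>
    ((hV i).1.1.1.mono_measure hQ).sub (c.aestronglyMeasurable_comp_proj (hV i).2.1.1 hδ)
  rw [hs, Finset.mul_sum, Finset.mul_sum]
  refine (eLpNorm_sum_le (fun i _ => (measurable_fderiv_apply_const ℝ c.h
    _).aestronglyMeasurable.smul (hm i)) one_le_two).trans (Finset.sum_le_sum fun i _ => ?_)
  refine (eLpNorm_le_mul_eLpNorm_of_ae_le_mul (c := c.K) (g := V i - g i ∘ c.proj)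
    (Eventually.of_forall fun x => ?_) 2).trans ?_
  · change ‖pd i c.h x • (V i - g i ∘ c.proj) x‖ ≤ _
    rw [norm_smul]
    exact mul_le_mul_of_nonneg_right (hpd x i) (norm_nonneg _)
  · rw [ENNReal.ofReal_coe_nnreal]
    gcongr
    exact c.eLpNorm_sub_trace_comp_proj_le (hV i) hδ hδ0

/-- Cutoffs `κₙ → 1` on `O`, for layers of width `δₙ → 0`, multiplied with `f ∈ L²(O)` supported in
the chart. -/
theorem tendsto_eLpNorm_cutoff_sub_one_smul {f : E 3 → F} (hO : IsOpen O) (hf : MemL2 O f)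
    (hf0 : ∀ x ∉ Metric.ball x₀ c.r, f x = 0) {δ : ℕ → ℝ} (hδ : Tendsto δ atTop (𝓝 0))
    {κ : ℕ → E 3 → ℝ} (hκ : ∀ n, ContDiff ℝ ∞ (κ n)) (h01 : ∀ n x, 0 ≤ κ n x ∧ κ n x ≤ 1)
    (h1 : ∀ n x, δ n ≤ c.h x → κ n x = 1) :
    Tendsto (fun n => eLpNorm (fun x => (κ n x - 1) • f x) 2 (volume.restrict O)) atTop (𝓝 0) := by
  refine tendsto_eLpNorm_two_zero_of_dominated hf 1
    (fun n => ((hκ n).continuous.sub continuous_const).aestronglyMeasurable.smul hf.1)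
    (fun n => Eventually.of_forall fun x => ?_) ?_
  · rw [norm_smul]
    gcongr
    rw [Real.norm_eq_abs, abs_le]
    constructor <;> linarith [(h01 n x).1, (h01 n x).2]
  · filter_upwards [ae_restrict_mem hO.measurableSet] with x hx
    by_cases hb : x ∈ Metric.ball x₀ c.r
    · refine tendsto_const_nhds.congr' ?_
      filter_upwards [hδ.eventually (gt_mem_nhds ((c.mem_iff x hb).1 hx))] with n hn
      rw [h1 n x hn.le, sub_self, zero_smul]
    · simp [hf0 x hb]

theorem hasInnerApprox [CompleteSpace F] (hO : IsOpen O) (hV : MemV0 O V)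
    (hψ : IsTest (Metric.ball x₀ (c.r / 2)) ψ) : HasInnerApprox O V ψ := by
  obtain ⟨g, hVg, hg⟩ := hV
  have hV2 : ∀ i, MemL2 O (V i) := fun i => (hVg i).1.1
  obtain ⟨C, hC0, hcut⟩ := c.exists_cutoff hV2
  have hr := c.r_pos
  let δ : ℕ → ℝ := fun n => (c.r / 2) / ((n : ℝ) + 1)
  have hδpos : ∀ n, 0 < δ n := fun n => by positivity
  have hδle : ∀ n, δ n ≤ c.r / 2 := fun n =>
    div_le_self (by positivity) (by linarith [(Nat.cast_nonneg n : (0 : ℝ) ≤ n)])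
  have hδ0 : Tendsto δ atTop (𝓝 0) := tendsto_layerWidth _
  choose κ hκ h01 h1 hη hκC hκs hκV using fun n => hcut (δ n) (hδpos n)
  choose η hηpos hη0 using hη
  have hball : Metric.ball x₀ (c.r / 2) ⊆ Metric.ball x₀ c.r :=
    Metric.ball_subset_ball (by linarith)
  obtain ⟨M, hM0, hM⟩ := hψ.exists_bound
  refine ⟨fun n x => κ n x * ψ x, fun n => c.isTest_mul_cutoff hψ (hκ n) (hηpos n) (hη0 n),
    ⟨M, fun n x => ?_⟩, fun x hx => ?_, ?_⟩
  · rw [abs_mul, abs_of_nonneg (h01 n x).1]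
    calc κ n x * |ψ x| ≤ 1 * M := mul_le_mul (h01 n x).2 (hM x) (abs_nonneg _) zero_le_one
      _ = M := one_mul M
  · by_cases hb : x ∈ Metric.ball x₀ c.r
    · refine tendsto_const_nhds.congr' ?_
      filter_upwards [hδ0.eventually (gt_mem_nhds ((c.mem_iff x hb).1 hx))] with n hn
      rw [h1 n x hn.le, one_mul]
    · have : ψ x = 0 := image_eq_zero_of_notMem_tsupport fun h => hb (hball (hψ.2.2 h))
      simp [this]
  · set W : E 3 → F := fun x => ∑ i, pd i ψ x • V i x with hW
    have hWm : MemL2 O W := memLp_finsetSum _ fun i _ => (hψ.pd i).bounded_smul (hV2 i)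
    have hW0 : ∀ x ∉ Metric.ball x₀ c.r, W x = 0 := fun x hx => by
      have : ∀ i, pd i ψ x = 0 := fun i => pd_eq_zero_of_notMem (fun h => hx (hball (hψ.2.2 h))) i
      simp [hW, this]
    have t1 := c.tendsto_eLpNorm_cutoff_sub_one_smul hO hWm hW0 hδ0 hκ h01 h1
    -- the derivative of the cutoff contributes on the layer only
    let Z : ℕ → E 3 → F := fun n x => ψ x • ∑ i, pd i (κ n) x • V i x
    have hZm : ∀ n, AEStronglyMeasurable (Z n) (volume.restrict O) := fun n =>
      hψ.1.continuous.aestronglyMeasurable.smul (Finset.aestronglyMeasurable_fun_sum _ fun i _ =>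
        (contDiff_pd (hκ n) i).continuous.aestronglyMeasurable.smul (hV2 i).1)
    let S : ℕ → ℝ≥0∞ := fun n => ∑ j, eLpNorm (fun y => ∑ i, c.e i • weakPartial O i (V j) y) 2
          (volume.restrict (c.layer c.r (δ n)))
    have hS : Tendsto S atTop (𝓝 0) := by
      have : Tendsto S atTop (𝓝 (∑ _j : Fin 3, 0)) := by
        refine tendsto_finsetSum _ fun j _ => c.tendsto_eLpNorm_layer ?_ hδ0
        exact memLp_finsetSum _ fun i _ => ((hVg j).1.hasWeakPartial i).1.const_smul (c.e i)
      simpa using this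
    have hZ : ∀ n, eLpNorm (Z n) 2 (volume.restrict O)
        ≤ ENNReal.ofReal M * (ENNReal.ofReal C * (c.K * S n) + ENNReal.ofReal (δ n)) := by
      intro n
      have hsupp : Function.support (Z n) ∩ O ⊆ c.layer (c.r / 2) (δ n) := by
        rintro x ⟨hx, -⟩
        have hψx : ψ x ≠ 0 := fun h => hx (by simp [Z, h])
        have hex : ∃ i, pd i (κ n) x ≠ 0 := by
          by_contra hcon
          push Not at hcon
          exact hx (by simp [Z, hcon])
        obtain ⟨i, hi⟩ := hex
        exact ⟨hψ.2.2 (subset_tsupport _ hψx), hκs n x i hi⟩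
      have hQm : MeasurableSet (c.layer (c.r / 2) (δ n)) := (c.isOpen_layer _ _).measurableSet
      have e1 : eLpNorm (Z n) 2 (volume.restrict O)
          = eLpNorm (Z n) 2 (volume.restrict (c.layer (c.r / 2) (δ n))) := by
        have e2 : Z n =ᵐ[volume.restrict O] (c.layer (c.r / 2) (δ n)).indicator (Z n) := by
          filter_upwards [ae_restrict_mem hO.measurableSet] with x hx
          by_cases hz : Z n x = 0
          · rw [hz]
            by_cases hq : x ∈ c.layer (c.r / 2) (δ n)
            · rw [indicator_of_mem hq, hz]
            · rw [indicator_of_notMem hq]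
          · rw [indicator_of_mem (hsupp ⟨hz, hx⟩)]
        rw [eLpNorm_congr_ae e2, eLpNorm_indicator_eq_eLpNorm_restrict hQm,
          Measure.restrict_restrict hQm, inter_eq_self_of_subset_left c.layer_half_subset]
      rw [e1]
      refine (eLpNorm_le_mul_eLpNorm_of_ae_le_mul (c := M)
        (g := fun x => ∑ i, pd i (κ n) x • V i x) (Eventually.of_forall fun x => ?_) 2).trans ?_
      · rw [norm_smul]
        exact mul_le_mul_of_nonneg_right (hM x) (norm_nonneg _)
      · refine mul_le_mul' le_rfl ((hκV n).trans (add_le_add ?_ le_rfl))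
        refine (mul_le_mul' le_rfl (c.eLpNorm_sum_pd_smul_le hVg hg (hδpos n).le
          (by linarith [hδle n]))).trans (le_of_eq ?_)
        have : ENNReal.ofReal C = ENNReal.ofReal (C / δ n) * ENNReal.ofReal (δ n) := by
          rw [← ENNReal.ofReal_mul (by have := hδpos n; positivity), div_mul_cancel₀ _ (hδpos n).ne']
        rw [this]
        ring
    have hZlim : Tendsto (fun n => eLpNorm (Z n) 2 (volume.restrict O)) atTop (𝓝 0) := by
      have hb : Tendsto (fun n => ENNReal.ofReal M * (ENNReal.ofReal C * (c.K * S n)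
          + ENNReal.ofReal (δ n))) atTop
          (𝓝 (ENNReal.ofReal M * (ENNReal.ofReal C * (c.K * 0) + ENNReal.ofReal 0))) := by
        refine ENNReal.Tendsto.const_mul (Tendsto.add ?_ (ENNReal.tendsto_ofReal hδ0))
          (Or.inr (by simp))
        exact ENNReal.Tendsto.const_mul (ENNReal.Tendsto.const_mul hS (Or.inr (by simp)))
          (Or.inr (by simp))
      simp only [mul_zero, ENNReal.ofReal_zero, add_zero] at hb
      exact tendsto_of_tendsto_of_tendsto_of_le_of_le tendsto_const_nhds hb (fun _ => zero_le) hZ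
    have hsum : Tendsto (fun n => eLpNorm (fun x => (κ n x - 1) • W x) 2 (volume.restrict O)
        + eLpNorm (Z n) 2 (volume.restrict O)) atTop (𝓝 0) := by simpa using t1.add hZlim
    refine tendsto_of_tendsto_of_tendsto_of_le_of_le tendsto_const_nhds hsum (fun _ => zero_le) ?_
    intro n
    have hE : (fun x => ∑ i, (pd i (fun x => κ n x * ψ x) x - pd i ψ x) • V i x)
        = (fun x => (κ n x - 1) • W x) + Z n := ?_
    · simp only
      rw [hE]
      exact eLpNorm_add_le (((hκ n).continuous.sub
        continuous_const).aestronglyMeasurable.smul hWm.1) (hZm n) one_le_two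
    ext x
    have hp : ∀ i, pd i (fun x => κ n x * ψ x) x = κ n x * pd i ψ x + pd i (κ n) x * ψ x :=
      fun i => pd_smul ((hκ n).differentiable (by simp) x) (hψ.1.differentiable (by simp) x) i
    simp only [hp, Z, hW, Pi.add_apply, Finset.smul_sum, smul_smul, ← Finset.sum_add_distrib,
      ← add_smul]
    refine Finset.sum_congr rfl fun i _ => ?_
    congr 1
    ring

end BoundaryChart

theorem exists_isTest_eq_one {d : ℕ} {D : Set (E d)} (hb : Bornology.IsBounded D) :
    ∃ ψ : E d → ℝ, IsTest univ ψ ∧ ∀ x ∈ D, ψ x = 1 := by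
  obtain ⟨R, hR0, hR⟩ := hb.exists_pos_norm_le
  let ρ : ContDiffBump (0 : E d) := ⟨R, R + 1, hR0, by linarith⟩
  exact ⟨ρ, ⟨ρ.contDiff, ρ.hasCompactSupport, subset_univ _⟩, fun x hx =>
    ρ.one_of_mem_closedBall (by simpa [mem_closedBall_zero_iff] using hR x hx)⟩

/-- For a field `V` in `V₀` there are test functions on `O` which are bounded, converge to `1` and
whose derivatives in the direction of `V` converge to `0` in `L²(O)`. -/
theorem MemV0.exists_tendsto_one [CompleteSpace F] (hO : IsOpen O) (hb : Bornology.IsBounded O)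
    (hL : HasLipschitzBoundary O) (hV : MemV0 O V) :
    ∃ φ : ℕ → E 3 → ℝ, (∀ n, IsTest O (φ n)) ∧ (∃ C, ∀ n x, |φ n x| ≤ C) ∧
      (∀ x ∈ O, Tendsto (fun n => φ n x) atTop (𝓝 1)) ∧
      Tendsto (fun n => eLpNorm (fun x => ∑ i, pd i (φ n) x • V i x) 2
        (volume.restrict O)) atTop (𝓝 0) := by
  have hV2 : ∀ i, MemL2 O (V i) := by
    obtain ⟨g, hg, -⟩ := hV
    exact fun i => (hg i).1.1
  obtain ⟨ψ, hψ, hψ1⟩ := exists_isTest_eq_one hb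
  have key : HasInnerApprox O V ψ := by
    refine forall_isTest_of_local (P := HasInnerApprox O V)
      (HasInnerApprox.of_eq_zero hO fun _ _ => rfl)
      (fun ψ ψ' h h' => HasInnerApprox.add hV2 h h') (fun x => ?_) hψ
    by_cases hx : x ∈ closure O
    · by_cases hxO : x ∈ O
      · exact ⟨O, hO, hxO, fun _ h => HasInnerApprox.of_isTest h⟩
      · obtain ⟨c⟩ := nonempty_boundaryChart hL (x₀ := x) ⟨hx, fun h => hxO (interior_subset h)⟩
        exact ⟨_, Metric.isOpen_ball, Metric.mem_ball_self (half_pos c.r_pos),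
          fun _ h => c.hasInnerApprox hO hV h⟩
    · refine ⟨(closure O)ᶜ, isClosed_closure.isOpen_compl, hx, fun ψ h =>
        HasInnerApprox.of_eq_zero hO fun z hz => ?_⟩
      exact image_eq_zero_of_notMem_tsupport fun h' => h.2.2 h' (subset_closure hz)
  obtain ⟨φ, h1, h2, h3, h4⟩ := key
  refine ⟨φ, h1, h2, fun x hx => by simpa [hψ1 x hx] using h3 x hx, h4.congr fun n => ?_⟩
  refine eLpNorm_congr_ae ?_
  filter_upwards [ae_restrict_mem hO.measurableSet] with x hx
  refine Finset.sum_congr rfl fun i _ => ?_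
  have h0 : ψ =ᶠ[𝓝 x] fun _ => 1 := by
    filter_upwards [hO.mem_nhds hx] with z hz using hψ1 z hz
  have : pd i ψ x = 0 := by rw [pd, h0.fderiv_eq]; simp
  rw [this, sub_zero]

end InnerApprox

/-! ### Consequences for fields in `V₀` and the trace bound for integrals of derivatives -/

section Integrals

variable {F : Type*} [NormedAddCommGroup F] [NormedSpace ℝ F] {O : Set (E 3)}

theorem tendsto_integral_smul_of_bounded {α : Type*} [MeasurableSpace α] {μ : Measure α}
    {φ : ℕ → α → ℝ} {f : α → F} (hf : Integrable f μ) {C : ℝ}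
    (hφ : ∀ n, AEStronglyMeasurable (φ n) μ) (hC : ∀ n x, |φ n x| ≤ C)
    (hlim : ∀ᵐ x ∂μ, Tendsto (fun n => φ n x) atTop (𝓝 1)) :
    Tendsto (fun n => ∫ x, φ n x • f x ∂μ) atTop (𝓝 (∫ x, f x ∂μ)) := by
  refine tendsto_integral_of_dominated_convergence (fun x => C * ‖f x‖)
    (fun n => (hφ n).smul hf.1) (hf.norm.const_mul C) (fun n => Eventually.of_forall fun x => ?_) ?_
  · rw [norm_smul]
    exact mul_le_mul_of_nonneg_right (hC n x) (norm_nonneg _)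
  · filter_upwards [hlim] with x hx
    simpa using hx.smul_const (f x)

/-- The divergence of a field in `V₀` has mean value zero. -/
theorem integral_weakDiv_eq_zero [CompleteSpace F] (hO : IsOpen O) (hb : Bornology.IsBounded O)
    (hL : HasLipschitzBoundary O) {V : Fin 3 → E 3 → F} (hV : MemV0 O V) :
    ∫ x in O, weakDiv O V x = 0 := by
  have : IsFiniteMeasure (volume.restrict O) := ⟨by simpa using hb.measure_lt_top⟩
  obtain ⟨φ, hφ, ⟨C, hC⟩, h1, h2⟩ := hV.exists_tendsto_one hO hb hL
  obtain ⟨g, hg, -⟩ := hV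
  have hV1 : ∀ i, MemH1 O (V i) := fun i => (hg i).1
  have hw : ∀ i, MemL2 O (weakPartial O i (V i)) := fun i => ((hV1 i).hasWeakPartial i).1
  have hdiv : MemL2 O (weakDiv O V) := memLp_finsetSum _ fun i _ => hw i
  have t1 := tendsto_integral_smul_of_bounded (hdiv.integrable one_le_two)
    (fun n => (hφ n).1.continuous.aestronglyMeasurable) hC
    (by filter_upwards [ae_restrict_mem hO.measurableSet] with x hx using h1 x hx)
  have hm : ∀ n, MemL2 O (fun x => ∑ i, pd i (φ n) x • V i x) := fun n =>
    memLp_finsetSum _ fun i _ => ((hφ n).pd i).bounded_smul (hV1 i).1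
  have t2 : Tendsto (fun n => ∫ x in O, (1 : ℝ) • ∑ i, pd i (φ n) x • V i x) atTop
      (𝓝 (∫ x in O, (1 : ℝ) • (0 : E 3 → F) x)) :=
    tendsto_integral_smul_right (memLp_const _) hm MemLp.zero (by simpa using h2)
  simp only [one_smul, Pi.zero_apply, integral_zero] at t2
  have t3 := t2.neg
  rw [neg_zero] at t3
  refine tendsto_nhds_unique t1 (t3.congr fun n => ?_)
  rw [integral_finsetSum _ fun i _ => ((hφ n).pd i).integrable_smul (hV1 i).1]
  simp only [weakDiv, Finset.smul_sum]
  rw [integral_finsetSum _ fun i _ => (hφ n).integrable_smul (hw i), ← Finset.sum_neg_distrib]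
  refine Finset.sum_congr rfl fun i _ => ?_
  rw [((hV1 i).hasWeakPartial i).2 _ (hφ n), neg_neg]

/-- If `U` is tangential to the boundary, then `∫ U · ∇p = - ∫ (div U) p` without boundary terms. -/
theorem HasTransport.integral_eq {𝕜 : Type*} [RCLike 𝕜] (hO : IsOpen O)
    (hb : Bornology.IsBounded O) (hL : HasLipschitzBoundary O) {U : Fin 3 → E 3 → ℝ}
    (hU : MemV0 O U) {p g : E 3 → 𝕜} (hp : MemL2 O p) (h : HasTransport O U p g) :
    ∫ x in O, g x = - ∫ x in O, weakDiv O U x • p x := by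
  have : IsFiniteMeasure (volume.restrict O) := ⟨by simpa using hb.measure_lt_top⟩
  obtain ⟨φ, hφ, ⟨C, hC⟩, h1, h2⟩ := hU.exists_tendsto_one hO hb hL
  obtain ⟨γ, hγ, -⟩ := hU
  have hU1 : ∀ i, MemH1 O (U i) := fun i => (hγ i).1
  have hdiv : MemL2 O (weakDiv O U) :=
    memLp_finsetSum _ fun i _ => ((hU1 i).hasWeakPartial i).1
  have hlim : ∀ᵐ x ∂(volume.restrict O), Tendsto (fun n => φ n x) atTop (𝓝 1) := by
    filter_upwards [ae_restrict_mem hO.measurableSet] with x hx using h1 x hx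
  have hφm : ∀ n, AEStronglyMeasurable (φ n) (volume.restrict O) :=
    fun n => (hφ n).1.continuous.aestronglyMeasurable
  have t1 := tendsto_integral_smul_of_bounded (h.1.integrable one_le_two) hφm hC hlim
  have hdp := integrable_smul_of_memLp_two hdiv hp
  have t2 := tendsto_integral_smul_of_bounded hdp hφm hC hlim
  have hm : ∀ n, MemL2 O (fun x => ∑ i, pd i (φ n) x • U i x) := fun n =>
    memLp_finsetSum _ fun i _ => ((hφ n).pd i).bounded_smul (hU1 i).1
  have t3 : Tendsto (fun n => ∫ x in O, (∑ i, pd i (φ n) x • U i x) • p x) atTop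
      (𝓝 (∫ x in O, (0 : E 3 → ℝ) x • p x)) :=
    tendsto_integral_smul_left hm MemLp.zero hp (by simpa using h2)
  simp only [Pi.zero_apply, zero_smul, integral_zero] at t3
  refine tendsto_nhds_unique t1 ?_
  have t4 := (t3.add t2).neg
  rw [zero_add] at t4
  refine t4.congr fun n => ?_
  have e : ∫ x in O, φ n x • weakDiv O U x • p x = ∫ x in O, (φ n x • weakDiv O U x) • p x := by
    simp only [smul_assoc]
  rw [h.2 _ (hφ n), e, ← integral_add (integrable_smul_of_memLp_two (hm n) hp)
    (integrable_smul_of_memLp_two ((hφ n).bounded_smul hdiv) hp)]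
  congr 1
  refine integral_congr_ae (Eventually.of_forall fun x => ?_)
  simp only [← add_smul, smul_eq_mul, mul_comm]

/-- A bound for `∫ ∂ᵢ(ψ f)` in terms of the trace of `f`, uniform in `f`. -/
def HasTraceBound (F : Type*) [NormedAddCommGroup F] [NormedSpace ℝ F] (O : Set (E 3))
    (ψ : E 3 → ℝ) : Prop :=
  ∃ C : ℝ≥0∞, C ≠ ⊤ ∧ ∀ f g : E 3 → F, HasTrace O f g → ∀ i,
    ‖∫ x in O, (ψ x • weakPartial O i f x + pd i ψ x • f x)‖ₑ ≤ C * eLpNorm g 2 (surf O)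

variable {ψ ψ' : E 3 → ℝ}

theorem HasTraceBound.of_isTest (h : IsTest O ψ) : HasTraceBound F O ψ := by
  refine ⟨0, by simp, fun f g hfg i => ?_⟩
  have hw := hfg.1.hasWeakPartial i
  rw [integral_add (h.integrable_smul hw.1) ((h.pd i).integrable_smul hfg.1.1), hw.2 _ h,
    add_neg_cancel]
  simp

theorem HasTraceBound.of_eq_zero (hO : IsOpen O) (h : ∀ x ∈ O, ψ x = 0) :
    HasTraceBound F O ψ := by
  refine ⟨0, by simp, fun f g hfg i => ?_⟩
  rw [setIntegral_eq_zero_of_forall_eq_zero]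
  · simp
  · intro x hx
    have h0 : ψ =ᶠ[𝓝 x] (fun _ => 0) := by
      filter_upwards [hO.mem_nhds hx] with z hz using h z hz
    simp [h x hx, pd, h0.fderiv_eq]

theorem HasTraceBound.add (hψ : IsTest univ ψ) (hψ' : IsTest univ ψ') (h : HasTraceBound F O ψ)
    (h' : HasTraceBound F O ψ') : HasTraceBound F O (fun x => ψ x + ψ' x) := by
  obtain ⟨C, hC, h1⟩ := h
  obtain ⟨C', hC', h1'⟩ := h'
  refine ⟨C + C', by finiteness, fun f g hfg i => ?_⟩
  have hw := (hfg.1.hasWeakPartial i).1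
  have hint : ∀ {ψ : E 3 → ℝ}, IsTest univ ψ → Integrable
      (fun x => ψ x • weakPartial O i f x + pd i ψ x • f x) (volume.restrict O) := fun hψ =>
    (integrable_smul_of_memLp_two (hψ.memLp _ _) hw).add
      (integrable_smul_of_memLp_two ((hψ.pd i).memLp _ _) hfg.1.1)
  have e : ∫ x in O, ((ψ x + ψ' x) • weakPartial O i f x + pd i (fun x => ψ x + ψ' x) x • f x)
      = (∫ x in O, (ψ x • weakPartial O i f x + pd i ψ x • f x))
        + ∫ x in O, (ψ' x • weakPartial O i f x + pd i ψ' x • f x) := by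
    rw [← integral_add (hint hψ) (hint hψ')]
    refine integral_congr_ae (Eventually.of_forall fun x => ?_)
    simp only
    rw [pd_add (hψ.1.differentiable (by simp) x) (hψ'.1.differentiable (by simp) x)]
    simp only [add_smul]
    abel
  rw [e, add_mul]
  exact (enorm_add_le _ _).trans (add_le_add (h1 f g hfg i) (h1' f g hfg i))

theorem BoundaryChart.hasTraceBound [CompleteSpace F] (hO : IsOpen O)
    (hb : Bornology.IsBounded O) {x₀ : E 3} (c : BoundaryChart O x₀)
    (hψ : IsTest (Metric.ball x₀ (c.r / 2)) ψ) : HasTraceBound F O ψ := by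
  have : IsFiniteMeasure (volume.restrict O) := ⟨by simpa using hb.measure_lt_top⟩
  obtain ⟨C, hC0, hcut⟩ := c.exists_cutoff (f := fun _ _ => (0 : ℝ)) (fun _ => MemLp.zero)
  obtain ⟨C₁, hC₁, hvol⟩ := c.exists_volume_layer_le
  obtain ⟨C₂, hC₂, hsurf⟩ := c.exists_eLpNorm_comp_proj_le (F := F)
  have hr := c.r_pos
  let δ : ℕ → ℝ := fun n => (c.r / 2) / ((n : ℝ) + 1)
  have hδpos : ∀ n, 0 < δ n := fun n => by positivity
  have hδle : ∀ n, δ n ≤ c.r / 2 := fun n =>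
    div_le_self (by positivity) (by linarith [(Nat.cast_nonneg n : (0 : ℝ) ≤ n)])
  have hδ0 : Tendsto δ atTop (𝓝 0) := tendsto_layerWidth _
  choose κ hκ h01 h1 hη hκC hκs _ using fun n => hcut (δ n) (hδpos n)
  choose η hηpos hη0 using hη
  have hball : Metric.ball x₀ (c.r / 2) ⊆ Metric.ball x₀ c.r :=
    Metric.ball_subset_ball (by linarith)
  obtain ⟨M, hM0, hM⟩ := hψ.exists_bound
  refine ⟨ENNReal.ofReal (C * M) * C₁ ^ (1 / 2 : ℝ) * C₂, by finiteness, fun f g hfg i => ?_⟩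
  have hw := hfg.1.hasWeakPartial i
  set T : E 3 → F := fun x => ψ x • weakPartial O i f x + pd i ψ x • f x with hT
  have hTm : MemL2 O T := (hψ.bounded_smul hw.1).add ((hψ.pd i).bounded_smul hfg.1.1)
  have hT0 : ∀ x ∉ Metric.ball x₀ c.r, T x = 0 := fun x hx => by
    have hx' : x ∉ tsupport ψ := fun h => hx (hball (hψ.2.2 h))
    simp [hT, pd_eq_zero_of_notMem hx', image_eq_zero_of_notMem_tsupport hx']
  have hκT : ∀ n, MemL2 O (fun x => κ n x • T x) := fun n => by
    refine MemLp.of_le hTm ((hκ n).continuous.aestronglyMeasurable.smul hTm.1)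
      (Eventually.of_forall fun x => ?_)
    rw [norm_smul, Real.norm_of_nonneg (h01 n x).1]
    exact mul_le_of_le_one_left (norm_nonneg _) (h01 n x).2
  have t1 : Tendsto (fun n => ∫ x in O, (1 : ℝ) • κ n x • T x) atTop
      (𝓝 (∫ x in O, (1 : ℝ) • T x)) := by
    refine tendsto_integral_smul_right (memLp_const _) hκT hTm ?_
    refine (c.tendsto_eLpNorm_cutoff_sub_one_smul hO hTm hT0 hδ0 hκ h01 h1).congr fun n => ?_
    congr 1
    ext x
    simp [sub_smul]
  simp only [one_smul] at t1
  -- the weak derivative tested with the cutoff of `ψ`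
  have hpdφ : ∀ n x, pd i (fun x => κ n x * ψ x) x = κ n x * pd i ψ x + pd i (κ n) x * ψ x :=
    fun n x => pd_smul ((hκ n).differentiable (by simp) x) (hψ.1.differentiable (by simp) x) i
  have key : ∀ n, ∫ x in O, κ n x • T x
      = - ∫ x in c.layer (c.r / 2) (δ n), (pd i (κ n) x * ψ x) • f x := by
    intro n
    have htest := c.isTest_mul_cutoff hψ (hκ n) (hηpos n) (hη0 n)
    have hweak := hw.2 _ htest
    have hi1 := htest.integrable_smul hw.1
    have hi2 := (htest.pd i).integrable_smul hfg.1.1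
    have hi3 := (hκT n).integrable one_le_two
    have e1 : ∫ x in c.layer (c.r / 2) (δ n), (pd i (κ n) x * ψ x) • f x
        = ∫ x in O, (pd i (κ n) x * ψ x) • f x := by
      refine (setIntegral_eq_of_subset_of_forall_sdiff_eq_zero hO.measurableSet
        c.layer_half_subset fun x hx => ?_).symm
      by_cases h0 : pd i (κ n) x = 0
      · simp [h0]
      by_cases h0' : ψ x = 0
      · simp [h0']
      exact absurd ⟨hψ.2.2 (subset_tsupport _ h0'), hκs n x i h0⟩ hx.2
    have e2 : ∀ x, (pd i (κ n) x * ψ x) • f x = (pd i (fun x => κ n x * ψ x) x • f x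
        + (κ n x * ψ x) • weakPartial O i f x) - κ n x • T x := by
      intro x
      rw [hpdφ]
      simp only [hT, smul_add, smul_smul, add_smul]
      abel
    have e3 : ∫ x in O, (pd i (fun x => κ n x * ψ x) x • f x
        + (κ n x * ψ x) • weakPartial O i f x) = 0 := by
      rw [integral_add hi2 hi1, hweak, neg_add_cancel]
    rw [e1, integral_congr_ae (Eventually.of_forall e2),
      integral_sub (f := fun x => pd i (fun x => κ n x * ψ x) x • f x
        + (κ n x * ψ x) • weakPartial O i f x) (hi2.add hi1) hi3, e3, zero_sub, neg_neg]
  have hw2 : MemL2 O (fun y => ∑ j, c.e j • weakPartial O j f y) :=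
    memLp_finsetSum _ fun j _ => (hfg.1.hasWeakPartial j).1.const_smul (c.e j)
  set D := eLpNorm (fun y => ∑ j, c.e j • weakPartial O j f y) 2 (volume.restrict O) with hD
  let s : ℕ → ℝ≥0∞ := fun n => ENNReal.ofReal (δ n) ^ (1 / 2 : ℝ)
  have hs2 : ∀ n, s n * s n = ENNReal.ofReal (δ n) := fun n => by
    simp only [s]
    rw [← ENNReal.rpow_add_of_nonneg _ _ (by norm_num) (by norm_num)]
    norm_num
  have hs0 : Tendsto s atTop (𝓝 0) := by
    have := (ENNReal.continuous_rpow_const (y := (1 / 2 : ℝ))).tendsto 0 |>.comp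
      (by simpa using ENNReal.tendsto_ofReal hδ0 :
        Tendsto (fun n => ENNReal.ofReal (δ n)) atTop (𝓝 0))
    rwa [ENNReal.zero_rpow_of_pos (by norm_num)] at this
  have hbound : ∀ n, ‖∫ x in O, κ n x • T x‖ₑ
      ≤ ENNReal.ofReal (C * M) * C₁ ^ (1 / 2 : ℝ) * (s n * D + C₂ * eLpNorm g 2 (surf O)) := by
    intro n
    set Q := volume.restrict (c.layer (c.r / 2) (δ n)) with hQdef
    have hQ : Q ≤ volume.restrict O := Measure.restrict_mono c.layer_half_subset le_rfl
    have hδr : c.r / 2 + δ n ≤ c.r := by linarith [hδle n]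
    have hfm : AEStronglyMeasurable f Q := hfg.1.1.1.mono_measure hQ
    have hgm : AEStronglyMeasurable (g ∘ c.proj) Q :=
      c.aestronglyMeasurable_comp_proj hfg.2.1.1 hδr
    have ham : AEStronglyMeasurable (fun x => pd i (κ n) x * ψ x) Q :=
      ((contDiff_pd (hκ n) i).continuous.mul hψ.1.continuous).aestronglyMeasurable
    rw [key, enorm_neg]
    refine (enorm_integral_smul_le ham hfm).trans ?_
    have b1 : eLpNorm (fun x => pd i (κ n) x * ψ x) 2 Q
        ≤ (C₁ ^ (1 / 2 : ℝ) * s n) * ENNReal.ofReal (C / δ n * M) := by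
      refine (eLpNorm_le_of_ae_bound (C := C / δ n * M) (Eventually.of_forall fun x => ?_)).trans ?_
      · rw [norm_mul]
        exact mul_le_mul (hκC n x i) (hM x) (norm_nonneg _) (by have := hδpos n; positivity)
      · refine mul_le_mul' ?_ le_rfl
        simp only [hQdef, Measure.restrict_apply_univ, ENNReal.toReal_ofNat, s]
        rw [← ENNReal.mul_rpow_of_nonneg _ _ (by norm_num)]
        norm_num
        exact ENNReal.rpow_le_rpow (hvol (δ n)) (by norm_num)
    have b2 : eLpNorm f 2 Q ≤ ENNReal.ofReal (δ n) * D + C₂ * s n * eLpNorm g 2 (surf O) := by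
      have e3 : f = (f - g ∘ c.proj) + g ∘ c.proj := by simp
      rw [e3]
      refine (eLpNorm_add_le (hfm.sub hgm) hgm one_le_two).trans (add_le_add ?_ ?_)
      · refine (c.eLpNorm_sub_trace_comp_proj_le hfg hδr (hδpos n).le).trans ?_
        exact mul_le_mul' le_rfl (eLpNorm_mono_measure _
          (Measure.restrict_mono c.layer_subset le_rfl))
      · exact hsurf _ _ hδr g hfg.2.1.1
    refine (mul_le_mul' b1 b2).trans (le_of_eq ?_)
    have e4 : ENNReal.ofReal (C * M) = ENNReal.ofReal (C / δ n * M) * (s n * s n) := by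
      rw [hs2, ← ENNReal.ofReal_mul (by have := hδpos n; positivity)]
      congr 1
      have := (hδpos n).ne'
      field_simp
    rw [e4, ← hs2]
    ring
  have t2 : Tendsto (fun n => ENNReal.ofReal (C * M) * C₁ ^ (1 / 2 : ℝ)
      * (s n * D + C₂ * eLpNorm g 2 (surf O))) atTop
      (𝓝 (ENNReal.ofReal (C * M) * C₁ ^ (1 / 2 : ℝ) * (0 * D + C₂ * eLpNorm g 2 (surf O)))) := by
    refine ENNReal.Tendsto.const_mul (Tendsto.add ?_ tendsto_const_nhds) (Or.inr (by finiteness))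
    exact ENNReal.Tendsto.mul_const hs0 (Or.inr hw2.2.ne)
  rw [zero_mul, zero_add, ← mul_assoc] at t2
  exact le_of_tendsto_of_tendsto' t1.enorm t2 hbound

/-- The integral over `O` of a derivative of an `H¹` function is bounded by the `L²` norm of the
trace. -/
theorem exists_enorm_integral_weakPartial_le (F : Type*) [NormedAddCommGroup F] [NormedSpace ℝ F]
    [CompleteSpace F] (hO : IsOpen O) (hb : Bornology.IsBounded O)
    (hL : HasLipschitzBoundary O) :
    ∃ C : ℝ≥0∞, C ≠ ⊤ ∧ ∀ f g : E 3 → F, HasTrace O f g → ∀ i,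
      ‖∫ x in O, weakPartial O i f x‖ₑ ≤ C * eLpNorm g 2 (surf O) := by
  obtain ⟨ψ, hψ, hψ1⟩ := exists_isTest_eq_one hb
  have key : HasTraceBound F O ψ := by
    refine forall_isTest_of_local (P := HasTraceBound F O)
      (HasTraceBound.of_eq_zero hO fun _ _ => rfl)
      (fun ψ ψ' h h' => HasTraceBound.add h h') (fun x => ?_) hψ
    by_cases hx : x ∈ closure O
    · by_cases hxO : x ∈ O
      · exact ⟨O, hO, hxO, fun _ h => HasTraceBound.of_isTest h⟩
      · obtain ⟨c⟩ := nonempty_boundaryChart hL (x₀ := x) ⟨hx, fun h => hxO (interior_subset h)⟩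
        exact ⟨_, Metric.isOpen_ball, Metric.mem_ball_self (half_pos c.r_pos),
          fun _ h => c.hasTraceBound hO hb h⟩
    · refine ⟨(closure O)ᶜ, isClosed_closure.isOpen_compl, hx, fun ψ h =>
        HasTraceBound.of_eq_zero hO fun z hz => ?_⟩
      exact image_eq_zero_of_notMem_tsupport fun h' => h.2.2 h' (subset_closure hz)
  obtain ⟨C, hC, h⟩ := key
  refine ⟨C, hC, fun f g hfg i => ?_⟩
  refine le_trans (le_of_eq ?_) (h f g hfg i)
  congr 1
  refine setIntegral_congr_fun hO.measurableSet fun x hx => ?_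
  have h0 : ψ =ᶠ[𝓝 x] fun _ => 1 := by
    filter_upwards [hO.mem_nhds hx] with z hz using hψ1 z hz
  have : pd i ψ x = 0 := by rw [pd, h0.fderiv_eq]; simp
  simp [this, hψ1 x hx]

end Integrals

/-! ### The geometry near the plate -/

theorem isometry_embed : Isometry embed := by
  refine Isometry.of_dist_eq fun x y => ?_
  rw [EuclideanSpace.dist_eq, EuclideanSpace.dist_eq]
  simp [embed, Fin.sum_univ_three]

theorem embed_apply_two (x : E 2) : embed x 2 = 0 := by simp [embed]

theorem isClosed_setOf_two_le : IsClosed {x : E 3 | x 2 ≤ 0} :=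
  isClosed_le (EuclideanSpace.proj 2 : E 3 →L[ℝ] ℝ).continuous continuous_const

theorem norm_sub_embed (z : E 3) : ‖z - embed !₂[z 0, z 1]‖ = |z 2| := by
  have : z - embed !₂[z 0, z 1] = EuclideanSpace.single 2 (z 2) := by
    ext i
    fin_cases i <;> simp [embed]
  rw [this]
  simp

theorem embed_eq_of_two_eq_zero {z : E 3} (hz : z 2 = 0) : embed !₂[z 0, z 1] = z := by
  have := norm_sub_embed z
  rw [hz, abs_zero, norm_eq_zero, sub_eq_zero] at this
  exact this.symm

theorem nonempty_inter_frontier {X : Type*} [TopologicalSpace X] {s t : Set X}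
    (hs : IsPreconnected s) (h1 : (s ∩ t).Nonempty) (h2 : (s ∩ tᶜ).Nonempty) :
    (s ∩ frontier t).Nonempty := by
  by_contra hcon
  have hf : ∀ x ∈ s, x ∉ frontier t := fun x hx hxf => hcon ⟨x, hx, hxf⟩
  have hi : ∀ x ∈ s, x ∈ t → x ∈ interior t := fun x hx hxt => by
    by_contra h
    exact hf x hx ⟨subset_closure hxt, h⟩
  have he : ∀ x ∈ s, x ∈ tᶜ → x ∈ interior tᶜ := fun x hx hxt => by
    by_contra h
    refine hf x hx ?_
    rw [← frontier_compl]
    exact ⟨subset_closure hxt, h⟩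
  obtain ⟨a, has, hat⟩ := h1
  obtain ⟨b, hbs, hbt⟩ := h2
  obtain ⟨x, -, hx1, hx2⟩ := hs _ _ isOpen_interior isOpen_interior
    (fun x hx => (em (x ∈ t)).imp (hi x hx) (he x hx)) ⟨a, has, hi a has hat⟩ ⟨b, hbs, he b hbs hbt⟩
  exact interior_subset hx2 (interior_subset hx1)

namespace IsFlowGeometry

variable {O S : Set (E 3)} {Ω : Set (E 2)}

theorem embed_subset_frontier (hG : IsFlowGeometry O S Ω) : embed '' Ω ⊆ frontier O := by
  rw [hG.frontier_eq]
  exact subset_closure.trans subset_union_right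

theorem isBounded_plate (hG : IsFlowGeometry O S Ω) : Bornology.IsBounded Ω := by
  have h1 : Bornology.IsBounded (embed '' Ω) :=
    (hG.isBounded.closure.subset frontier_subset_closure).subset hG.embed_subset_frontier
  have h2 := isometry_embed.antilipschitz.isBounded_preimage h1
  rwa [preimage_image_eq _ isometry_embed.injective] at h2

theorem two_nonpos_of_mem_frontier (hG : IsFlowGeometry O S Ω) {x : E 3} (hx : x ∈ frontier O) : x 2 ≤ 0 := by
  rw [hG.frontier_eq] at hx
  rcases hx with hx | hx
  · exact closure_minimal (fun y hy => hG.below y hy) isClosed_setOf_two_le hx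
  · refine closure_minimal ?_ isClosed_setOf_two_le hx
    rintro _ ⟨y, -, rfl⟩
    exact (embed_apply_two y).le

/-- The upper half space does not meet the boundary, hence it does not meet `O`, which is
bounded. -/
theorem two_neg_of_mem (hG : IsFlowGeometry O S Ω) {x : E 3} (hx : x ∈ O) : x 2 < 0 := by
  by_contra hcon
  let H : Set (E 3) := {z | 0 < z 2}
  have hH : Convex ℝ H := convex_halfSpace_gt (f := fun z : E 3 => z 2)
    (EuclideanSpace.proj 2 : E 3 →L[ℝ] ℝ).toLinearMap.isLinear 0
  have hup : ∀ (z : E 3) (s : ℝ), (z + s • EuclideanSpace.single 2 (1 : ℝ) : E 3) 2 = z 2 + s := by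
    intro z s; simp
  -- a point of `O` in the upper half space
  have h1 : (H ∩ O).Nonempty := by
    have hc : Continuous fun s : ℝ => (x + s • EuclideanSpace.single 2 (1 : ℝ) : E 3) := by fun_prop
    have ht : Tendsto (fun s : ℝ => (x + s • EuclideanSpace.single 2 (1 : ℝ) : E 3)) (𝓝[>] 0)
        (𝓝 x) := by
      simpa using (hc.tendsto 0).mono_left nhdsWithin_le_nhds
    obtain ⟨s, hs, hs0⟩ := ((ht.eventually (hG.isOpen.mem_nhds hx)).and self_mem_nhdsWithin).exists
    refine ⟨_, ?_, hs⟩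
    have : 0 < s := hs0
    change 0 < (x + s • EuclideanSpace.single 2 (1 : ℝ) : E 3) 2
    rw [hup]
    linarith [not_lt.1 hcon]
  -- a point outside `O` in the upper half space
  have h2 : (H ∩ Oᶜ).Nonempty := by
    obtain ⟨R, hR0, hR⟩ := hG.isBounded.exists_pos_norm_le
    refine ⟨EuclideanSpace.single 2 (R + 1), ?_, fun h => ?_⟩
    · change 0 < (EuclideanSpace.single 2 (R + 1) : E 3) 2
      simp
      linarith
    · have := hR _ h
      rw [PiLp.norm_single, Real.norm_of_nonneg (by linarith)] at this
      linarith
  obtain ⟨z, hz, hzf⟩ := nonempty_inter_frontier hH.isPreconnected h1 h2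
  exact absurd (hG.two_nonpos_of_mem_frontier hzf) (not_le.2 hz)

/-- Near a point of the plate, `O` is the lower half space. -/
theorem exists_ball_lower_half (hG : IsFlowGeometry O S Ω) {y₀ : E 2} (hy₀ : y₀ ∈ Ω) :
    ∃ ρ > 0, ∀ z ∈ Metric.ball (embed y₀) ρ,
      (z 2 < 0 → z ∈ O) ∧ (z 2 = 0 → z ∈ embed '' Ω) := by
  set x₀ := embed y₀ with hx₀
  have hx₀f : x₀ ∈ frontier O := hG.embed_subset_frontier ⟨y₀, hy₀, rfl⟩
  obtain ⟨c⟩ := nonempty_boundaryChart hG.lipschitz hx₀f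
  obtain ⟨ρ₁, hρ₁, hρ₁Ω⟩ := Metric.isOpen_iff.1 hG.isOpen_plate y₀ hy₀
  have hplate : ∀ z ∈ Metric.ball x₀ ρ₁, z 2 = 0 → z ∈ embed '' Ω := by
    intro z hz hz2
    refine ⟨!₂[z 0, z 1], hρ₁Ω ?_, embed_eq_of_two_eq_zero hz2⟩
    rw [Metric.mem_ball, ← isometry_embed.dist_eq, embed_eq_of_two_eq_zero hz2]
    exact hz
  set r := min ρ₁ c.r with hr
  have hr0 : 0 < r := lt_min hρ₁ c.r_pos
  -- near `x₀` the boundary contains the plane `x₃ = 0`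
  have hh0 : ∀ z ∈ Metric.ball x₀ r, z 2 = 0 → c.h z = 0 := fun z hz hz2 =>
    c.h_eq_zero_of_mem_frontier hG.isOpen (Metric.ball_subset_ball (min_le_right _ _) hz)
      (hG.embed_subset_frontier (hplate z (Metric.ball_subset_ball (min_le_left _ _) hz) hz2))
  have hx₀2 : x₀ 2 = 0 := embed_apply_two y₀
  -- hence the direction of the graph is transversal to this plane
  have he : c.e 2 ≠ 0 := by
    intro he
    have hm : x₀ + (r / 2) • c.e ∈ Metric.ball x₀ r := by
      rw [Metric.mem_ball, dist_eq_norm, add_sub_cancel_left, norm_smul, c.norm_e, mul_one,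
        Real.norm_of_nonneg (by linarith)]
      linarith
    have h1 := hh0 _ hm (by simp [he, hx₀2])
    rw [c.shift, hh0 x₀ (Metric.mem_ball_self hr0) hx₀2] at h1
    linarith
  set a := |c.e 2| with ha
  have ha0 : 0 < a := abs_pos.2 he
  set ρ := r / (1 + a⁻¹) with hρ
  have hρ0 : 0 < ρ := by positivity
  have hρr : ρ + ρ * a⁻¹ = r := by
    rw [hρ]; field_simp
  have hρle : ρ ≤ r := by
    have : 0 ≤ ρ * a⁻¹ := by positivity
    linarith
  -- there are no boundary points below the plane near `x₀`
  have hno : ∀ z ∈ Metric.ball x₀ ρ, z 2 < 0 → z ∉ frontier O := by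
    intro z hz hz2 hzf
    have hzb : z ∈ Metric.ball x₀ r := Metric.ball_subset_ball hρle hz
    have hz0 : c.h z = 0 := c.h_eq_zero_of_mem_frontier hG.isOpen
      (Metric.ball_subset_ball (min_le_right _ _) hzb) hzf
    set s := -(z 2 / c.e 2) with hs
    have hz2abs : |z 2| ≤ dist z x₀ := by
      have := PiLp.norm_apply_le (z - x₀) 2
      rwa [PiLp.sub_apply, hx₀2, sub_zero, Real.norm_eq_abs, ← dist_eq_norm] at this
    have hsabs : |s| < ρ * a⁻¹ := by
      rw [hs, abs_neg, abs_div, div_eq_mul_inv]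
      exact mul_lt_mul_of_pos_right (hz2abs.trans_lt hz) (by positivity)
    have hm : z + s • c.e ∈ Metric.ball x₀ r := by
      rw [Metric.mem_ball] at hz ⊢
      have h1 : dist (z + s • c.e) z = |s| := by
        rw [dist_eq_norm, add_sub_cancel_left, norm_smul, c.norm_e, mul_one, Real.norm_eq_abs]
      linarith [dist_triangle (z + s • c.e) z x₀]
    have h1 := hh0 _ hm (by
      simp only [PiLp.add_apply, PiLp.smul_apply, smul_eq_mul, hs]
      field_simp
      ring)
    rw [c.shift, hz0, zero_sub, neg_eq_zero, hs, neg_eq_zero, div_eq_zero_iff] at h1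
    rcases h1 with h1 | h1
    · exact hz2.ne h1
    · exact he h1
  refine ⟨ρ, hρ0, fun z hz => ⟨fun hz2 => ?_, fun hz2 => hplate z
    (Metric.ball_subset_ball (hρle.trans (min_le_left _ _)) hz) hz2⟩⟩
  let H : Set (E 3) := Metric.ball x₀ ρ ∩ {w | w 2 < 0}
  have hH : Convex ℝ H := (convex_ball x₀ ρ).inter (convex_halfSpace_lt (f := fun z : E 3 => z 2)
    (EuclideanSpace.proj 2 : E 3 →L[ℝ] ℝ).toLinearMap.isLinear 0)
  by_contra hzO
  have h1 : (H ∩ O).Nonempty := by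
    obtain ⟨w, hw, hwO⟩ := mem_closure_iff_nhds.1 hx₀f.1 _ (Metric.ball_mem_nhds x₀ hρ0)
    exact ⟨w, ⟨hw, hG.two_neg_of_mem hwO⟩, hwO⟩
  obtain ⟨w, hw, hwf⟩ := nonempty_inter_frontier hH.isPreconnected h1 ⟨z, ⟨hz, hz2⟩, hzO⟩
  exact hno w hw.1 hw.2 hwf

theorem ae_surf_mem (hG : IsFlowGeometry O S Ω) : ∀ᵐ x ∂(surf O), x ∈ S ∪ embed '' Ω := by
  have h1 : ∀ᵐ x ∂(surf O), x ∈ frontier O := ae_restrict_mem isClosed_frontier.measurableSet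
  have h2 : ∀ᵐ x ∂(surf O), x ∉ frontier O \ (S ∪ embed '' Ω) :=
    measure_eq_zero_iff_ae_notMem.1 hG.interface_null
  filter_upwards [h1, h2] with x hx hx'
  by_contra h
  exact hx' ⟨hx, h⟩

/-- On the plate, surface measure is a multiple of the Lebesgue measure of the plane. -/
theorem exists_surf_restrict_eq (hG : IsFlowGeometry O S Ω) :
    ∃ k : ℝ≥0∞, k ≠ 0 ∧ k ≠ ⊤ ∧
      (surf O).restrict (embed '' Ω) = k • (volume.restrict Ω).map embed := by
  obtain ⟨C, hC0, hC, hvol⟩ := exists_volume_eq_smul_hausdorffMeasure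
  have hemb : MeasurableEmbedding embed := isometry_embed.isClosedEmbedding.measurableEmbedding
  have hm : MeasurableSet (embed '' Ω) := hemb.measurableSet_image.2 hG.isOpen_plate.measurableSet
  refine ⟨C⁻¹, ENNReal.inv_ne_zero.2 hC, ENNReal.inv_ne_top.2 hC0, ?_⟩
  have h1 : (surf O).restrict (embed '' Ω)
      = (Measure.hausdorffMeasure 2).restrict (embed '' Ω) := by
    rw [surf, Measure.restrict_restrict hm, inter_eq_self_of_subset_left hG.embed_subset_frontier]
  have h2 := isometry_embed.map_hausdorffMeasure (d := 2) (Or.inl zero_le_two)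
  have h3 : ((Measure.hausdorffMeasure 2 : Measure (E 2)).map embed).restrict (embed '' Ω)
      = ((Measure.hausdorffMeasure 2 : Measure (E 2)).restrict Ω).map embed := by
    rw [hemb.restrict_map, preimage_image_eq _ isometry_embed.injective]
  rw [h2, Measure.restrict_restrict hm,
    inter_eq_self_of_subset_left (image_subset_range _ _)] at h3
  rw [h1, h3, hvol, Measure.restrict_smul, Measure.map_smul, smul_smul,
    ENNReal.inv_mul_cancel hC0 hC, one_smul]

theorem ae_surf_plate (hG : IsFlowGeometry O S Ω) {p : E 3 → Prop} (hp : ∀ᵐ x ∂(volume.restrict Ω), p (embed x)) :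
    ∀ᵐ x ∂(surf O), x ∈ embed '' Ω → p x := by
  obtain ⟨k, -, -, h⟩ := hG.exists_surf_restrict_eq
  have hemb : MeasurableEmbedding embed := isometry_embed.isClosedEmbedding.measurableEmbedding
  have hm : MeasurableSet (embed '' Ω) := hemb.measurableSet_image.2 hG.isOpen_plate.measurableSet
  rw [← ae_restrict_iff' hm, h]
  exact Measure.ae_smul_measure (hemb.ae_map_iff.2 hp) k

/-- The `L²` norm on the boundary of a function that vanishes off the plate. -/
theorem exists_eLpNorm_surf_le (hG : IsFlowGeometry O S Ω) (F : Type*) [NormedAddCommGroup F] :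
    ∃ C : ℝ≥0∞, C ≠ ⊤ ∧ ∀ u : E 3 → F, (∀ᵐ x ∂(surf O), x ∉ embed '' Ω → u x = 0) →
      eLpNorm u 2 (surf O) ≤ C * eLpNorm (u ∘ embed) 2 (volume.restrict Ω) := by
  obtain ⟨k, -, hk, h⟩ := hG.exists_surf_restrict_eq
  have hemb : MeasurableEmbedding embed := isometry_embed.isClosedEmbedding.measurableEmbedding
  have hm : MeasurableSet (embed '' Ω) := hemb.measurableSet_image.2 hG.isOpen_plate.measurableSet
  refine ⟨k ^ (1 / 2 : ℝ), by finiteness, fun u hu => ?_⟩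
  have e : u =ᵐ[surf O] (embed '' Ω).indicator u := by
    filter_upwards [hu] with x hx
    by_cases hxΩ : x ∈ embed '' Ω
    · rw [indicator_of_mem hxΩ]
    · rw [indicator_of_notMem hxΩ, hx hxΩ]
  rw [eLpNorm_congr_ae e, eLpNorm_indicator_eq_eLpNorm_restrict hm, h,
    eLpNorm_smul_measure_of_ne_top (by simp), hemb.eLpNorm_map_measure]
  simp

end IsFlowGeometry

/-! ### Fields prescribed on the plate -/

/-- The orthogonal projection of `ℝ³` to the plane `x₃ = 0`. -/
noncomputable def planeProj : E 3 →L[ℝ] E 2 :=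
  LinearMap.toContinuousLinearMap
    { toFun := fun x => !₂[x 0, x 1]
      map_add' := fun x y => by ext i; fin_cases i <;> simp
      map_smul' := fun c x => by ext i; fin_cases i <;> simp }

theorem planeProj_apply (x : E 3) : planeProj x = !₂[x 0, x 1] := rfl

theorem planeProj_embed (y : E 2) : planeProj (embed y) = y := by
  ext i
  fin_cases i <;> simp [planeProj_apply, embed]

theorem planeProj_append (y : E 2) (t : ℝ) : planeProj !₂[y 0, y 1, t] = y := by
  ext i
  fin_cases i <;> simp [planeProj_apply]

variable {O S : Set (E 3)} {Ω : Set (E 2)}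

section Trace

variable {F : Type*} [NormedAddCommGroup F] [NormedSpace ℝ F]

theorem tendsto_eLpNorm_sub_sub {α ι F : Type*} [NormedAddCommGroup F] [MeasurableSpace α] {μ : Measure α} {l : Filter ι}
    {f f' : ι → α → F} {g g' : α → F} (hf : ∀ k, AEStronglyMeasurable (f k - g) μ)
    (hf' : ∀ k, AEStronglyMeasurable (f' k - g') μ)
    (h : Tendsto (fun k => eLpNorm (f k - g) 2 μ) l (𝓝 0))
    (h' : Tendsto (fun k => eLpNorm (f' k - g') 2 μ) l (𝓝 0)) :
    Tendsto (fun k => eLpNorm (f k - f' k - (g - g')) 2 μ) l (𝓝 0) := by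
  refine tendsto_of_tendsto_of_tendsto_of_le_of_le tendsto_const_nhds
    (by simpa using h.add h') (fun _ => zero_le) (fun k => ?_)
  rw [show f k - f' k - (g - g') = (f k - g) - (f' k - g') by abel]
  exact eLpNorm_sub_le (hf k) (hf' k) one_le_two

theorem HasTrace.sub [CompleteSpace F] (hO : IsOpen O) {f f' g g' : E 3 → F}
    (h : HasTrace O f g) (h' : HasTrace O f' g') : HasTrace O (f - f') (g - g') := by
  obtain ⟨h1, hg, φ, hφ, ht, hb⟩ := h
  obtain ⟨h1', hg', φ', hφ', ht', hb'⟩ := h'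
  refine ⟨h1.sub h1', hg.sub hg', fun k => φ k - φ' k, fun k => (hφ k).sub (hφ' k), ⟨?_, ?_⟩, ?_⟩
  · exact tendsto_eLpNorm_sub_sub
      (fun k => (hφ k).continuous.aestronglyMeasurable.sub h1.1.1)
      (fun k => (hφ' k).continuous.aestronglyMeasurable.sub h1'.1.1) ht.1 ht'.1
  · intro i
    have e : ∀ k, pd i (φ k - φ' k) = pd i (φ k) - pd i (φ' k) := fun k => funext fun x =>
      pd_sub ((hφ k).differentiable (by simp) x) ((hφ' k).differentiable (by simp) x) i
    simp only [e]
    exact tendsto_eLpNorm_sub_congr (h1.weakPartial_sub hO h1' i).symm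
      (tendsto_eLpNorm_sub_sub
        (fun k => (contDiff_pd (hφ k) i).continuous.aestronglyMeasurable.sub
          (h1.hasWeakPartial i).1.1)
        (fun k => (contDiff_pd (hφ' k) i).continuous.aestronglyMeasurable.sub
          (h1'.hasWeakPartial i).1.1) (ht.2 i) (ht'.2 i))
  · exact tendsto_eLpNorm_sub_sub
      (fun k => (hφ k).continuous.aestronglyMeasurable.sub hg.1)
      (fun k => (hφ' k).continuous.aestronglyMeasurable.sub hg'.1) hb hb'

theorem IsTest.hasTrace [CompleteSpace F] (hO : IsOpen O) {D : Set (E 3)} {f : E 3 → F}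
    (hf : IsTest D f) (hs : MemLp f 2 (surf O)) : HasTrace O f f := by
  refine ⟨hf.memH1, hs, fun _ => f, fun _ => hf.1, ⟨by simp, fun i => ?_⟩, by simp⟩
  have e : FSI.pd i f - weakPartial O i f =ᵐ[volume.restrict O] 0 := by
    filter_upwards [(hf.hasWeakPartial i).weakPartial_ae hO] with x hx
    simp [hx]
  simp [eLpNorm_congr_ae e]

end Trace

variable {𝕜 : Type*} [RCLike 𝕜]

/-- A test function on the plate extends to a test function `W` on `ℝ³` that vanishes on the rest
of the boundary, namely `W x = χ (x₃) θ (x₁, x₂)` with a cutoff function `χ` supported in a small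
interval. As `O` is the lower half space near the support of `W`, the integral of `∂₃ W` over `O`
is that of `θ` by the fundamental theorem of calculus. -/
theorem IsFlowGeometry.exists_isTest_extension (hG : IsFlowGeometry O S Ω) {θ : E 2 → 𝕜}
    (hθ : IsTest Ω θ) :
    ∃ W : E 3 → 𝕜, IsTest univ W ∧ (∀ y, W (embed y) = θ y) ∧
      (∀ x ∈ frontier O, x ∉ embed '' Ω → W x = 0) ∧
      ∫ x in O, pd 2 W x = ∫ y in Ω, θ y := by
  let V : Set (E 3) := {z | (z 2 < 0 → z ∈ O) ∧ (z 2 = 0 → z ∈ embed '' Ω)}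
  have hcomp : IsCompact (tsupport θ) := hθ.2.1
  obtain ⟨δ, hδ0, hδ⟩ := (hcomp.image isometry_embed.continuous).exists_thickening_subset_open
    (t := interior V) isOpen_interior (by
      rintro _ ⟨y, hy, rfl⟩
      obtain ⟨ρ, hρ, h⟩ := hG.exists_ball_lower_half (hθ.2.2 hy)
      exact mem_interior_iff_mem_nhds.2 (mem_of_superset (Metric.ball_mem_nhds _ hρ) h))
  have hV : ∀ x : E 3, planeProj x ∈ tsupport θ → |x 2| < δ → x ∈ V := by
    intro x hx hx2
    refine interior_subset (hδ (Metric.mem_thickening_iff.2 ⟨_, ⟨_, hx, rfl⟩, ?_⟩))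
    rw [dist_eq_norm, planeProj_apply, norm_sub_embed]
    exact hx2
  let χ : ContDiffBump (0 : ℝ) := ⟨δ / 4, δ / 2, by linarith, by linarith⟩
  have hχ0 : ∀ t, t ∈ tsupport χ → |t| < δ := by
    intro t ht
    rw [χ.tsupport_eq, mem_closedBall_zero_iff, Real.norm_eq_abs] at ht
    exact ht.trans_lt (half_lt_self hδ0)
  let π : E 3 →L[ℝ] ℝ := EuclideanSpace.proj 2
  let W : E 3 → 𝕜 := fun x => χ (π x) • θ (planeProj x)
  have hχs : ContDiff ℝ ∞ (fun x => χ (π x)) := χ.contDiff.comp π.contDiff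
  have hθs : ContDiff ℝ ∞ (fun x => θ (planeProj x)) := hθ.1.comp planeProj.contDiff
  have hsupp : ∀ x, W x ≠ 0 → planeProj x ∈ tsupport θ ∧ x 2 ∈ tsupport χ := by
    intro x hx
    refine ⟨subset_tsupport _ fun h => hx ?_, subset_tsupport _ fun h => hx ?_⟩
    · simp only [W, h, smul_zero]
    · change χ (x 2) • _ = (0 : 𝕜)
      rw [h, zero_smul]
  have hWcomp : HasCompactSupport W := by
    have hK : IsCompact ((fun q : E 2 × ℝ => (!₂[q.1 0, q.1 1, q.2] : E 3)) ''
        (tsupport θ ×ˢ tsupport χ)) :=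
      (hcomp.prod χ.hasCompactSupport).image (by fun_prop)
    refine HasCompactSupport.intro hK fun x hx => ?_
    by_contra h
    refine hx ⟨(planeProj x, x 2), hsupp x h, ?_⟩
    ext i
    fin_cases i <;> simp [planeProj_apply]
  have hpd : ∀ x, pd 2 W x = deriv χ (x 2) • θ (planeProj x) := by
    intro x
    have h1 : pd 2 (fun x => χ (π x)) x = deriv χ (x 2) := by
      have := (χ.contDiff (n := 1)).differentiable one_ne_zero (π x) |>.hasDerivAt.comp_hasFDerivAt x
        π.hasFDerivAt
      rw [pd, show (fun x => χ (π x)) = χ ∘ π from rfl, this.fderiv]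
      simp [π]
    have h2 : pd 2 (fun x => θ (planeProj x)) x = 0 := by
      have := (hθ.1.differentiable (by simp) (planeProj x)).hasFDerivAt.comp x
        planeProj.hasFDerivAt
      rw [pd, show (fun x => θ (planeProj x)) = θ ∘ planeProj from rfl, this.fderiv]
      have h0 : planeProj (EuclideanSpace.single 2 (1 : ℝ)) = 0 := by
        ext i
        fin_cases i <;> simp [planeProj_apply]
      simp [h0]
    rw [pd_smul (hχs.differentiable (by simp) x) (hθs.differentiable (by simp) x), h1, h2,
      smul_zero, zero_add]
  have hπ : Measurable fun x : E 3 => x 2 := π.continuous.measurable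
  have hmeas : MeasurableSet {x : E 3 | x 2 < 0} := hπ measurableSet_Iio
  refine ⟨W, ⟨hχs.smul hθs, hWcomp, subset_univ _⟩, fun y => ?_, fun x hx hxΩ => ?_, ?_⟩
  · have h0 : χ 0 = 1 := χ.one_of_mem_closedBall (by simp [χ]; linarith)
    change χ (embed y 2) • θ (planeProj (embed y)) = θ y
    rw [embed_apply_two, h0, one_smul, planeProj_embed]
  · by_contra h
    obtain ⟨h1, h2⟩ := hsupp x h
    have hxV := hV x h1 (hχ0 _ h2)
    rcases (hG.two_nonpos_of_mem_frontier hx).lt_or_eq with h3 | h3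
    · exact (hG.isOpen.frontier_eq ▸ hx).2 (hxV.1 h3)
    · exact hxΩ (hxV.2 h3)
  · have e1 : ∫ x in O, pd 2 W x = ∫ x in {x : E 3 | x 2 < 0}, pd 2 W x := by
      refine (setIntegral_eq_of_subset_of_forall_sdiff_eq_zero hmeas
        (fun x hx => hG.two_neg_of_mem hx) fun x hx => ?_).symm
      by_contra h
      rw [hpd] at h
      have h1 : x 2 ∈ tsupport χ := by
        by_contra h1
        have h2 : deriv χ (x 2) = 0 := by
          rw [(notMem_tsupport_iff_eventuallyEq.1 h1).deriv_eq]
          exact deriv_const _ _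
        exact h (by rw [h2, zero_smul])
      have h2 : planeProj x ∈ tsupport θ := subset_tsupport _ fun h2 => h (by rw [h2, smul_zero])
      exact hx.2 ((hV x h2 (hχ0 _ h1)).1 hx.1)
    have e2 : ∫ y in Ω, θ y = ∫ y, θ y :=
      setIntegral_eq_integral_of_forall_compl_eq_zero fun y hy =>
        image_eq_zero_of_notMem_tsupport fun h => hy (hθ.2.2 h)
    have e3 : ∫ t in Iio (0 : ℝ), ((deriv χ t : ℝ) : 𝕜) = 1 := by
      rw [integral_ofReal, ← integral_Iic_eq_integral_Iio,
        χ.hasCompactSupport.integral_Iic_deriv_eq (χ.contDiff (n := 1)) 0,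
        χ.one_of_mem_closedBall (by simp [χ]; linarith)]
      simp
    have hmp := measurePreserving_append
    have hme : MeasurableEmbedding (fun q : E 2 × ℝ => (!₂[q.1 0, q.1 1, q.2] : E 3)) := by
      have hc : Continuous (fun q : E 2 × ℝ => (!₂[q.1 0, q.1 1, q.2] : E 3)) := by fun_prop
      refine hc.measurableEmbedding fun q q' h => ?_
      refine Prod.ext ?_ ?_
      · rw [← planeProj_append q.1 q.2, ← planeProj_append q'.1 q'.2]
        exact congrArg planeProj h
      · exact congrArg (fun z : E 3 => z 2) h
    rw [e1, e2, ← hmp.setIntegral_preimage_emb hme]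
    have e4 : (fun q : E 2 × ℝ => (!₂[q.1 0, q.1 1, q.2] : E 3)) ⁻¹' {x | x 2 < 0}
        = univ ×ˢ Iio 0 := by
      ext q
      simp
    have e5 : ∀ q : E 2 × ℝ, pd 2 W !₂[q.1 0, q.1 1, q.2] = θ q.1 * ((deriv χ q.2 : ℝ) : 𝕜) := by
      intro q
      rw [hpd, planeProj_append, mul_comm, RCLike.real_smul_eq_coe_mul]
      rfl
    rw [e4]
    simp only [e5]
    have e6 := setIntegral_prod_mul (μ := (volume : Measure (E 2))) (ν := (volume : Measure ℝ)) θ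
      (fun t => ((deriv χ t : ℝ) : 𝕜)) univ (Iio 0)
    rw [e3, mul_one, setIntegral_univ] at e6
    exact e6

/-- The divergence theorem for a field that has the normal trace `h` on the plate, and vanishes on
the rest of the boundary. -/
theorem HasPlateTrace.integral_weakDiv (hG : IsFlowGeometry O S Ω) {v : Fin 3 → E 3 → 𝕜}
    {h : E 2 → 𝕜} (hv : HasPlateTrace O S Ω v h) (hh : MemH02 Ω h) :
    ∫ x in O, weakDiv O v x = ∫ y in Ω, h y := by
  have : IsFiniteMeasure (volume.restrict O) := ⟨by simpa using hG.isBounded.measure_lt_top⟩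
  have : IsFiniteMeasure (volume.restrict Ω) := ⟨by simpa using hG.isBounded_plate.measure_lt_top⟩
  obtain ⟨g, hg, hS, hΩ⟩ := hv
  obtain ⟨C, hC, hbd⟩ := exists_enorm_integral_weakPartial_le 𝕜 hG.isOpen hG.isBounded hG.lipschitz
  obtain ⟨C', hC', hsurf⟩ := hG.exists_eLpNorm_surf_le 𝕜
  have hplate : ∀ᵐ x ∂(surf O), x ∈ embed '' Ω → ∀ i, g i x = if i = 2 then h (planeProj x) else 0 :=
    hG.ae_surf_plate (by
      filter_upwards [hΩ] with y hy i
      rw [hy i, planeProj_embed])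
  have hint : ∀ i, Integrable (weakPartial O i (v i)) (volume.restrict O) := fun i =>
    ((hg i).1.hasWeakPartial i).1.integrable one_le_two
  have h0 : ∀ i, i ≠ 2 → ∫ x in O, weakPartial O i (v i) x = 0 := by
    intro i hi
    have hz : g i =ᵐ[surf O] 0 := by
      filter_upwards [hG.ae_surf_mem, hS, hplate] with x hx hxS hxΩ
      rcases hx with hx | hx
      · exact hxS hx i
      · rw [hxΩ hx i, if_neg hi]
        rfl
    have := hbd _ _ (hg i) i
    rw [eLpNorm_congr_ae hz, eLpNorm_zero, mul_zero] at this
    simpa using this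
  have h2 : ∫ x in O, weakPartial O 2 (v 2) x = ∫ y in Ω, h y := by
    have hh1 := hh.memL2
    obtain ⟨-, θ, hθ, ht, -⟩ := hh
    choose W hW hWe hW0 hWi using fun k => hG.exists_isTest_extension (hθ k)
    have hWt : ∀ k, HasTrace O (W k) (W k) := fun k => by
      refine (hW k).hasTrace hG.isOpen ⟨(hW k).1.continuous.aestronglyMeasurable, ?_⟩
      refine (hsurf _ ?_).trans_lt (ENNReal.mul_lt_top hC'.lt_top ?_)
      · filter_upwards [ae_restrict_mem isClosed_frontier.measurableSet] with x hx hxΩ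
          using hW0 k x hx hxΩ
      · rw [show W k ∘ embed = θ k from funext (hWe k)]
        exact (hθ k).memL2.2
    have hle : ∀ k, ‖(∫ x in O, weakPartial O 2 (v 2) x) - ∫ y in Ω, θ k y‖ₑ
        ≤ C * (C' * eLpNorm (θ k - h) 2 (volume.restrict Ω)) := by
      intro k
      have h1 := hbd _ _ ((hg 2).sub hG.isOpen (hWt k)) 2
      have e1 : ∫ x in O, weakPartial O 2 (v 2 - W k) x
          = (∫ x in O, weakPartial O 2 (v 2) x) - ∫ y in Ω, θ k y := by
        rw [← hWi k, integral_congr_ae ((hg 2).1.weakPartial_sub hG.isOpen (hWt k).1 2)]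
        simp only [Pi.sub_apply]
        rw [integral_sub (hint 2) (((hWt k).1.hasWeakPartial 2).1.integrable one_le_two),
          integral_congr_ae (((hW k).hasWeakPartial 2).weakPartial_ae hG.isOpen)]
      rw [e1] at h1
      refine h1.trans (mul_le_mul_right ?_ _)
      refine (hsurf _ ?_).trans (mul_le_mul_right (le_of_eq ?_) _)
      · filter_upwards [hG.ae_surf_mem, hS, ae_restrict_mem isClosed_frontier.measurableSet]
          with x hx hxS hxf hxΩ
        rw [Pi.sub_apply, hxS (hx.resolve_right hxΩ) 2, hW0 k x hxf hxΩ, sub_zero]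
      · rw [eLpNorm_sub_comm]
        refine eLpNorm_congr_ae ?_
        filter_upwards [hΩ] with y hy
        simp [hWe k y, hy 2]
    have hr : Tendsto (fun k => C * (C' * eLpNorm (θ k - h) 2 (volume.restrict Ω))) atTop (𝓝 0) := by
      have := ENNReal.Tendsto.const_mul (ENNReal.Tendsto.const_mul ht.1 (Or.inr hC')) (Or.inr hC)
      simpa using this
    have t1 : Tendsto (fun k => ∫ y in Ω, θ k y) atTop
        (𝓝 (∫ x in O, weakPartial O 2 (v 2) x)) := by
      rw [tendsto_iff_edist_tendsto_0]
      refine tendsto_of_tendsto_of_tendsto_of_le_of_le tendsto_const_nhds hr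
        (fun _ => zero_le) fun k => ?_
      rw [edist_comm, edist_eq_enorm_sub]
      exact hle k
    have t2 := tendsto_integral_smul_right (φ := fun _ => (1 : ℝ)) (memLp_const _)
      (fun k => (hθ k).memL2) hh1 ht.1
    simp only [one_smul] at t2
    exact tendsto_nhds_unique t1 t2
  simp only [weakDiv]
  rw [integral_finsetSum _ fun i _ => hint i, Fin.sum_univ_three, h0 0 (by decide),
    h0 1 (by decide), h2, zero_add, zero_add]

end FSI

namespace FSI

/-! ### Invariance of the mean value -/

variable {𝕜 : Type*} [RCLike 𝕜] {O S : Set (E 3)} {Ω : Set (E 2)} {U : Fin 3 → E 3 → ℝ}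
  {ν lam η : ℝ} {φ : State 𝕜}

theorem hasTransport_transport {p : E 3 → 𝕜} (h : ∃ g, HasTransport O U p g) :
    HasTransport O U p (transport O U p) := by
  rw [transport, dif_pos h]
  exact h.choose_spec

theorem memL2_stressDiv {p : E 3 → 𝕜} {u : Fin 3 → E 3 → 𝕜} {i : Fin 3}
    (h : ∃ g, HasStressDiv O ν lam p u i g) : MemL2 O (stressDiv O ν lam p u i) := by
  rw [stressDiv, dif_pos h]
  exact h.choose_spec.1

theorem memL2_plateForce {p : E 3 → 𝕜} {u : Fin 3 → E 3 → 𝕜} {w : E 2 → 𝕜}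
    (h : ∃ f, HasPlateForce O S Ω ν lam p u w f) : MemL2 Ω (plateForce O S Ω ν lam p u w) := by
  rw [plateForce, dif_pos h]
  exact h.choose_spec.1

theorem memL2_weakDiv {u : Fin 3 → E 3 → 𝕜} (hu : ∀ i, MemH1 O (u i)) : MemL2 O (weakDiv O u) :=
  memLp_finsetSum _ fun i _ => ((hu i).hasWeakPartial i).1

theorem weakDiv_add_ae (hO : IsOpen O) {u f f' : Fin 3 → E 3 → 𝕜} (hf : ∀ i, MemH1 O (f i))
    (hf' : ∀ i, MemH1 O (f' i)) (h : ∀ i, u i =ᵐ[volume.restrict O] f i + f' i) :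
    weakDiv O u =ᵐ[volume.restrict O] weakDiv O f + weakDiv O f' := by
  have h1 : ∀ i, weakPartial O i (u i) =ᵐ[volume.restrict O]
      weakPartial O i (f i) + weakPartial O i (f' i) := fun i =>
    ((((hf i).hasWeakPartial i).add ((hf' i).hasWeakPartial i) (hf i).1 (hf' i).1).congr
      (h i).symm (ae_eq_refl _)).weakPartial_ae hO
  filter_upwards [ae_all_iff.2 h1] with x hx
  simp only [weakDiv, Pi.add_apply, ← Finset.sum_add_distrib]
  exact Finset.sum_congr rfl fun i _ => hx i

theorem memL2_bounded_smul {D : Set (E 3)} {b : E 3 → ℝ} {f : E 3 → 𝕜}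
    (hb : MemLp b ⊤ (volume.restrict D)) (hf : MemL2 D f) : MemL2 D (fun x => b x • f x) :=
  MemLp.smul (p := ⊤) (q := 2) (r := 2) hf hb

namespace MemDomain

theorem memL2_plateTransport (h : MemDomain O S Ω U ν lam φ) :
    MemL2 Ω (plateTransport O Ω U φ.w₁) := by
  have := h.velocity_mem.memL2.sub h.w₂_mem
  rwa [add_sub_cancel_left] at this

theorem opAB_mem_energySpace (h : MemDomain O S Ω U ν lam φ) (hU : IsAmbientField O Ω U) :
    opAB O S Ω U ν lam η φ ∈ energySpace 𝕜 O Ω := by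
  refine ⟨?_, fun i => ?_, h.velocity_mem, ?_⟩
  · exact ((hasTransport_transport h.transport_mem).1.neg.sub (memL2_weakDiv h.u_mem)).add
      (memL2_bounded_smul hU.div_bounded h.p_mem).neg
  · refine MemLp.add ?_ MemLp.zero
    exact ((memL2_stressDiv (h.stressDiv_mem i)).sub ((h.u_mem i).1.const_smul η)).sub
      (memLp_finsetSum _ fun j _ => memL2_bounded_smul (hU.bounded j)
        ((h.u_mem i).hasWeakPartial j).1)
  · exact (memL2_plateForce h.plateForce_mem).add MemLp.zero

/-- The flux of the velocity through the boundary is the flux through the plate. -/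
theorem integral_weakDiv (h : MemDomain O S Ω U ν lam φ) (hG : IsFlowGeometry O S Ω) :
    ∫ x in O, weakDiv O φ.u x = ∫ y in Ω, (φ.w₂ + plateTransport O Ω U φ.w₁) y := by
  have : IsFiniteMeasure (volume.restrict O) := ⟨by simpa using hG.isBounded.measure_lt_top⟩
  obtain ⟨f₀, f₁, h0, h1, hsum⟩ := h.velocity_match
  have hf0 : ∀ i, MemH1 O (f₀ i) := by
    obtain ⟨g, hg, -⟩ := h0
    exact fun i => (hg i).1
  have hf1 : ∀ i, MemH1 O (f₁ i) := by
    obtain ⟨g, hg, -⟩ := h1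
    exact fun i => (hg i).1
  rw [integral_congr_ae (weakDiv_add_ae hG.isOpen hf0 hf1 hsum)]
  simp only [Pi.add_apply (f := weakDiv O f₀)]
  rw [integral_add ((memL2_weakDiv hf0).integrable one_le_two)
    ((memL2_weakDiv hf1).integrable one_le_two),
    integral_weakDiv_eq_zero hG.isOpen hG.isBounded hG.lipschitz h0,
    h1.integral_weakDiv hG h.velocity_mem, zero_add]

theorem mean_opA (h : MemDomain O S Ω U ν lam φ) (hG : IsFlowGeometry O S Ω)
    (hU : IsAmbientField O Ω U) :
    mean O Ω (opA O S Ω U ν lam η φ) = - mean O Ω (opB O Ω U φ) := by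
  have : IsFiniteMeasure (volume.restrict O) := ⟨by simpa using hG.isBounded.measure_lt_top⟩
  have : IsFiniteMeasure (volume.restrict Ω) := ⟨by simpa using hG.isBounded_plate.measure_lt_top⟩
  have hT := hasTransport_transport h.transport_mem
  have h1 := hT.integral_eq hG.isOpen hG.isBounded hG.lipschitz hU.memV0 h.p_mem
  have h2 := h.integral_weakDiv hG
  simp only [Pi.add_apply] at h2
  rw [integral_add (h.w₂_mem.integrable one_le_two)
    (h.memL2_plateTransport.integrable one_le_two)] at h2
  change (∫ x in O, (- transport O U φ.p x - weakDiv O φ.u x)) + ∫ y in Ω, φ.w₂ y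
    = - ((∫ x in O, - (weakDiv O U x • φ.p x)) + ∫ y in Ω, plateTransport O Ω U φ.w₁ y)
  have hi : Integrable (fun x => - transport O U φ.p x) (volume.restrict O) :=
    (hT.1.integrable one_le_two).neg
  rw [integral_sub hi ((memL2_weakDiv h.u_mem).integrable one_le_two), integral_neg,
    integral_neg, h1, h2]
  ring

theorem mean_opAB (h : MemDomain O S Ω U ν lam φ) (hG : IsFlowGeometry O S Ω)
    (hU : IsAmbientField O Ω U) : mean O Ω (opAB O S Ω U ν lam η φ) = 0 := by
  have : IsFiniteMeasure (volume.restrict O) := ⟨by simpa using hG.isBounded.measure_lt_top⟩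
  have : IsFiniteMeasure (volume.restrict Ω) := ⟨by simpa using hG.isBounded_plate.measure_lt_top⟩
  have e : mean O Ω (opAB O S Ω U ν lam η φ)
      = mean O Ω (opA O S Ω U ν lam η φ) + mean O Ω (opB O Ω U φ) := by
    have i1 : Integrable (opA O S Ω U ν lam η φ).p (volume.restrict O) :=
      ((hasTransport_transport h.transport_mem).1.neg.sub (memL2_weakDiv h.u_mem)).integrable
        one_le_two
    have i2 : Integrable (opB O Ω U φ).p (volume.restrict O) :=
      (memL2_bounded_smul hU.div_bounded h.p_mem).neg.integrable one_le_two
    have i3 : Integrable (opA O S Ω U ν lam η φ).w₁ (volume.restrict Ω) :=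
      h.w₂_mem.integrable one_le_two
    have i4 : Integrable (opB O Ω U φ).w₁ (volume.restrict Ω) :=
      h.memL2_plateTransport.integrable one_le_two
    have a1 := integral_add i1 i2
    have a2 := integral_add i3 i4
    unfold mean
    rw [add_add_add_comm, ← a1, ← a2]
    rfl
  rw [e, h.mean_opA hG hU, neg_add_cancel]

end MemDomain

end FSI

theorem lemma3 {𝕜 : Type*} [RCLike 𝕜] (O S : Set (E 3)) (Ω : Set (E 2))
    (hG : IsFlowGeometry O S Ω) (U : Fin 3 → E 3 → ℝ) (hU : IsAmbientField O Ω U)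
    (ν lam η : ℝ) (hν : 0 < ν) (hlam : 0 ≤ lam) (hη : 0 < η) :
    (nullVec 𝕜 Ω ∈ energySpace 𝕜 O Ω ∧
      ∀ φ ∈ energySpace 𝕜 O Ω,
        (φ ∈ HNperp 𝕜 O Ω ↔ ∀ χ ∈ HN 𝕜 Ω, energyInner O Ω φ χ = 0)) ∧
    ∀ φ : State 𝕜, MemDomain O S Ω U ν lam φ → φ ∈ HNperp 𝕜 O Ω →
      opAB O S Ω U ν lam η φ ∈ HNperp 𝕜 O Ω ∧
      energyInner O Ω (opAB O S Ω U ν lam η φ) (nullVec 𝕜 Ω) = 0 ∧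
      mean O Ω (opA O S Ω U ν lam η φ) = - mean O Ω (opB O Ω U φ) := by
  have hb := hG.isBounded_plate
  refine ⟨⟨nullVec_mem_energySpace hG.isBounded hG.isOpen_plate hb, fun φ hφ =>
    mem_HNperp_iff hG.isOpen_plate hb hφ⟩, fun φ hD _ => ?_⟩
  have hmem := hD.opAB_mem_energySpace (η := η) hU
  have hmean := hD.mean_opAB (η := η) hG hU
  refine ⟨⟨hmem, hmean⟩, ?_, hD.mean_opA hG hU⟩
  rw [energyInner_nullVec hG.isOpen_plate hb hmem, hmean]
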